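/- Let $n\ge 1$ and let $a\in(0,1)$ be irrational. On the unit sphere $S^{2n+1}\subset\mathbb{C}^{n+1}=\mathbb{C}\oplus\mathbb{C}^n$ with its round metric $g_0$, let $T_0$ be the vector field $z\mapsto iz$, let $T_1$ be the vector field $z=(z_0,z')\mapsto(iz_0,0)$, and put $T=T_0+aT_1$ and $Q=T_0^{\perp_{g_0}}$. Then there is exactly one smooth Riemannian metric $g$ on $S^{2n+1}$ such that $g(T,T)=1$, $g(T,Q)=0$ and $g|_Q=g_0(T,T_0)^{-1}\,g_0|_Q$, and it has the following properties. 1. $T$ is a Sasakian structure on $(S^{2n+1},g)$: it is a Killing vector field of unit length, and the Levi-Civita connection $\nabla$ of $g$ satisfies $\nabla_X\nabla_YT-\nabla_{\nabla_XY}T=g(T,Y)X-g(X,Y)T$ for all vector fields $X,Y$. 2. $T$ is irregular: its flow has an orbit that is not closed (not periodic). 3. The action of $U(1)\times U(n)$ on $S^{2n+1}$, where $U(1)$ acts on $\mathbb{C}$ and $U(n)$ on $\mathbb{C}^n$, is by smooth isometries of $g$, and its generic orbits have codimension $1$: all points of some dense open subset have orbits that are embedded submanifolds of codimension $1$. 4.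 $(S^{2n+1},g)$ has cohomogeneity one: all points of some dense open subset have orbits under the full isometry group of $g$ that are embedded submanifolds of codimension $1$. In particular, in every odd dimension $\ge 3$ there is a compact irregular Sasakian manifold of cohomogeneity one, the smallest value possible for a non-homogeneous manifold. -/

import Mathlib

open scoped Manifold ContDiff Bundle

noncomputable section

section RiemannianNotions

variable {E : Type*} [NormedAddCommGroup E] [NormedSpace ℝ E]
  {H : Type*} [TopologicalSpace H] {I : ModelWithCorners ℝ E H}
  {M : Type*} [TopologicalSpace M] [ChartedSpace H M] [IsManifold I ∞ M]

/-- A vector field is smooth if it is a smooth section of the tangent bundle. -/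
def SmoothField (X : (x : M) → TangentSpace I x) : Prop :=
  ContMDiff I I.tangent ∞ (fun x => (⟨x, X x⟩ : TangentBundle I M))

/-- Smooth Riemannian metrics on `M`. -/
abbrev RMetric (I : ModelWithCorners ℝ E H) (M : Type*) [TopologicalSpace M]
    [ChartedSpace H M] [IsManifold I ∞ M] :=
  Bundle.ContMDiffRiemannianMetric I ∞ E (TangentSpace I : M → Type _)

/-- `ξ` is a Killing field of `g`: it is smooth and `L_ξ g = 0`, that is,
`ξ (g(X, Y)) = g([ξ, X], Y) + g(X, [ξ, Y])` for all smooth vector fields `X`, `Y`. -/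
def IsKilling (g : RMetric I M) (ξ : (x : M) → TangentSpace I x) : Prop :=
  SmoothField ξ ∧ ∀ X Y : (x : M) → TangentSpace I x, SmoothField X → SmoothField Y → ∀ x : M,
    mvfderiv I (fun y => g.inner y (X y) (Y y)) x (ξ x) =
      g.inner x (VectorField.mlieBracket I ξ X x) (Y x) +
        g.inner x (X x) (VectorField.mlieBracket I ξ Y x)

/-- `cov` is the Levi-Civita connection of `g`: it is torsion-free and `g` is parallel.
Here `cov Y x v` is the value at `x` of the covariant derivative of `Y` in the direction `v`. -/
structure IsLeviCivita [FiniteDimensional ℝ E] [CompleteSpace E] (g : RMetric I M)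
    (cov : CovariantDerivative I E (TangentSpace I : M → Type _)) : Prop where
  torsion_free : cov.torsion = 0
  metric : ∀ Y Z : (x : M) → TangentSpace I x, SmoothField Y → SmoothField Z →
    ∀ (x : M) (v : TangentSpace I x),
      mvfderiv I (fun y => g.inner y (Y y) (Z y)) x v =
        g.inner x (cov Y x v) (Z x) + g.inner x (Y x) (cov Z x v)

/-- `ξ` is a Sasakian structure on `(M, g)`: a Killing field of unit length with
`(∇_v (∇ξ)) Y = ∇_v (∇_Y ξ) - ∇_{∇_v Y} ξ = (ξ ∧ v) Y = g(ξ, Y) v - g(v, Y) ξ`,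
where `∇` is the Levi-Civita connection of `g`. -/
def IsSasakian [FiniteDimensional ℝ E] [CompleteSpace E] (g : RMetric I M)
    (ξ : (x : M) → TangentSpace I x) : Prop :=
  IsKilling g ξ ∧ (∀ x, g.inner x (ξ x) (ξ x) = 1) ∧
  ∃ cov : CovariantDerivative I E (TangentSpace I : M → Type _), IsLeviCivita g cov ∧
    ∀ Y : (x : M) → TangentSpace I x, SmoothField Y → ∀ (x : M) (v : TangentSpace I x),
      cov (fun y => cov ξ y (Y y)) x v - cov ξ x (cov Y x v) =
        g.inner x (ξ x) (Y x) • v - g.inner x v (Y x) • ξ x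

/-- `φ` preserves the metric `g`, i.e. the pullback of `g` by `φ` is `g`. -/
def PreservesMetric (g : RMetric I M) (φ : M → M) : Prop :=
  ∀ (x : M) (v w : TangentSpace I x),
    g.inner (φ x) (mfderiv I I φ x v) (mfderiv I I φ x w) = g.inner x v w

/-- The orbit of `x` under the full isometry group of `(M, g)`. -/
def isometryOrbit (g : RMetric I M) (x : M) : Set M :=
  {y | ∃ φ : M ≃ₘ^∞⟮I, I⟯ M, PreservesMetric g φ ∧ φ x = y}

end RiemannianNotions

section OrbitNotions

variable {E : Type*} [NormedAddCommGroup E] [NormedSpace ℝ E]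
  {H : Type*} [TopologicalSpace H] {I : ModelWithCorners ℝ E H}
  {M : Type*} [TopologicalSpace M] [ChartedSpace H M]

/-- The flow of `ξ` has an orbit that is not closed, i.e. not periodic. -/
def IsIrregular (ξ : (x : M) → TangentSpace I x) : Prop :=
  ∃ γ : ℝ → M, IsMIntegralCurve γ ξ ∧ ¬ ∃ p : ℝ, 0 < p ∧ Function.Periodic γ p

/-- `S` is an embedded smooth submanifold of codimension `k`: near each of its points it is the
zero set of a submersion to `ℝᵏ`. -/
def IsSubmanifoldOfCodim (I : ModelWithCorners ℝ E H) (k : ℕ) (S : Set M) : Prop :=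
  ∀ x ∈ S, ∃ (U : Set M) (f : M → EuclideanSpace ℝ (Fin k)), IsOpen U ∧ x ∈ U ∧
    ContMDiffOn I 𝓘(ℝ, EuclideanSpace ℝ (Fin k)) ∞ f U ∧
    (∀ y ∈ U, Function.Surjective (mvfderiv I f y)) ∧
    S ∩ U = {y | y ∈ U ∧ f y = 0}

/-- Generic orbits have codimension `k`: there is a dense open set of points whose orbits are
embedded submanifolds of codimension `k`. Here `orb x` is the orbit of `x`. -/
def GenericOrbitsHaveCodim (I : ModelWithCorners ℝ E H) (orb : M → Set M) (k : ℕ) : Prop :=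
  ∃ U : Set M, IsOpen U ∧ Dense U ∧ ∀ x ∈ U, IsSubmanifoldOfCodim I k (orb x)

/-- `(M, g)` has cohomogeneity `k`: the generic orbits of its isometry group have codimension `k`. -/
def HasCohomogeneity [IsManifold I ∞ M] (g : RMetric I M) (k : ℕ) : Prop :=
  GenericOrbitsHaveCodim I (isometryOrbit g) k

end OrbitNotions

section Sphere

/-- The Hermitian space `ℂⁿ⁺¹`, split as the line of the coordinate `0` plus its orthogonal
complement `ℂⁿ`. -/
abbrev Cn (n : ℕ) := EuclideanSpace ℂ (Fin (n + 1))

/-- The unit sphere `S²ⁿ⁺¹` in `ℂⁿ⁺¹`. -/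
abbrev Sph (n : ℕ) := Metric.sphere (0 : Cn n) 1

instance finrank_Cn (n : ℕ) : Fact (Module.finrank ℝ (Cn n) = (2 * n + 1) + 1) := ⟨by
  rw [← Module.finrank_mul_finrank ℝ ℂ (Cn n)]
  simp
  ring⟩

/-- The differential at `x` of the inclusion of the sphere into `ℂⁿ⁺¹`. -/
def dIncl (n : ℕ) (x : Sph n) : TangentSpace (𝓡 (2 * n + 1)) x →L[ℝ] Cn n :=
  mvfderiv (𝓡 (2 * n + 1)) (fun y : Sph n => (y : Cn n)) x

/-- The round metric of the sphere at `x`. -/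
def g₀ (n : ℕ) (x : Sph n) (v w : TangentSpace (𝓡 (2 * n + 1)) x) : ℝ :=
  inner ℝ (dIncl n x v) (dIncl n x w)

theorem exists_tangent (n : ℕ) (x : Sph n) (u : Cn n) (hu : inner ℝ (x : Cn n) u = 0) :
    ∃ v : TangentSpace (𝓡 (2 * n + 1)) x, dIncl n x v = u := by
  have h : u ∈ (mvfderiv (𝓡 (2 * n + 1)) ((↑) : Sph n → Cn n) x).range := by
    rw [range_mvfderiv_subtypeVal]
    exact Submodule.mem_orthogonal_singleton_iff_inner_right.2 hu
  exact h

/-- Multiplication by `i` on `ℂⁿ⁺¹`. -/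
def J₀ (n : ℕ) (z : Cn n) : Cn n := Complex.I • z

/-- Multiplication by `i` on the coordinate `0`, and `0` on the other coordinates. -/
def J₁ (n : ℕ) (z : Cn n) : Cn n := EuclideanSpace.single 0 (Complex.I * z 0)

theorem inner_J₀ (n : ℕ) (z : Cn n) : inner ℝ z (J₀ n z) = 0 := by
  rw [PiLp.inner_apply]
  refine Finset.sum_eq_zero fun i _ => ?_
  simp [J₀, Complex.inner]
  ring

theorem inner_J₁ (n : ℕ) (z : Cn n) : inner ℝ z (J₁ n z) = 0 := by
  rw [PiLp.inner_apply]
  refine Finset.sum_eq_zero fun i _ => ?_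
  by_cases h : i = 0
  · subst h
    simp [J₁, Complex.inner]
    ring
  · simp [J₁, h]

/-- The vector field on the sphere induced by `J₀`: its value at `x` is the tangent vector whose
image in `ℂⁿ⁺¹` is `J₀ x`. -/
def T₀ (n : ℕ) (x : Sph n) : TangentSpace (𝓡 (2 * n + 1)) x :=
  (exists_tangent n x (J₀ n x) (inner_J₀ n x)).choose

/-- The vector field on the sphere induced by `J₁`: its value at `x` is the tangent vector whose
image in `ℂⁿ⁺¹` is `J₁ x`. -/
def T₁ (n : ℕ) (x : Sph n) : TangentSpace (𝓡 (2 * n + 1)) x :=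
  (exists_tangent n x (J₁ n x) (inner_J₁ n x)).choose

/-- The vector field `T₀ + a T₁`. -/
def Tfield (n : ℕ) (a : ℝ) (x : Sph n) : TangentSpace (𝓡 (2 * n + 1)) x :=
  T₀ n x + a • T₁ n x

/-- The characterization of the deformed metric, with `Q` the `g₀`-orthogonal of `T₀`: `T` has unit
length, is orthogonal to `Q`, and `g = g₀(T, T₀)⁻¹ g₀` on `Q`. -/
def IsDeformedMetric (n : ℕ) (a : ℝ) (g : RMetric (𝓡 (2 * n + 1)) (Sph n)) : Prop :=
  ∀ x : Sph n, g.inner x (Tfield n a x) (Tfield n a x) = 1 ∧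
    (∀ v, g₀ n x (T₀ n x) v = 0 → g.inner x (Tfield n a x) v = 0) ∧
    (∀ v w, g₀ n x (T₀ n x) v = 0 → g₀ n x (T₀ n x) w = 0 →
      g.inner x v w = (g₀ n x (Tfield n a x) (T₀ n x))⁻¹ * g₀ n x v w)

/-- The action of `(u, A)` in `U(1) × U(n)` on `ℂⁿ⁺¹ = ℂ ⊕ ℂⁿ`. -/
def blockMap (n : ℕ) (h : Circle × Matrix.unitaryGroup (Fin n) ℂ) (z : Cn n) : Cn n :=
  WithLp.toLp 2 (Fin.cons ((h.1 : ℂ) * z 0)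
    ((h.2 : Matrix (Fin n) (Fin n) ℂ).mulVec fun i => z i.succ))

theorem norm_blockMap (n : ℕ) (h : Circle × Matrix.unitaryGroup (Fin n) ℂ) (z : Cn n) :
    ‖blockMap n h z‖ = ‖z‖ := by
  have key : ∀ w : Fin n → ℂ,
      ∑ i, ‖(h.2 : Matrix (Fin n) (Fin n) ℂ).mulVec w i‖ ^ 2 = ∑ i, ‖w i‖ ^ 2 := by
    intro w
    have hs : ∀ v : Fin n → ℂ, ((∑ i, ‖v i‖ ^ 2 : ℝ) : ℂ) = star v ⬝ᵥ v := by
      intro v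
      simp [dotProduct, ← Complex.normSq_eq_norm_sq, Complex.normSq_eq_conj_mul_self]
    have hU : (star (h.2 : Matrix (Fin n) (Fin n) ℂ)) * (h.2 : Matrix (Fin n) (Fin n) ℂ) = 1 :=
      Matrix.UnitaryGroup.star_mul_self h.2
    apply Complex.ofReal_injective
    rw [hs, hs, Matrix.star_mulVec, ← Matrix.dotProduct_mulVec, Matrix.mulVec_mulVec,
      ← Matrix.star_eq_conjTranspose, hU, Matrix.one_mulVec]
  rw [EuclideanSpace.norm_eq, EuclideanSpace.norm_eq, Fin.sum_univ_succ, Fin.sum_univ_succ]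
  congr 1
  have hz := key fun i => z i.succ
  have hu : ‖(h.1 : ℂ)‖ = 1 := Circle.norm_coe h.1
  simp [blockMap, hz, hu]

/-- The action of `U(1) × U(n)` on the sphere. -/
instance sphAction (n : ℕ) :
    MulAction (Circle × Matrix.unitaryGroup (Fin n) ℂ) (Sph n) where
  smul h x := ⟨blockMap n h x, by simp [norm_blockMap]⟩
  one_smul x := by
    apply Subtype.ext
    change blockMap n 1 x = x
    ext i
    refine Fin.cases ?_ (fun j => ?_) i <;> simp [blockMap]
  mul_smul h k x := by
    apply Subtype.ext
    change blockMap n (h * k) x = blockMap n h (blockMap n k x)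
    ext i
    refine Fin.cases ?_ (fun j => ?_) i
    · simp [blockMap, mul_assoc]
    · simp [blockMap, Matrix.mulVec_mulVec]

end Sphere

end

/-! Write `f = 1 + a|z₀|²` (`conf`) and `η = Im⟨x, ·⟩ / f` (`ctForm`). Then `η(T) = 1`, `ker η = Q`,
and the metric has to be `η² + f⁻¹ g₀`, the second term being taken on the projection along `T`
(`proj`). Since `T` and `Q` span the tangent space, nothing else is possible.

Its Levi-Civita connection is given in closed form by `lcConn`. For fields split as `ηT + y`, its
horizontal part is `transConn`, a complex linear connection on `Q` compatible with the Hermitian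
form `f⁻¹⟨·, ·⟩`. One reads off `∇T = i ∘ proj`. This is skew, so `T` is Killing, and as `i` is
transversally parallel, the Sasakian equation follows. The flow of `T` is a line of slope `a` in a
two-torus, hence not periodic for irrational `a`.

Since `U(n)` is transitive on the spheres of `ℂⁿ`, the orbits of `U(1) × U(n)` are the level sets of
`rho = |z₀|²`. The hard part is that no isometry `φ` moves a generic point to another level. A
solution `ξ` of the Sasakian equation satisfies `R(X, Y)ξ = g(ξ, Y)X - g(ξ, X)Y`. Take `ξ = φ^*T`
and pair with the horizontal projection `ν` of the coordinate vector `e₀`, whose curvature is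
explicit. The result (`inner_obstr_eq_zero`) is that `proj ξ` is orthogonal to `obstr`, which forces
`proj ξ = 0` except at three values of `rho` (`projF_eq_zero`). Hence `φ` carries `T` to `±T` along
generic flow lines and intertwines the flows (`map_flow`). By density of the irrational line it also
intertwines the rotations of `z₀` (`map_rotation`), so `dφ(T₁) = ±T₁`. Thus `g(T, T₁) = rho / (1 + a
rho)` is preserved up to sign, and with it `rho` (`rho_map_eq`). -/

noncomputable section

/-! ### Directional derivatives of vector-valued functions on a manifold -/

section DirectionalDerivative

open Set

variable {E : Type*} [NormedAddCommGroup E] [NormedSpace ℝ E]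
  {H : Type*} [TopologicalSpace H] {I : ModelWithCorners ℝ E H}
  {M : Type*} [TopologicalSpace M] [ChartedSpace H M]
  {V W Z : Type*} [NormedAddCommGroup V] [NormedSpace ℝ V] [NormedAddCommGroup W]
  [NormedSpace ℝ W] [NormedAddCommGroup Z] [NormedSpace ℝ Z]

/-- `F` is differentiable at `x` and its derivative in the direction `v` is `w`. -/
def HasD (I : ModelWithCorners ℝ E H) (F : M → W) (x : M) (v : TangentSpace I x) (w : W) : Prop :=
  MDifferentiableAt I 𝓘(ℝ, W) F x ∧ mvfderiv I F x v = w

theorem HasD.of_mdiff {F : M → W} {x : M} {v : TangentSpace I x}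
    (h : MDifferentiableAt I 𝓘(ℝ, W) F x) : HasD I F x v (mvfderiv I F x v) := ⟨h, rfl⟩

theorem HasD.congr_deriv {F : M → W} {x : M} {v : TangentSpace I x} {w w' : W}
    (h : HasD I F x v w) (e : w = w') : HasD I F x v w' := e ▸ h

theorem HasD.unique {F : M → W} {x : M} {v : TangentSpace I x} {w w' : W}
    (h : HasD I F x v w) (h' : HasD I F x v w') : w = w' := h.2.symm.trans h'.2

theorem HasD.fderiv_comp {Φ : W → Z} {L : W →L[ℝ] Z} {F : M → W} {x : M} {v : TangentSpace I x}
    {w : W} (hΦ : HasFDerivAt Φ L (F x)) (h : HasD I F x v w) :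
    HasD I (fun y => Φ (F y)) x v (L w) := by
  obtain ⟨h1, rfl⟩ := h
  have h2 : HasMFDerivAt I 𝓘(ℝ, Z) (Φ ∘ F) x (L.comp (mfderiv I 𝓘(ℝ, W) F x)) :=
    HasMFDerivAt.comp x hΦ.hasMFDerivAt h1.hasMFDerivAt
  refine ⟨h2.mdifferentiableAt, ?_⟩
  have h3 := h2.mfderiv
  change mfderiv I 𝓘(ℝ, Z) (Φ ∘ F) x v = _
  rw [h3]
  rfl

theorem HasD.prodMk {F : M → W} {G : M → Z} {x : M} {v : TangentSpace I x} {w : W} {z : Z}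
    (h : HasD I F x v w) (h' : HasD I G x v z) : HasD I (fun y => (F y, G y)) x v (w, z) := by
  obtain ⟨h1, rfl⟩ := h
  obtain ⟨h2, rfl⟩ := h'
  have h3 : HasMFDerivAt I 𝓘(ℝ, W × Z) (fun y => (F y, G y)) x
      ((mvfderiv I F x).prod (mvfderiv I G x)) :=
    ⟨h1.continuousAt.prodMk h2.continuousAt, h1.hasMFDerivAt.2.prodMk h2.hasMFDerivAt.2⟩
  refine ⟨h3.mdifferentiableAt, ?_⟩
  change mfderiv I 𝓘(ℝ, W × Z) (fun y => (F y, G y)) x v = _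
  rw [h3.mfderiv]
  rfl

theorem HasD.const (c : W) (x : M) (v : TangentSpace I x) : HasD I (fun _ => c) x v 0 :=
  ⟨mdifferentiableAt_const, by rw [mvfderiv_const]; rfl⟩

/-- The product rules for real and complex scalars and for the real inner product are this rule with
different bilinear maps. -/
theorem HasD.bilin {F : M → W} {G : M → Z} {x : M} {v : TangentSpace I x} {w : W} {z : Z}
    (B : W →L[ℝ] Z →L[ℝ] V) (h : HasD I F x v w) (h' : HasD I G x v z) :
    HasD I (fun y => B (F y) (G y)) x v (B w (G x) + B (F x) z) := by
  have := HasD.fderiv_comp (Φ := fun p : W × Z => B p.1 p.2)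
    (F := fun y => (F y, G y))
    (B.hasFDerivAt_of_bilinear (hasFDerivAt_fst (p := (F x, G x))) hasFDerivAt_snd) (h.prodMk h')
  refine this.congr_deriv ?_
  simp [add_comm]

theorem HasD.clm {F : M → W} {x : M} {v : TangentSpace I x} {w : W} (L : W →L[ℝ] Z)
    (h : HasD I F x v w) : HasD I (fun y => L (F y)) x v (L w) :=
  HasD.fderiv_comp L.hasFDerivAt h

theorem HasD.add {F G : M → W} {x : M} {v : TangentSpace I x} {w w' : W}
    (h : HasD I F x v w) (h' : HasD I G x v w') : HasD I (fun y => F y + G y) x v (w + w') :=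
  HasD.fderiv_comp (Φ := fun p : W × W => p.1 + p.2)
    ((hasFDerivAt_fst (p := (F x, G x))).add hasFDerivAt_snd) (h.prodMk h')

theorem HasD.sub {F G : M → W} {x : M} {v : TangentSpace I x} {w w' : W}
    (h : HasD I F x v w) (h' : HasD I G x v w') : HasD I (fun y => F y - G y) x v (w - w') :=
  HasD.fderiv_comp (Φ := fun p : W × W => p.1 - p.2)
    ((hasFDerivAt_fst (p := (F x, G x))).sub hasFDerivAt_snd) (h.prodMk h')

theorem HasD.neg {F : M → W} {x : M} {v : TangentSpace I x} {w : W}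
    (h : HasD I F x v w) : HasD I (fun y => -F y) x v (-w) :=
  HasD.fderiv_comp (Φ := fun p : W => -p) (hasFDerivAt_id (F x)).neg h

theorem HasD.smul {c : M → ℝ} {F : M → W} {x : M} {v : TangentSpace I x} {r : ℝ} {w : W}
    (h : HasD I c x v r) (h' : HasD I F x v w) :
    HasD I (fun y => c y • F y) x v (r • F x + c x • w) :=
  HasD.bilin (ContinuousLinearMap.lsmul ℝ ℝ) h h'

theorem HasD.csmul [NormedSpace ℂ W] {c : M → ℂ} {F : M → W} {x : M} {v : TangentSpace I x}
    {r : ℂ} {w : W} [IsScalarTower ℝ ℂ W]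
    (h : HasD I c x v r) (h' : HasD I F x v w) :
    HasD I (fun y => c y • F y) x v (r • F x + c x • w) :=
  HasD.bilin (ContinuousLinearMap.lsmul ℝ ℂ) h h'

theorem HasD.mul {c d : M → ℝ} {x : M} {v : TangentSpace I x} {r s : ℝ}
    (h : HasD I c x v r) (h' : HasD I d x v s) :
    HasD I (fun y => c y * d y) x v (r * d x + c x * s) :=
  HasD.bilin (ContinuousLinearMap.mul ℝ ℝ) h h'

theorem HasD.cmul {c d : M → ℂ} {x : M} {v : TangentSpace I x} {r s : ℂ}
    (h : HasD I c x v r) (h' : HasD I d x v s) :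
    HasD I (fun y => c y * d y) x v (r * d x + c x * s) :=
  HasD.bilin (ContinuousLinearMap.mul ℝ ℂ) h h'

theorem HasD.inv {c : M → ℝ} {x : M} {v : TangentSpace I x} {r : ℝ}
    (h : HasD I c x v r) (hc : c x ≠ 0) :
    HasD I (fun y => (c y)⁻¹) x v (-(c x ^ 2)⁻¹ * r) := by
  refine (HasD.fderiv_comp (hasDerivAt_inv hc).hasFDerivAt h).congr_deriv ?_
  simp [mul_comm]

theorem HasD.inner {x : M} {v : TangentSpace I x} {K : Type*}
    [NormedAddCommGroup K] [InnerProductSpace ℝ K] {F G : M → K} {w w' : K}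
    (h : HasD I F x v w) (h' : HasD I G x v w') :
    HasD I (fun y => inner ℝ (F y) (G y)) x v (inner ℝ w (G x) + inner ℝ (F x) w') :=
  HasD.bilin (innerSL ℝ) h h'

end DirectionalDerivative

/-! ### The Lie bracket as a commutator of derivations -/

section LieBracketDerivation

open Set VectorField

variable {E : Type*} [NormedAddCommGroup E] [NormedSpace ℝ E] [CompleteSpace E]
  {H : Type*} [TopologicalSpace H] {I : ModelWithCorners ℝ E H}
  {M : Type*} [TopologicalSpace M] [ChartedSpace H M] [IsManifold I ∞ M]
  {W : Type*} [NormedAddCommGroup W] [NormedSpace ℝ W]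

theorem contMDiff_mvfderiv_apply {h : M → W} (hh : ContMDiff I 𝓘(ℝ, W) ∞ h)
    {X : (x : M) → TangentSpace I x} (hX : SmoothField X) :
    ContMDiff I 𝓘(ℝ, W) ∞ (fun y => mvfderiv I h y (X y)) := by
  haveI : IsManifold I 1 M := IsManifold.of_le (n := ∞) (by simp)
  have h1 := (hh.contMDiff_tangentMap (m := ∞) (by simp)).comp hX
  exact (contMDiff_snd_tangentBundle_modelSpace W 𝓘(ℝ, W)).comp h1

/-- The pullback of `Z` is the inverse of the derivative of the inverse chart applied to `Z`, and
the chain rule cancels it. Directional derivatives on `M` thus become derivatives in the model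
space. -/
theorem fderivWithin_comp_extChartAt_symm {h : M → W} (x : M) {z : E}
    (hz : z ∈ (extChartAt I x).target)
    (hh : MDifferentiableAt I 𝓘(ℝ, W) h ((extChartAt I x).symm z))
    (Z : (x : M) → TangentSpace I x) :
    fderivWithin ℝ (h ∘ (extChartAt I x).symm) (range I) z
      (mpullbackWithin 𝓘(ℝ, E) I (extChartAt I x).symm Z (range I) z) =
        mvfderiv I h ((extChartAt I x).symm z) (Z ((extChartAt I x).symm z)) := by
  have : IsManifold I 1 M := IsManifold.of_le (n := ∞) (by simp)
  have hinv := isInvertible_mfderivWithin_extChartAt_symm (I := I) (x := x) hz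
  have hzr : z ∈ range I := extChartAt_target_subset_range x hz
  have hc : mfderivWithin 𝓘(ℝ, E) 𝓘(ℝ, W) (h ∘ (extChartAt I x).symm) (range I) z =
      (mfderiv I 𝓘(ℝ, W) h ((extChartAt I x).symm z)).comp
        (mfderivWithin 𝓘(ℝ, E) I (extChartAt I x).symm (range I) z) :=
    mfderiv_comp_mfderivWithin z hh (mdifferentiableWithinAt_extChartAt_symm hz)
      (I.uniqueDiffOn.uniqueMDiffOn _ hzr)
  rw [mfderivWithin_eq_fderivWithin] at hc
  refine (congrArg (fun L => L (mpullbackWithin 𝓘(ℝ, E) I (extChartAt I x).symm Z (range I) z))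
    hc).trans ?_
  change mfderiv I 𝓘(ℝ, W) h ((extChartAt I x).symm z)
    ((mfderivWithin 𝓘(ℝ, E) I (extChartAt I x).symm (range I) z)
      ((mfderivWithin 𝓘(ℝ, E) I (extChartAt I x).symm (range I) z).inverse
        (Z ((extChartAt I x).symm z)))) = _
  rw [hinv.self_apply_inverse]
  rfl

/-- The Lie bracket acts on functions as the commutator of derivations. -/
theorem mvfderiv_mlieBracket {h : M → W} (hh : ContMDiff I 𝓘(ℝ, W) ∞ h)
    {X Y : (x : M) → TangentSpace I x} (hX : SmoothField X) (hY : SmoothField Y) (x : M) :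
    mvfderiv I h x (mlieBracket I X Y x) =
      mvfderiv I (fun y => mvfderiv I h y (Y y)) x (X x) -
        mvfderiv I (fun y => mvfderiv I h y (X y)) x (Y x) := by
  have i1 : IsManifold I 1 M := IsManifold.of_le (n := ∞) (by simp)
  have i2 : IsManifold I 2 M := IsManifold.of_le (n := ∞) (by norm_cast)
  set φ := extChartAt I x with hφ
  let h' : E → W := h ∘ φ.symm
  have hud : UniqueDiffOn ℝ (range I) := I.uniqueDiffOn
  have hxt : φ x ∈ φ.target := mem_extChartAt_target x
  have hxr : φ x ∈ range I := extChartAt_target_subset_range x hxt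
  have hxx : φ.symm (φ x) = x := extChartAt_to_inv x
  have h'smooth : ContDiffWithinAt ℝ ∞ h' (range I) (φ x) := (contMDiffAt_iff.1 (hh x)).2
  have hmd : ∀ {k : M → W}, ContMDiff I 𝓘(ℝ, W) ∞ k → ∀ y, MDifferentiableAt I 𝓘(ℝ, W) k y :=
    fun hk y => (hk y).mdifferentiableAt (by simp)
  have hD : DifferentiableWithinAt ℝ (fderivWithin ℝ h' (range I)) (range I) (φ x) :=
    (h'smooth.fderivWithin_right (m := 1) hud (by norm_cast) hxr).differentiableWithinAt (by simp)
  -- Symmetry of the second derivative removes the second-order terms from the commutator. It also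
  -- holds at boundary points, because `range I` lies in the closure of its interior.
  have hsymm : IsSymmSndFDerivWithinAt ℝ h' (range I) (φ x) :=
    h'smooth.isSymmSndFDerivWithinAt
      (by simp only [minSmoothness_of_isRCLikeNormedField]; norm_cast) hud
      (I.range_subset_closure_interior hxr) hxr
  have hvf : ∀ {Z : (x : M) → TangentSpace I x}, SmoothField Z →
      DifferentiableWithinAt ℝ (mpullbackWithin 𝓘(ℝ, E) I φ.symm Z (range I)) (range I) (φ x) := by
    intro Z hZ
    have := MDifferentiableWithinAt.differentiableWithinAt_mpullbackWithin_vectorField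
      (s := univ) (((hZ x).mdifferentiableAt (by simp)).mdifferentiableWithinAt)
    rw [preimage_univ, univ_inter] at this
    exact this
  -- In the chart the iterated derivative is `D²h(Z, U) + Dh(DU · Z)`.
  have hsnd : ∀ {Z U : (x : M) → TangentSpace I x}, SmoothField Z → SmoothField U →
      mvfderiv I (fun y => mvfderiv I h y (U y)) x (Z x) =
      fderivWithin ℝ (fderivWithin ℝ h' (range I)) (range I) (φ x)
        (mpullbackWithin 𝓘(ℝ, E) I φ.symm Z (range I) (φ x))
        (mpullbackWithin 𝓘(ℝ, E) I φ.symm U (range I) (φ x)) +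
      fderivWithin ℝ h' (range I) (φ x)
        (fderivWithin ℝ (mpullbackWithin 𝓘(ℝ, E) I φ.symm U (range I)) (range I) (φ x)
          (mpullbackWithin 𝓘(ℝ, E) I φ.symm Z (range I) (φ x))) := by
    intro Z U hZ hU
    have e1 := fderivWithin_comp_extChartAt_symm (I := I) x hxt
      (hmd (contMDiff_mvfderiv_apply hh hU) _) Z
    rw [← hφ, hxx] at e1
    rw [← e1]
    have e2 : (fun y => mvfderiv I h y (U y)) ∘ φ.symm =ᶠ[nhdsWithin (φ x) (range I)]
        fun z => fderivWithin ℝ h' (range I) z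
          (mpullbackWithin 𝓘(ℝ, E) I φ.symm U (range I) z) := by
      filter_upwards [extChartAt_target_mem_nhdsWithin x] with z hz
      exact (fderivWithin_comp_extChartAt_symm x hz (hmd hh _) U).symm
    rw [e2.fderivWithin_eq (e2.self_of_nhdsWithin hxr)]
    have e3 := (hD.hasFDerivWithinAt.clm_apply (hvf hU).hasFDerivWithinAt).fderivWithin
      (hud _ hxr)
    refine (congrArg (fun L : E →L[ℝ] W =>
      L (mpullbackWithin 𝓘(ℝ, E) I φ.symm Z (range I) (φ x))) e3).trans ?_
    exact add_comm _ _
  rw [hsnd hX hY, hsnd hY hX]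
  have e4 := hsymm.eq (mpullbackWithin 𝓘(ℝ, E) I φ.symm X (range I) (φ x))
    (mpullbackWithin 𝓘(ℝ, E) I φ.symm Y (range I) (φ x))
  have e5 : mlieBracket I X Y x = lieBracketWithin ℝ
      (mpullbackWithin 𝓘(ℝ, E) I φ.symm X (range I))
      (mpullbackWithin 𝓘(ℝ, E) I φ.symm Y (range I)) (range I) (φ x) := by
    rw [← mlieBracketWithin_univ, mlieBracketWithin_apply, mfderiv_extChartAt_self,
      preimage_univ, univ_inter]
    exact congrArg (fun L : E →L[ℝ] E => L _) ContinuousLinearMap.inverse_id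
  rw [e4, add_sub_add_left_eq_sub, e5, (hmd hh x).mvfderiv]
  exact map_sub (fderivWithin ℝ h' (range I) (φ x)) _ _

end LieBracketDerivation

local instance isManifold_sph (n : ℕ) : IsManifold (𝓡 (2 * n + 1)) ∞ (Sph n) := inferInstance

local instance isManifold_one_sph (n : ℕ) : IsManifold (𝓡 (2 * n + 1)) 1 (Sph n) := inferInstance

local instance topologicalSpace_tangentBundle_sph (n : ℕ) :
    TopologicalSpace (TangentBundle (𝓡 (2 * n + 1)) (Sph n)) := inferInstance

/-! ### Tangent vectors, fields and forms on the sphere seen in `ℂⁿ⁺¹` -/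

section SphereCalculus

open Set

variable {n : ℕ}

theorem contMDiff_incl (n : ℕ) :
    ContMDiff (𝓡 (2 * n + 1)) 𝓘(ℝ, Cn n) ∞ (fun y : Sph n => (y : Cn n)) :=
  contMDiff_coe_sphere

theorem hasD_incl (x : Sph n) (v : TangentSpace (𝓡 (2 * n + 1)) x) :
    HasD (𝓡 (2 * n + 1)) (fun y : Sph n => (y : Cn n)) x v (dIncl n x v) :=
  ⟨(contMDiff_incl n x).mdifferentiableAt (by simp), rfl⟩

theorem dIncl_injective (x : Sph n) : Function.Injective (dIncl n x) :=
  injective_mvfderiv_subtypeVal_sphere x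

theorem inner_dIncl (x : Sph n) (v : TangentSpace (𝓡 (2 * n + 1)) x) :
    inner ℝ (x : Cn n) (dIncl n x v) = 0 := by
  have h : dIncl n x v ∈ (mvfderiv (𝓡 (2 * n + 1)) ((↑) : Sph n → Cn n) x).range := ⟨v, rfl⟩
  rw [range_mvfderiv_subtypeVal] at h
  exact Submodule.mem_orthogonal_singleton_iff_inner_right.1 h

instance (x : Sph n) : FiniteDimensional ℝ (TangentSpace (𝓡 (2 * n + 1)) x) :=
  inferInstanceAs (FiniteDimensional ℝ (EuclideanSpace ℝ (Fin (2 * n + 1))))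

theorem exists_leftInverse_dIncl (x : Sph n) :
    ∃ g : Cn n →L[ℝ] TangentSpace (𝓡 (2 * n + 1)) x, ∀ v, g (dIncl n x v) = v := by
  obtain ⟨g, hg⟩ := LinearMap.exists_leftInverse_of_injective
    (dIncl n x : TangentSpace (𝓡 (2 * n + 1)) x →ₗ[ℝ] Cn n)
    (LinearMap.ker_eq_bot.2 (dIncl_injective x))
  have : FiniteDimensional ℝ (Cn n) := inferInstance
  exact ⟨LinearMap.toContinuousLinearMap g, fun v => LinearMap.congr_fun hg v⟩

/-- A left inverse of the differential of the inclusion of the sphere. -/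
def tlift (n : ℕ) (x : Sph n) : Cn n →L[ℝ] TangentSpace (𝓡 (2 * n + 1)) x :=
  (exists_leftInverse_dIncl x).choose

theorem tlift_dIncl (x : Sph n) (v : TangentSpace (𝓡 (2 * n + 1)) x) :
    tlift n x (dIncl n x v) = v :=
  (exists_leftInverse_dIncl x).choose_spec v

theorem dIncl_tlift (x : Sph n) {u : Cn n} (hu : inner ℝ (x : Cn n) u = 0) :
    dIncl n x (tlift n x u) = u := by
  obtain ⟨v, rfl⟩ := exists_tangent n x u hu
  rw [tlift_dIncl]

theorem smooth_hat {Y : (x : Sph n) → TangentSpace (𝓡 (2 * n + 1)) x} (hY : SmoothField Y) :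
    ContMDiff (𝓡 (2 * n + 1)) 𝓘(ℝ, Cn n) ∞ (fun x => dIncl n x (Y x)) :=
  contMDiff_mvfderiv_apply (contMDiff_incl n) hY

/-- The differential of the inclusion, in the local trivialization of the tangent bundle. -/
def dInclCoord (n : ℕ) (x₀ x : Sph n) : EuclideanSpace ℝ (Fin (2 * n + 1)) →L[ℝ] Cn n :=
  (dIncl n x).comp ((trivializationAt (EuclideanSpace ℝ (Fin (2 * n + 1)))
    (TangentSpace (𝓡 (2 * n + 1)) : Sph n → Type _) x₀).symmL ℝ x)

theorem contMDiffAt_dInclCoord (x₀ : Sph n) :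
    ContMDiffAt (𝓡 (2 * n + 1)) 𝓘(ℝ, EuclideanSpace ℝ (Fin (2 * n + 1)) →L[ℝ] Cn n) ∞
      (dInclCoord n x₀) x₀ := by
  have h := ContMDiffAt.mfderiv_const (m := ∞) (contMDiff_incl n x₀) (by simp)
  refine h.congr_of_eventuallyEq (Filter.Eventually.of_forall fun x => ?_)
  simp only [inTangentCoordinates, ContinuousLinearMap.inCoordinates]
  rw [TangentBundle.continuousLinearMapAt_model_space]
  rfl

theorem dInclCoord_apply_coord (x₀ x : Sph n)
    (hx : x ∈ (trivializationAt (EuclideanSpace ℝ (Fin (2 * n + 1)))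
      (TangentSpace (𝓡 (2 * n + 1)) : Sph n → Type _) x₀).baseSet)
    (v : TangentSpace (𝓡 (2 * n + 1)) x) :
    dInclCoord n x₀ x ((trivializationAt (EuclideanSpace ℝ (Fin (2 * n + 1)))
      (TangentSpace (𝓡 (2 * n + 1)) : Sph n → Type _) x₀).continuousLinearMapAt ℝ x v) =
      dIncl n x v := by
  rw [dInclCoord, ContinuousLinearMap.comp_apply, Bundle.Trivialization.symmL_continuousLinearMapAt _ hx]

theorem dInclCoord_injective (x₀ x : Sph n)
    (hx : x ∈ (trivializationAt (EuclideanSpace ℝ (Fin (2 * n + 1)))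
      (TangentSpace (𝓡 (2 * n + 1)) : Sph n → Type _) x₀).baseSet) :
    Function.Injective (dInclCoord n x₀ x) := by
  set e := trivializationAt (EuclideanSpace ℝ (Fin (2 * n + 1)))
    (TangentSpace (𝓡 (2 * n + 1)) : Sph n → Type _) x₀ with he
  intro u v huv
  have h : e.symmL ℝ x u = e.symmL ℝ x v := dIncl_injective x huv
  rw [← e.continuousLinearMapAt_symmL (R := ℝ) hx u, h, e.continuousLinearMapAt_symmL hx v]

/-- A smooth function with values in the tangent hyperplanes defines a smooth vector field. -/
theorem smoothField_tlift {F : Sph n → Cn n} (hF : ContMDiff (𝓡 (2 * n + 1)) 𝓘(ℝ, Cn n) ∞ F)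
    (hF' : ∀ x : Sph n, inner ℝ (x : Cn n) (F x) = 0) :
    SmoothField (fun x => tlift n x (F x)) := by
  intro x₀
  rw [Bundle.contMDiffAt_section]
  set e := trivializationAt (EuclideanSpace ℝ (Fin (2 * n + 1)))
    (TangentSpace (𝓡 (2 * n + 1)) : Sph n → Type _) x₀ with he
  have hx₀ : x₀ ∈ e.baseSet := FiberBundle.mem_baseSet_trivializationAt' x₀
  -- `tlift` is chosen point by point, with no control in `x`. A left inverse fixed at `x₀` gives a
  -- smooth family `Q` with `Q x₀ = 1`, invertible nearby, and `Q⁻¹ g' F` recovers the coordinates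
  -- of the field.
  obtain ⟨g, hg⟩ := LinearMap.exists_leftInverse_of_injective
    (dInclCoord n x₀ x₀ : EuclideanSpace ℝ (Fin (2 * n + 1)) →ₗ[ℝ] Cn n)
    (LinearMap.ker_eq_bot.2 (dInclCoord_injective x₀ x₀ hx₀))
  let g' : Cn n →L[ℝ] EuclideanSpace ℝ (Fin (2 * n + 1)) := LinearMap.toContinuousLinearMap g
  let Q : Sph n → EuclideanSpace ℝ (Fin (2 * n + 1)) →L[ℝ] EuclideanSpace ℝ (Fin (2 * n + 1)) :=
    fun x => g'.comp (dInclCoord n x₀ x)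
  have hQ : ContMDiffAt (𝓡 (2 * n + 1)) 𝓘(ℝ, _) ∞ Q x₀ :=
    contMDiffAt_const.clm_comp (contMDiffAt_dInclCoord x₀)
  have hQ0 : Q x₀ = ContinuousLinearMap.id ℝ _ := by
    ext1 v
    exact LinearMap.congr_fun hg v
  have hinv : (Q x₀).IsInvertible := by
    rw [hQ0]
    exact ContinuousLinearMap.isInvertible_equiv (f := ContinuousLinearEquiv.refl ℝ _)
  have hQi : ContMDiffAt (𝓡 (2 * n + 1)) 𝓘(ℝ, _) ∞ (fun x => (Q x).inverse) x₀ :=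
    (ContDiffAt.contMDiffAt hinv.contDiffAt_map_inverse).comp x₀ hQ
  have hev : ∀ᶠ x in nhds x₀, (Q x).IsInvertible :=
    hQ.continuousAt.eventually (by
      obtain ⟨L, hL⟩ := hinv
      rw [← hL]
      filter_upwards [L.nhds] with M hM
      exact hM)
  have hsm : ContMDiffAt (𝓡 (2 * n + 1)) 𝓘(ℝ, EuclideanSpace ℝ (Fin (2 * n + 1))) ∞
      (fun x => (Q x).inverse (g' (F x))) x₀ :=
    hQi.clm_apply (contMDiffAt_const.clm_apply (hF x₀))
  refine hsm.congr_of_eventuallyEq ?_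
  filter_upwards [hev, e.open_baseSet.mem_nhds hx₀] with x hx hxb
  have h1 : dInclCoord n x₀ x (e.continuousLinearMapAt ℝ x (tlift n x (F x))) = F x := by
    rw [dInclCoord_apply_coord x₀ x hxb, dIncl_tlift x (hF' x)]
  have h2 : (Q x).inverse (g' (F x)) = e.continuousLinearMapAt ℝ x (tlift n x (F x)) := by
    conv_lhs => rw [← h1]
    exact hx.inverse_apply_self _
  rw [h2, e.continuousLinearMapAt_apply ℝ, e.coe_linearMapAt_of_mem hxb]

/-- The bilinear form induced on the tangent spaces of the sphere. -/
def pullForm (n : ℕ) (B : Sph n → Cn n →L[ℝ] Cn n →L[ℝ] ℝ) (x : Sph n) :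
    TangentSpace (𝓡 (2 * n + 1)) x →L[ℝ] TangentSpace (𝓡 (2 * n + 1)) x →L[ℝ] ℝ :=
  let L : EuclideanSpace ℝ (Fin (2 * n + 1)) →L[ℝ] Cn n := dIncl n x
  ((B x).bilinearComp L L : EuclideanSpace ℝ (Fin (2 * n + 1)) →L[ℝ]
    EuclideanSpace ℝ (Fin (2 * n + 1)) →L[ℝ] ℝ)

theorem pullForm_apply (B : Sph n → Cn n →L[ℝ] Cn n →L[ℝ] ℝ) (x : Sph n)
    (v w : TangentSpace (𝓡 (2 * n + 1)) x) :
    pullForm n B x v w = B x (dIncl n x v) (dIncl n x w) := rfl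

/-- In a trivialization the form is `B` with `dInclCoord` inserted in both slots, a composition of
smooth operator-valued maps. -/
theorem contMDiff_pullForm {B : Sph n → Cn n →L[ℝ] Cn n →L[ℝ] ℝ}
    (hB : ContMDiff (𝓡 (2 * n + 1)) 𝓘(ℝ, Cn n →L[ℝ] Cn n →L[ℝ] ℝ) ∞ B) :
    ContMDiff (𝓡 (2 * n + 1)) ((𝓡 (2 * n + 1)).prod
      𝓘(ℝ, EuclideanSpace ℝ (Fin (2 * n + 1)) →L[ℝ] EuclideanSpace ℝ (Fin (2 * n + 1)) →L[ℝ] ℝ)) ∞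
      (fun x => Bundle.TotalSpace.mk' (EuclideanSpace ℝ (Fin (2 * n + 1)) →L[ℝ]
        EuclideanSpace ℝ (Fin (2 * n + 1)) →L[ℝ] ℝ)
        (E := fun x : Sph n => TangentSpace (𝓡 (2 * n + 1)) x →L[ℝ]
          TangentSpace (𝓡 (2 * n + 1)) x →L[ℝ] ℝ) x (pullForm n B x)) := by
  intro x₀
  rw [contMDiffAt_hom_bundle]
  refine ⟨contMDiffAt_id, ?_⟩
  have h : ContMDiffAt (𝓡 (2 * n + 1)) 𝓘(ℝ, EuclideanSpace ℝ (Fin (2 * n + 1)) →L[ℝ]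
      EuclideanSpace ℝ (Fin (2 * n + 1)) →L[ℝ] ℝ) ∞
      (fun x => ((dInclCoord n x₀ x).precomp ℝ).comp ((B x).comp (dInclCoord n x₀ x))) x₀ := by
    have h1 := ContMDiffAt.clm_precomp (F₃ := ℝ) (contMDiffAt_dInclCoord x₀)
    have h2 := (hB x₀).clm_comp (contMDiffAt_dInclCoord x₀)
    exact h1.clm_comp h2
  refine h.congr_of_eventuallyEq ?_
  have hx₀ : x₀ ∈ (trivializationAt (EuclideanSpace ℝ (Fin (2 * n + 1)))
    (TangentSpace (𝓡 (2 * n + 1)) : Sph n → Type _) x₀).baseSet :=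
    FiberBundle.mem_baseSet_trivializationAt' x₀
  filter_upwards [(trivializationAt (EuclideanSpace ℝ (Fin (2 * n + 1)))
    (TangentSpace (𝓡 (2 * n + 1)) : Sph n → Type _) x₀).open_baseSet.mem_nhds hx₀] with x hxb
  ext u v
  refine (inCoordinates_apply_eq₂ (E₃ := Bundle.Trivial (Sph n) ℝ) hxb hxb (Set.mem_univ _)).trans ?_
  simp [pullForm_apply, dInclCoord, Bundle.Trivialization.symmL_apply _ hxb]

end SphereCalculus

/-! ### Connections, isometries and curvature on a general manifold -/

section RiemannianGeometry

open VectorField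

variable {E : Type*} [NormedAddCommGroup E] [NormedSpace ℝ E]
  {H : Type*} [TopologicalSpace H] {I : ModelWithCorners ℝ E H}
  {M : Type*} [TopologicalSpace M] [ChartedSpace H M] [IsManifold I ∞ M]

theorem SmoothField.mdiff {X : (x : M) → TangentSpace I x} (hX : SmoothField X) (x : M) :
    MDifferentiableAt I I.tangent (fun x => (⟨x, X x⟩ : TangentBundle I M)) x :=
  (hX x).mdifferentiableAt (by simp)

theorem RMetric.contMDiff_inner (g : RMetric I M) {X Y : (x : M) → TangentSpace I x}
    (hX : SmoothField X) (hY : SmoothField Y) :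
    ContMDiff I 𝓘(ℝ) ∞ (fun x => g.inner x (X x) (Y x)) := by
  letI : Bundle.RiemannianBundle (TangentSpace I : M → Type _) := ⟨g.toRiemannianMetric⟩
  have i1 : IsManifold I 1 M := IsManifold.of_le (n := ∞) (by simp)
  exact ContMDiff.inner_bundle (IB := I) (IM := I) (F := E) (E := (TangentSpace I : M → Type _))
    (n := ∞) (b := id) (v := X) (w := Y) hX hY

theorem RMetric.ext_of_inner (g : RMetric I M) {x : M} {u v : TangentSpace I x}
    (h : ∀ w, g.inner x u w = g.inner x v w) : u = v := by
  by_contra hne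
  have := g.pos x (u - v) (sub_ne_zero.2 hne)
  rw [map_sub (g.inner x) u v, ContinuousLinearMap.sub_apply, h, sub_self] at this
  exact lt_irrefl _ this

variable (φ : M ≃ₘ^∞⟮I, I⟯ M)

theorem Diffeomorph.isInvertible_mfderiv (x : M) : (mfderiv I I φ x).IsInvertible :=
  ⟨φ.mfderivToContinuousLinearEquiv (by simp) x, rfl⟩

theorem mfderiv_mpullback (X : (x : M) → TangentSpace I x) (x : M) :
    mfderiv I I φ x (mpullback I I φ X x) = X (φ x) :=
  (φ.isInvertible_mfderiv x).self_apply_inverse _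

theorem mpullback_eq_iff {X : (x : M) → TangentSpace I x} {x : M} {v : TangentSpace I x} :
    mpullback I I φ X x = v ↔ X (φ x) = mfderiv I I φ x v := by
  constructor
  · rintro rfl
    exact (mfderiv_mpullback φ X x).symm
  · intro h
    rw [mpullback_apply, h]
    exact (φ.isInvertible_mfderiv x).inverse_apply_self _

theorem SmoothField.mpullback [CompleteSpace E] {X : (x : M) → TangentSpace I x}
    (hX : SmoothField X) : SmoothField (VectorField.mpullback I I φ X) := by
  have i1 : IsManifold I 1 M := IsManifold.of_le (n := ∞) (by simp)
  exact ContMDiff.mpullback_vectorField (m := ∞) (n := ∞) hX φ.contMDiff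
    φ.isInvertible_mfderiv (by simp)

variable {φ}

theorem inner_mpullback {g : RMetric I M} (hφ : PreservesMetric g φ)
    (X Y : (x : M) → TangentSpace I x) (x : M) :
    g.inner x (mpullback I I φ X x) (mpullback I I φ Y x) =
      g.inner (φ x) (X (φ x)) (Y (φ x)) := by
  rw [← hφ, mfderiv_mpullback, mfderiv_mpullback]

theorem mvfderiv_comp_mpullback {W : Type*} [NormedAddCommGroup W] [NormedSpace ℝ W] {h : M → W}
    (X : (x : M) → TangentSpace I x) (x : M) (hh : MDifferentiableAt I 𝓘(ℝ, W) h (φ x)) :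
    mvfderiv I (fun y => h (φ y)) x (mpullback I I φ X x) = mvfderiv I h (φ x) (X (φ x)) := by
  have e := mfderiv_comp (I := I) (I' := I) (I'' := 𝓘(ℝ, W)) x hh
    (φ.contMDiff.mdifferentiable (by simp) x)
  refine (congrArg (fun L : E →L[ℝ] W => L (mpullback I I φ X x)) e).trans ?_
  exact congrArg (mvfderiv I h (φ x)) (mfderiv_mpullback φ X x)

theorem mlieBracket_mpullback [CompleteSpace E] {X Y : (x : M) → TangentSpace I x}
    (hX : SmoothField X) (hY : SmoothField Y) (x : M) :
    mlieBracket I (mpullback I I φ X) (mpullback I I φ Y) x =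
      mpullback I I φ (mlieBracket I X Y) x := by
  have i2 : IsManifold I (minSmoothness ℝ 2) M :=
    IsManifold.of_le (n := ∞) (by simp only [minSmoothness_of_isRCLikeNormedField]; norm_cast)
  have i3 : IsManifold I (minSmoothness ℝ 3) M :=
    IsManifold.of_le (n := ∞) (by simp only [minSmoothness_of_isRCLikeNormedField]; norm_cast)
  exact (mpullback_mlieBracket (n := ∞) (hX.mdiff _) (hY.mdiff _) (φ.contMDiff x)
    (by simp only [minSmoothness_of_isRCLikeNormedField]; norm_cast)).symm

variable [FiniteDimensional ℝ E] [CompleteSpace E] {g : RMetric I M}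
  {cov : CovariantDerivative I E (TangentSpace I : M → Type _)}

theorem IsLeviCivita.cov_sub_cov (h : IsLeviCivita g cov) {X Y : (x : M) → TangentSpace I x}
    (hX : SmoothField X) (hY : SmoothField Y) (x : M) :
    cov Y x (X x) - cov X x (Y x) = mlieBracket I X Y x :=
  cov.torsion_eq_zero_iff.1 h.torsion_free (hX.mdiff x) (hY.mdiff x)

/-- The right side involves only the metric, derivatives and brackets, each natural under
isometries; naturality of the connection is deduced from this. -/
theorem IsLeviCivita.koszul (h : IsLeviCivita g cov) {X Y Z : (x : M) → TangentSpace I x}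
    (hX : SmoothField X) (hY : SmoothField Y) (hZ : SmoothField Z) (x : M) :
    2 * g.inner x (cov Y x (X x)) (Z x) =
      mvfderiv I (fun y => g.inner y (Y y) (Z y)) x (X x) +
      mvfderiv I (fun y => g.inner y (X y) (Z y)) x (Y x) -
      mvfderiv I (fun y => g.inner y (X y) (Y y)) x (Z x) +
      g.inner x (mlieBracket I X Y x) (Z x) - g.inner x (mlieBracket I X Z x) (Y x) -
      g.inner x (mlieBracket I Y Z x) (X x) := by
  rw [h.metric Y Z hY hZ, h.metric X Z hX hZ, h.metric X Y hX hY, ← h.cov_sub_cov hX hY,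
    ← h.cov_sub_cov hX hZ, ← h.cov_sub_cov hY hZ]
  simp only [map_sub, ContinuousLinearMap.sub_apply]
  rw [g.symm x (Y x) (cov Z x (X x)), g.symm x (X x) (cov Z x (Y x)),
    g.symm x (X x) (cov Y x (Z x))]
  ring

/-- Every tangent vector is the value of a smooth vector field. -/
def HasSmoothExtensions (I : ModelWithCorners ℝ E H) (M : Type*) [TopologicalSpace M]
    [ChartedSpace H M] [IsManifold I ∞ M] : Prop :=
  ∀ (x : M) (v : TangentSpace I x), ∃ X : (x : M) → TangentSpace I x, SmoothField X ∧ X x = v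

/-- The Levi-Civita connection is natural under isometries. -/
theorem IsLeviCivita.cov_mpullback (hM : HasSmoothExtensions I M) (h : IsLeviCivita g cov)
    (hφ : PreservesMetric g φ) {X Y : (x : M) → TangentSpace I x}
    (hX : SmoothField X) (hY : SmoothField Y) (x : M) :
    cov (mpullback I I φ Y) x (mpullback I I φ X x) =
      mpullback I I φ (fun y => cov Y y (X y)) x := by
  refine g.ext_of_inner fun w => ?_
  -- `Z` is chosen at `φ x` so that its pullback at `x` is the test vector `w`; the Koszul formulas
  -- at `x` and at `φ x` then match term by term.
  obtain ⟨Z, hZ, hZw⟩ := hM (φ x) (mfderiv I I φ x w)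
  obtain rfl : mpullback I I φ Z x = w := (mpullback_eq_iff φ).2 hZw
  have k1 := h.koszul (hX.mpullback φ) (hY.mpullback φ) (hZ.mpullback φ) x
  have k2 := h.koszul hX hY hZ (φ x)
  simp only [inner_mpullback hφ, mlieBracket_mpullback hX hY, mlieBracket_mpullback hX hZ,
    mlieBracket_mpullback hY hZ] at k1
  rw [mvfderiv_comp_mpullback (h := fun y => g.inner y (Y y) (Z y)) X x
      ((g.contMDiff_inner hY hZ _).mdifferentiableAt (by simp)),
    mvfderiv_comp_mpullback (h := fun y => g.inner y (X y) (Z y)) Y x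
      ((g.contMDiff_inner hX hZ _).mdifferentiableAt (by simp)),
    mvfderiv_comp_mpullback (h := fun y => g.inner y (X y) (Y y)) Z x
      ((g.contMDiff_inner hX hY _).mdifferentiableAt (by simp)), ← k2] at k1
  rw [inner_mpullback hφ (fun y => cov Y y (X y)) Z x]
  linarith

/-- The second order equation satisfied by a Sasakian structure. -/
def SasakianEquation (g : RMetric I M)
    (cov : CovariantDerivative I E (TangentSpace I : M → Type _))
    (ξ : (x : M) → TangentSpace I x) : Prop :=
  ∀ Y : (x : M) → TangentSpace I x, SmoothField Y → ∀ (x : M) (v : TangentSpace I x),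
    cov (fun y => cov ξ y (Y y)) x v - cov ξ x (cov Y x v) =
      g.inner x (ξ x) (Y x) • v - g.inner x v (Y x) • ξ x

/-- Covariant derivatives of smooth fields are smooth. -/
def PreservesSmooth (cov : CovariantDerivative I E (TangentSpace I : M → Type _)) : Prop :=
  ∀ X Y : (x : M) → TangentSpace I x, SmoothField X → SmoothField Y →
    SmoothField (fun y => cov Y y (X y))

/-- Each ingredient of the equation is natural under isometries, and both `Y` and `v` can be written
as pullbacks. -/
theorem SasakianEquation.mpullback (hM : HasSmoothExtensions I M) (h : IsLeviCivita g cov)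
    (hs : PreservesSmooth cov) (hφ : PreservesMetric g φ) {ξ : (x : M) → TangentSpace I x}
    (hξ : SmoothField ξ) (hS : SasakianEquation g cov ξ) :
    SasakianEquation g cov (mpullback I I φ ξ) := by
  intro Y hY x v
  have hsymm : ∀ y, Y y = VectorField.mpullback I I φ (VectorField.mpullback I I φ.symm Y) y := by
    intro y
    symm
    rw [mpullback_eq_iff, mpullback_eq_iff]
    have h1 : (φ.symm : M → M) ∘ φ = id := by
      ext z
      simp
    have h2 := mfderiv_comp (I := I) (I' := I) (I'' := I) y
      (φ.symm.contMDiff.mdifferentiable (by simp) (φ y)) (φ.contMDiff.mdifferentiable (by simp) y)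
    rw [h1, mfderiv_id] at h2
    -- The base points `φ.symm (φ y)` and `y` agree only propositionally, so the values are compared
    -- in the model space `E`.
    have h3 : ∀ z, z = y → (Y z : E) = Y y := by
      rintro z rfl
      rfl
    exact (h3 _ (φ.symm_apply_apply y)).trans (congrArg (fun L : E →L[ℝ] E => L (Y y)) h2)
  obtain ⟨Y', hY', rfl⟩ : ∃ Y', SmoothField Y' ∧ Y = VectorField.mpullback I I φ Y' :=
    ⟨_, hY.mpullback φ.symm, funext hsymm⟩
  obtain ⟨X, hX, hXv⟩ := hM (φ x) (mfderiv I I φ x v)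
  obtain rfl : VectorField.mpullback I I φ X x = v := (mpullback_eq_iff φ).2 hXv
  have e1 : (fun y => cov (VectorField.mpullback I I φ ξ) y (VectorField.mpullback I I φ Y' y)) =
      VectorField.mpullback I I φ (fun y => cov ξ y (Y' y)) :=
    funext fun y => h.cov_mpullback hM hφ hY' hξ y
  rw [e1, h.cov_mpullback hM hφ hX (hs _ _ hY' hξ), h.cov_mpullback hM hφ hX hY',
    h.cov_mpullback hM hφ (hs _ _ hX hY') hξ, inner_mpullback hφ, inner_mpullback hφ]
  have := congrArg (mfderiv I I φ x).inverse (hS Y' hY' (φ x) (X (φ x)))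
  rw [map_sub, map_sub, map_smul, map_smul] at this
  exact this

/-- The curvature of a connection. -/
def curv (cov : CovariantDerivative I E (TangentSpace I : M → Type _))
    (X Y Z : (x : M) → TangentSpace I x) (x : M) : TangentSpace I x :=
  cov (fun y => cov Z y (Y y)) x (X x) - cov (fun y => cov Z y (X y)) x (Y x) -
    cov Z x (mlieBracket I X Y x)

/-- Antisymmetrize the equation in `X` and `Y`: torsion-freeness turns `∇_X Y - ∇_Y X` into the
bracket, and the symmetric term `g(X, Y) ξ` drops out. -/
theorem SasakianEquation.curv_eq (h : IsLeviCivita g cov) {ξ : (x : M) → TangentSpace I x}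
    (hS : SasakianEquation g cov ξ) {X Y : (x : M) → TangentSpace I x}
    (hX : SmoothField X) (hY : SmoothField Y) (x : M) :
    curv cov X Y ξ x = g.inner x (ξ x) (Y x) • X x - g.inner x (ξ x) (X x) • Y x := by
  have e1 := hS Y hY x (X x)
  have e2 := hS X hX x (Y x)
  rw [curv, ← h.cov_sub_cov hX hY, map_sub]
  rw [g.symm x (Y x)] at e2
  rw [sub_eq_iff_eq_add] at e1 e2
  rw [e1, e2]
  abel

/-- Differentiate `g(K, Z)` twice and use that the bracket acts as a commutator; the mixed terms
`g(∇K, ∇Z)` cancel. -/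
theorem IsLeviCivita.curv_skew (h : IsLeviCivita g cov) (hs : PreservesSmooth cov)
    {X Y Z K : (x : M) → TangentSpace I x}
    (hX : SmoothField X) (hY : SmoothField Y) (hZ : SmoothField Z) (hK : SmoothField K) (x : M) :
    g.inner x (curv cov X Y K x) (Z x) + g.inner x (K x) (curv cov X Y Z x) = 0 := by
  have hsm := g.contMDiff_inner hK hZ
  have e := mvfderiv_mlieBracket hsm hX hY x
  have hd : ∀ {U V : (x : M) → TangentSpace I x}, SmoothField U → SmoothField V →
      mvfderiv I (fun y => mvfderiv I (fun y => g.inner y (K y) (Z y)) y (V y)) x (U x) =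
      g.inner x (cov (fun y => cov K y (V y)) x (U x)) (Z x) +
      g.inner x (cov K x (V x)) (cov Z x (U x)) +
      (g.inner x (cov K x (U x)) (cov Z x (V x)) +
      g.inner x (K x) (cov (fun y => cov Z y (V y)) x (U x))) := by
    intro U V hU hV
    rw [← h.metric _ _ (hs _ _ hV hK) hZ, ← h.metric _ _ hK (hs _ _ hV hZ)]
    have : (fun y => mvfderiv I (fun y => g.inner y (K y) (Z y)) y (V y)) =
        fun y => g.inner y (cov K y (V y)) (Z y) + g.inner y (K y) (cov Z y (V y)) :=
      funext fun y => h.metric _ _ hK hZ y (V y)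
    rw [this]
    exact ((HasD.of_mdiff ((g.contMDiff_inner (hs _ _ hV hK) hZ x).mdifferentiableAt
      (by simp))).add (HasD.of_mdiff ((g.contMDiff_inner hK (hs _ _ hV hZ) x).mdifferentiableAt
      (by simp)))).2
  rw [hd hX hY, hd hY hX, h.metric _ _ hK hZ] at e
  simp only [curv, map_sub, ContinuousLinearMap.sub_apply]
  linarith

end RiemannianGeometry

/-! ### Pointwise algebra of the deformed structure -/

section HermitianAlgebra

open Complex ComplexConjugate

variable {n : ℕ}

theorem inner_real_eq_re (u v : Cn n) : inner ℝ u v = (inner ℂ u v).re := by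
  rw [PiLp.inner_apply, PiLp.inner_apply, Complex.re_sum]
  refine Finset.sum_congr rfl fun i _ => ?_
  simp [Complex.inner]

/-- The unit vector of the coordinate `0`. -/
def e₀ (n : ℕ) : Cn n := EuclideanSpace.single 0 1

theorem e₀_apply_zero : e₀ n 0 = 1 := by simp [e₀]

theorem inner_e₀_left (v : Cn n) : inner ℂ (e₀ n) v = v 0 := by
  simp [e₀, EuclideanSpace.inner_single_left]

theorem inner_e₀_right (v : Cn n) : inner ℂ v (e₀ n) = conj (v 0) := by
  simp [e₀, EuclideanSpace.inner_single_right]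

theorem inner_sphere_self (x : Sph n) : inner ℂ (x : Cn n) (x : Cn n) = 1 := by
  rw [inner_self_eq_norm_sq_to_K]
  simp

/-- The squared modulus of the coordinate `0`. -/
def rho (x : Cn n) : ℝ := normSq (x 0)

theorem ofReal_rho (x : Cn n) : (rho x : ℂ) = conj (x 0) * x 0 := by
  rw [rho, normSq_eq_conj_mul_self]

/-- The conformal factor `g₀(T, T₀)` of the deformation. -/
def conf (a : ℝ) (x : Cn n) : ℝ := 1 + a * rho x

theorem conf_pos {a : ℝ} (ha : 0 < a) (x : Cn n) : 0 < conf a x := by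
  have : 0 ≤ rho x := normSq_nonneg _
  unfold conf
  positivity

theorem conf_ne_zero {a : ℝ} (ha : 0 < a) (x : Cn n) : (conf a x : ℂ) ≠ 0 :=
  ofReal_ne_zero.2 (conf_pos ha x).ne'

theorem ofReal_conf (a : ℝ) (x : Cn n) : (conf a x : ℂ) = 1 + a * (conj (x 0) * x 0) := by
  rw [conf]
  push_cast
  rw [ofReal_rho]

/-- The endomorphism `1 + a J₁ / i`, so that `T` is `i` times it. -/
def defo (a : ℝ) (x : Cn n) : Cn n := x + ((a : ℂ) * x 0) • e₀ n

/-- The vector field `T` as a map into the Hermitian space. -/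
def Tvec (a : ℝ) (x : Cn n) : Cn n := I • defo a x

theorem defo_apply_zero (a : ℝ) (x : Cn n) : defo a x 0 = (1 + a) * x 0 := by
  simp [defo, e₀_apply_zero]
  ring

theorem inner_defo (a : ℝ) (x y : Cn n) :
    inner ℂ (defo a x) y = inner ℂ x y + a * conj (x 0) * y 0 := by
  simp [defo, inner_add_left, inner_smul_left, inner_e₀_left]
  ring

theorem inner_sphere_defo (a : ℝ) (x : Sph n) :
    inner ℂ (x : Cn n) (defo a x) = conf a (x : Cn n) := by
  rw [defo, inner_add_right, inner_smul_right, inner_sphere_self, inner_e₀_right, ofReal_conf]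
  ring

/-- The contact form of the deformed structure. -/
def ctForm (a : ℝ) (x v : Cn n) : ℝ := (inner ℂ x v).im / conf a x

/-- The projection along `T`. -/
def proj (a : ℝ) (x v : Cn n) : Cn n := v - (ctForm a x v : ℂ) • Tvec a x

theorem ctForm_smul_add_proj (a : ℝ) (x v : Cn n) : (ctForm a x v : ℂ) • Tvec a x + proj a x v = v := by
  rw [proj]
  abel

theorem inner_sphere_Tvec (a : ℝ) (x : Sph n) :
    inner ℂ (x : Cn n) (Tvec a x) = I * conf a (x : Cn n) := by
  rw [Tvec, inner_smul_right, inner_sphere_defo]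

theorem ctForm_add (a : ℝ) (x v w : Cn n) : ctForm a x (v + w) = ctForm a x v + ctForm a x w := by
  simp [ctForm, inner_add_right, add_div]

theorem ctForm_smul (a : ℝ) (x v : Cn n) (r : ℝ) : ctForm a x (r • v) = r * ctForm a x v := by
  have : inner ℂ x (r • v) = r * inner ℂ x v := by
    rw [← Complex.coe_smul, inner_smul_right]
  rw [ctForm, ctForm, this]
  simp [mul_div_assoc]

theorem proj_add (a : ℝ) (x v w : Cn n) : proj a x (v + w) = proj a x v + proj a x w := by
  simp only [proj, ctForm_add, ofReal_add]
  module

theorem proj_smul (a : ℝ) (x v : Cn n) (r : ℝ) : proj a x (r • v) = r • proj a x v := by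
  simp only [proj, ctForm_smul, ofReal_mul, smul_sub, mul_smul, Complex.coe_smul]

theorem inner_sphere_proj {a : ℝ} (ha : 0 < a) (x : Sph n) {v : Cn n}
    (hv : inner ℝ (x : Cn n) v = 0) : inner ℂ (x : Cn n) (proj a x v) = 0 := by
  have hf := conf_ne_zero ha (x : Cn n)
  rw [proj, inner_sub_right, inner_smul_right, inner_sphere_Tvec, ctForm, ofReal_div]
  rw [inner_real_eq_re] at hv
  field_simp
  rw [Complex.ext_iff]
  simp [hv]

theorem ctForm_of_mem {a : ℝ} {x v : Cn n} (hv : inner ℂ x v = 0) : ctForm a x v = 0 := by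
  simp [ctForm, hv]

theorem proj_of_mem {a : ℝ} {x v : Cn n} (hv : inner ℂ x v = 0) : proj a x v = v := by
  simp [proj, ctForm_of_mem hv]

theorem ctForm_Tvec_smul_add {a : ℝ} (ha : 0 < a) (x : Sph n) (r : ℝ) {y : Cn n}
    (hy : inner ℂ (x : Cn n) y = 0) : ctForm a x ((r : ℂ) • Tvec a (x : Cn n) + y) = r := by
  have hf := (conf_pos ha (x : Cn n)).ne'
  rw [ctForm, inner_add_right, inner_smul_right, hy, inner_sphere_Tvec]
  simp
  field_simp

theorem proj_Tvec_smul_add {a : ℝ} (ha : 0 < a) (x : Sph n) (r : ℝ) {y : Cn n}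
    (hy : inner ℂ (x : Cn n) y = 0) : proj a x ((r : ℂ) • Tvec a (x : Cn n) + y) = y := by
  rw [proj, ctForm_Tvec_smul_add ha x r hy]
  abel

theorem inner_real_Tvec_smul_add (a : ℝ) (x : Sph n) (r : ℝ) {y : Cn n}
    (hy : inner ℂ (x : Cn n) y = 0) :
    inner ℝ (x : Cn n) ((r : ℂ) • Tvec a (x : Cn n) + y) = 0 := by
  rw [inner_real_eq_re, inner_add_right, inner_smul_right, hy, inner_sphere_Tvec]
  simp

/-- The deformed metric, as a bilinear form on the Hermitian space. -/
def metricForm (a : ℝ) (x v w : Cn n) : ℝ :=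
  ctForm a x v * ctForm a x w + (conf a x)⁻¹ * inner ℝ (proj a x v) (proj a x w)

/-- The transverse connection: the covariant derivative of the `Q`-valued field `y`, whose
derivative is `dy`, in the direction `η T + X`. -/
def transConn (a : ℝ) (x : Cn n) (η : ℝ) (X y dy : Cn n) : Cn n :=
  dy - (I * a * η * y 0) • e₀ n -
    ((a : ℂ) * (conf a x : ℂ)⁻¹ * conj (x 0)) • (X 0 • y + y 0 • X) +
    ((conf a x : ℂ)⁻¹ * inner ℂ X y) • defo a x

/-- The Levi-Civita connection of the deformed metric: the covariant derivative of the field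
`ηY T + y`, whose components have derivatives `dη`, `dy`, in the direction `η T + X`. -/
def lcConn (a : ℝ) (x : Cn n) (η : ℝ) (X : Cn n) (ηY : ℝ) (y : Cn n) (dη : ℝ) (dy : Cn n) : Cn n :=
  ((dη - (conf a x)⁻¹ * (inner ℂ X y).im : ℝ) : ℂ) • Tvec a x +
    ((ηY * I : ℂ) • X + transConn a x η X y dy)

/-- `hdy` is the derivative of `⟨x, y⟩ = 0`. Because `⟨x, defo a x⟩ = f`, the last term of
`transConn` supplies `⟨X, y⟩`, and the `e₀` term supplies the contribution of `T`. -/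
theorem inner_transConn {a : ℝ} (ha : 0 < a) (x : Sph n) (η : ℝ) {X y dy : Cn n}
    (hX : inner ℂ (x : Cn n) X = 0) (hy : inner ℂ (x : Cn n) y = 0)
    (hdy : inner ℂ ((η : ℂ) • Tvec a (x : Cn n) + X) y + inner ℂ (x : Cn n) dy = 0) :
    inner ℂ (x : Cn n) (transConn a x η X y dy) = 0 := by
  have hf := conf_ne_zero ha (x : Cn n)
  rw [Tvec, smul_smul, inner_add_left, inner_smul_left, inner_defo, hy] at hdy
  simp only [transConn, inner_add_right, inner_sub_right, inner_smul_right, hX, hy,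
    inner_e₀_right, inner_sphere_defo]
  simp only [map_mul, conj_ofReal, conj_I] at hdy
  rw [mul_right_comm _ _ (conf a (x : Cn n) : ℂ), inv_mul_cancel₀ hf]
  linear_combination hdy

/-- All terms are complex linear in `(y, dy)`. For the constant `c = i` this says that `i` is
parallel on `Q`, the transverse Kähler condition behind the Sasakian equation. -/
theorem transConn_csmul (a : ℝ) (x : Cn n) (η : ℝ) (X y dy : Cn n) (c dc : ℂ) :
    transConn a x η X (c • y) (dc • y + c • dy) = dc • y + c • transConn a x η X y dy := by
  simp only [transConn, inner_smul_right, PiLp.smul_apply, smul_eq_mul]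
  module

theorem transConn_add (a : ℝ) (x : Cn n) (η : ℝ) (X y y' dy dy' : Cn n) :
    transConn a x η X (y + y') (dy + dy') =
      transConn a x η X y dy + transConn a x η X y' dy' := by
  simp only [transConn, inner_add_right, PiLp.add_apply]
  module

/-- The subtracted term is `(df / f)⟨y, z⟩`, so `transConn` is compatible with the Hermitian form
`f⁻¹⟨·, ·⟩`. -/
theorem inner_transConn_add_inner {a : ℝ} (ha : 0 < a) (x : Sph n) (η : ℝ) {X y dy z dz : Cn n}
    (hX : inner ℂ (x : Cn n) X = 0) (hy : inner ℂ (x : Cn n) y = 0)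
    (hz : inner ℂ (x : Cn n) z = 0) :
    inner ℂ (transConn a x η X y dy) z + inner ℂ y (transConn a x η X z dz) =
      inner ℂ dy z + inner ℂ y dz - (a : ℂ) * (conf a (x : Cn n) : ℂ)⁻¹ *
        (conj (x.1 0) * X 0 + x.1 0 * conj (X 0)) * inner ℂ y z := by
  have hyd : inner ℂ y (defo a (x : Cn n)) = a * (x.1 0) * conj (y 0) := by
    rw [← inner_conj_symm, inner_defo, hy]
    simp
  simp only [transConn, inner_add_left, inner_sub_left, inner_smul_left, inner_add_right,
    inner_sub_right, inner_smul_right, inner_e₀_left, inner_e₀_right, inner_defo, hz, hyd,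
    map_mul, map_inv₀, conj_ofReal, conj_I, inner_conj_symm, conj_conj]
  ring

/-- The difference of the Levi-Civita connection and the flat derivative is symmetric. -/
theorem lcConn_sub_symm {a : ℝ} (ha : 0 < a) (x : Sph n) (ηX ηY dX dY : ℝ) {X Y DX DY : Cn n}
    (hX : inner ℂ (x : Cn n) X = 0) (hY : inner ℂ (x : Cn n) Y = 0) :
    lcConn a x ηX X ηY Y dY DY - ((dY : ℂ) • Tvec a (x : Cn n) +
      (ηY : ℂ) • Tvec a ((ηX : ℂ) • Tvec a (x : Cn n) + X) + DY) =
    lcConn a x ηY Y ηX X dX DX - ((dX : ℂ) • Tvec a (x : Cn n) +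
      (ηX : ℂ) • Tvec a ((ηY : ℂ) • Tvec a (x : Cn n) + Y) + DX) := by
  -- Since `T = i defo`, the terms `-f⁻¹ Im⟨X, Y⟩ T` and `f⁻¹⟨X, Y⟩ defo` add up to `f⁻¹ Re⟨X, Y⟩
  -- defo`, which is symmetric.
  have h1 : inner ℂ X Y - ((inner ℂ X Y).im : ℂ) * I =
      inner ℂ Y X - ((inner ℂ Y X).im : ℂ) * I := by
    rw [← inner_conj_symm X Y, Complex.ext_iff]
    generalize inner ℂ Y X = z
    simp
  have h2 : ∀ v : Cn n, Tvec a v = I • v + (I * a * v 0) • e₀ n := by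
    intro v
    rw [Tvec, defo]
    module
  rw [h2 (_ + X), h2 (_ + Y)]
  simp only [lcConn, transConn, PiLp.add_apply, PiLp.smul_apply, smul_eq_mul, ofReal_sub,
    ofReal_mul, ofReal_inv]
  simp only [Tvec, PiLp.smul_apply, smul_eq_mul]
  linear_combination (norm := module) h1 • ((conf a (x : Cn n) : ℂ)⁻¹ • defo a (x : Cn n))

end HermitianAlgebra

/-! ### Differentiation rules for Hermitian expressions -/

section HermitianDerivatives

open Complex ComplexConjugate

variable {E : Type*} [NormedAddCommGroup E] [NormedSpace ℝ E]
  {H : Type*} [TopologicalSpace H] {I' : ModelWithCorners ℝ E H}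
  {M : Type*} [TopologicalSpace M] [ChartedSpace H M] {n : ℕ}

theorem HasD.hinner {x : M} {v : TangentSpace I' x} {F G : M → Cn n} {w w' : Cn n}
    (h : HasD I' F x v w) (h' : HasD I' G x v w') :
    HasD I' (fun y => Inner.inner ℂ (F y) (G y)) x v
      (Inner.inner ℂ w (G x) + Inner.inner ℂ (F x) w') := by
  have := HasD.fderiv_comp (Φ := fun p : Cn n × Cn n => Inner.inner ℂ p.1 p.2)
    (F := fun y => (F y, G y)) (HasFDerivAt.inner ℂ (hasFDerivAt_fst (p := (F x, G x))) hasFDerivAt_snd) (h.prodMk h')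
  refine this.congr_deriv ?_
  simp [add_comm]

theorem HasD.apply_zero {x : M} {v : TangentSpace I' x} {F : M → Cn n} {w : Cn n}
    (h : HasD I' F x v w) : HasD I' (fun y => F y 0) x v (w 0) :=
  h.clm ((EuclideanSpace.proj 0 : Cn n →L[ℂ] ℂ).restrictScalars ℝ)

theorem HasD.conj {x : M} {v : TangentSpace I' x} {F : M → ℂ} {w : ℂ}
    (h : HasD I' F x v w) : HasD I' (fun y => conj (F y)) x v (conj w) :=
  h.clm (conjCLE : ℂ →L[ℝ] ℂ)

theorem HasD.re {x : M} {v : TangentSpace I' x} {F : M → ℂ} {w : ℂ}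
    (h : HasD I' F x v w) : HasD I' (fun y => (F y).re) x v w.re :=
  h.clm reCLM

theorem HasD.ofReal {x : M} {v : TangentSpace I' x} {F : M → ℝ} {w : ℝ}
    (h : HasD I' F x v w) : HasD I' (fun y => (F y : ℂ)) x v w :=
  h.clm ofRealCLM

theorem HasD.csmul_const {x : M} {v : TangentSpace I' x} {F : M → Cn n} {w : Cn n} (c : ℂ)
    (h : HasD I' F x v w) : HasD I' (fun y => c • F y) x v (c • w) :=
  h.clm ((c • ContinuousLinearMap.id ℂ (Cn n)).restrictScalars ℝ)

theorem HasD.cmul_const {x : M} {v : TangentSpace I' x} {F : M → ℂ} {w : ℂ} (c : ℂ)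
    (h : HasD I' F x v w) : HasD I' (fun y => c * F y) x v (c * w) :=
  h.clm ((c • ContinuousLinearMap.id ℂ ℂ).restrictScalars ℝ)

theorem HasD.mul_const {x : M} {v : TangentSpace I' x} {F : M → ℝ} {w : ℝ} (c : ℝ)
    (h : HasD I' F x v w) : HasD I' (fun y => c * F y) x v (c * w) :=
  h.clm (c • ContinuousLinearMap.id ℝ ℝ)

theorem HasD.const_add {x : M} {v : TangentSpace I' x} {F : M → ℝ} {w : ℝ} (c : ℝ)
    (h : HasD I' F x v w) : HasD I' (fun y => c + F y) x v w :=
  ((HasD.const c x v).add h).congr_deriv (zero_add _)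

theorem HasD.rho {x : M} {v : TangentSpace I' x} {F : M → Cn n} {w : Cn n}
    (h : HasD I' F x v w) :
    HasD I' (fun y => rho (F y)) x v (2 * (starRingEnd ℂ (F x 0) * w 0).re) := by
  have e : (fun y => _root_.rho (F y)) = fun y => (starRingEnd ℂ (F y 0) * F y 0).re := by
    funext y
    rw [← ofReal_rho, ofReal_re]
  rw [e]
  refine (h.apply_zero.conj.cmul h.apply_zero).re.congr_deriv ?_
  simp
  ring

theorem HasD.conf {x : M} {v : TangentSpace I' x} {F : M → Cn n} {w : Cn n} (a : ℝ)
    (h : HasD I' F x v w) :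
    HasD I' (fun y => conf a (F y)) x v (a * (2 * (starRingEnd ℂ (F x 0) * w 0).re)) :=
  (h.rho.mul_const a).const_add 1

end HermitianDerivatives

/-! ### The explicit connection on the sphere -/

section SphereConnection

open Complex ComplexConjugate

variable {n : ℕ} {a : ℝ}

instance (x : Sph n) : T2Space (TangentSpace (𝓡 (2 * n + 1)) x) :=
  inferInstanceAs (T2Space (EuclideanSpace ℝ (Fin (2 * n + 1))))

/-- The tangent bundle of the sphere has enough smooth sections. -/
theorem hasSmoothExtensions_sphere (n : ℕ) : HasSmoothExtensions (𝓡 (2 * n + 1)) (Sph n) := by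
  intro x v
  -- The constant vector is projected orthogonally onto each tangent hyperplane.
  refine ⟨fun y => tlift n y (dIncl n x v - (inner ℝ (y : Cn n) (dIncl n x v)) • (y : Cn n)),
    smoothField_tlift ?_ ?_, ?_⟩
  · exact contMDiff_const.sub ((ContDiff.contMDiff (f := fun u : Cn n => inner ℝ u (dIncl n x v) • u)
      ((contDiff_id.inner ℝ contDiff_const).smul contDiff_id)).comp (contMDiff_incl n))
  · intro y
    rw [inner_sub_right, inner_smul_right, real_inner_self_eq_norm_sq]
    simp
  · simp only
    rw [inner_dIncl, zero_smul, sub_zero, tlift_dIncl]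

variable (Y : (x : Sph n) → TangentSpace (𝓡 (2 * n + 1)) x)

/-- A vector field on the sphere as a map into the Hermitian space. -/
def hat (x : Sph n) : Cn n := dIncl n x (Y x)

/-- The component along `T` of a vector field. -/
def etaF (a : ℝ) (x : Sph n) : ℝ := ctForm a x (hat Y x)

/-- The component in `Q` of a vector field. -/
def projF (a : ℝ) (x : Sph n) : Cn n := proj a x (hat Y x)

variable {Y}

/-- The vector field with given components along `T` and in `Q`. -/
def mkField (a : ℝ) (η : Sph n → ℝ) (y : Sph n → Cn n) (x : Sph n) :
    TangentSpace (𝓡 (2 * n + 1)) x :=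
  tlift n x ((η x : ℂ) • Tvec a (x : Cn n) + y x)

theorem hat_mkField {η : Sph n → ℝ} {y : Sph n → Cn n} {x : Sph n}
    (hy : inner ℂ (x : Cn n) (y x) = 0) :
    hat (mkField a η y) x = (η x : ℂ) • Tvec a (x : Cn n) + y x :=
  dIncl_tlift x (inner_real_Tvec_smul_add a x _ hy)

theorem hat_mdiff {x : Sph n} (hY : MDifferentiableAt (𝓡 (2 * n + 1)) (𝓡 (2 * n + 1)).tangent
    (fun x => (⟨x, Y x⟩ : TangentBundle (𝓡 (2 * n + 1)) (Sph n))) x) :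
    MDifferentiableAt (𝓡 (2 * n + 1)) 𝓘(ℝ, Cn n) (hat Y) x := by
  have h1 := ((contMDiff_incl n).contMDiff_tangentMap (m := 1) (by norm_cast)).mdifferentiable
    (by simp) (⟨x, Y x⟩ : TangentBundle (𝓡 (2 * n + 1)) (Sph n))
  have h2 := MDifferentiableAt.comp x h1 hY
  have h3 := (contMDiff_snd_tangentBundle_modelSpace (n := 1) (Cn n) 𝓘(ℝ, Cn n)).mdifferentiable
    (by simp) (tangentMap (𝓡 (2 * n + 1)) 𝓘(ℝ, Cn n) (fun y : Sph n => (y : Cn n)) ⟨x, Y x⟩)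
  exact MDifferentiableAt.comp x h3 h2

theorem hasD_hat {x : Sph n} (hY : MDifferentiableAt (𝓡 (2 * n + 1)) (𝓡 (2 * n + 1)).tangent
    (fun x => (⟨x, Y x⟩ : TangentBundle (𝓡 (2 * n + 1)) (Sph n))) x)
    (v : TangentSpace (𝓡 (2 * n + 1)) x) :
    HasD (𝓡 (2 * n + 1)) (hat Y) x v (mvfderiv (𝓡 (2 * n + 1)) (hat Y) x v) :=
  HasD.of_mdiff (hat_mdiff hY)

theorem contDiff_rho : ContDiff ℝ ∞ (rho : Cn n → ℝ) := by
  have : (rho : Cn n → ℝ) = fun x => (x 0).re * (x 0).re + (x 0).im * (x 0).im := by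
    funext x
    rw [rho, normSq_apply]
  rw [this]
  have h : ContDiff ℝ ∞ (fun x : Cn n => x 0) :=
    ((EuclideanSpace.proj 0 : Cn n →L[ℂ] ℂ).restrictScalars ℝ).contDiff
  have h1 := reCLM.contDiff.comp h
  have h2 := imCLM.contDiff.comp h
  exact (h1.mul h1).add (h2.mul h2)

theorem contDiff_conf (a : ℝ) : ContDiff ℝ ∞ (conf a : Cn n → ℝ) :=
  contDiff_const.add (contDiff_const.mul contDiff_rho)

theorem contDiff_apply_zero : ContDiff ℝ ∞ (fun x : Cn n => x 0) :=
  ((EuclideanSpace.proj 0 : Cn n →L[ℂ] ℂ).restrictScalars ℝ).contDiff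

theorem contDiff_defo (a : ℝ) : ContDiff ℝ ∞ (defo a : Cn n → Cn n) := by
  unfold defo
  exact contDiff_id.add ((contDiff_const.mul contDiff_apply_zero).smul contDiff_const)

theorem contDiff_Tvec (a : ℝ) : ContDiff ℝ ∞ (Tvec a : Cn n → Cn n) :=
  contDiff_const.smul (f := fun _ => I) (contDiff_defo a)

theorem contDiff_ctForm (ha : 0 < a) :
    ContDiff ℝ ∞ (fun p : Cn n × Cn n => ctForm a p.1 p.2) := by
  unfold ctForm
  exact (imCLM.contDiff.comp (contDiff_fst.inner ℂ contDiff_snd)).div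
    ((contDiff_conf a).comp contDiff_fst) fun p => (conf_pos ha p.1).ne'

theorem contDiff_proj (ha : 0 < a) :
    ContDiff ℝ ∞ (fun p : Cn n × Cn n => proj a p.1 p.2) := by
  unfold proj
  exact contDiff_snd.sub ((ofRealCLM.contDiff.comp (contDiff_ctForm ha)).smul
    ((contDiff_Tvec a).comp contDiff_fst))

theorem etaF_mdiff (ha : 0 < a) {x : Sph n}
    (hY : MDifferentiableAt (𝓡 (2 * n + 1)) (𝓡 (2 * n + 1)).tangent
    (fun x => (⟨x, Y x⟩ : TangentBundle (𝓡 (2 * n + 1)) (Sph n))) x) :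
    MDifferentiableAt (𝓡 (2 * n + 1)) 𝓘(ℝ, ℝ) (etaF Y a) x :=
  (HasD.fderiv_comp (F := fun x : Sph n => ((x : Cn n), hat Y x))
    ((contDiff_ctForm ha).differentiable (by simp) (↑x, hat Y x)).hasFDerivAt
    ((hasD_incl x 0).prodMk (hasD_hat hY 0))).1

theorem projF_mdiff (ha : 0 < a) {x : Sph n}
    (hY : MDifferentiableAt (𝓡 (2 * n + 1)) (𝓡 (2 * n + 1)).tangent
    (fun x => (⟨x, Y x⟩ : TangentBundle (𝓡 (2 * n + 1)) (Sph n))) x) :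
    MDifferentiableAt (𝓡 (2 * n + 1)) 𝓘(ℝ, Cn n) (projF Y a) x :=
  (HasD.fderiv_comp (F := fun x : Sph n => ((x : Cn n), hat Y x))
    ((contDiff_proj ha).differentiable (by simp) (↑x, hat Y x)).hasFDerivAt
    ((hasD_incl x 0).prodMk (hasD_hat hY 0))).1

theorem contMDiff_comp_incl_prod {W V : Type*} [NormedAddCommGroup W] [NormedSpace ℝ W]
    [NormedAddCommGroup V] [NormedSpace ℝ V] {Φ : Cn n × W → V} (hΦ : ContDiff ℝ ∞ Φ)
    {F : Sph n → W} (hF : ContMDiff (𝓡 (2 * n + 1)) 𝓘(ℝ, W) ∞ F) :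
    ContMDiff (𝓡 (2 * n + 1)) 𝓘(ℝ, V) ∞ (fun x : Sph n => Φ (↑x, F x)) :=
  hΦ.contMDiff.comp ((contMDiff_incl n).prodMk_space hF)

theorem contMDiff_hat (hY : SmoothField Y) :
    ContMDiff (𝓡 (2 * n + 1)) 𝓘(ℝ, Cn n) ∞ (hat Y) := smooth_hat hY

theorem contMDiff_etaF (ha : 0 < a) (hY : SmoothField Y) :
    ContMDiff (𝓡 (2 * n + 1)) 𝓘(ℝ, ℝ) ∞ (etaF Y a) :=
  contMDiff_comp_incl_prod (contDiff_ctForm ha) (contMDiff_hat hY)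

theorem contMDiff_projF (ha : 0 < a) (hY : SmoothField Y) :
    ContMDiff (𝓡 (2 * n + 1)) 𝓘(ℝ, Cn n) ∞ (projF Y a) :=
  contMDiff_comp_incl_prod (contDiff_proj ha) (contMDiff_hat hY)

theorem smoothField_mkField {η : Sph n → ℝ} {y : Sph n → Cn n}
    (hη : ContMDiff (𝓡 (2 * n + 1)) 𝓘(ℝ, ℝ) ∞ η)
    (hy : ContMDiff (𝓡 (2 * n + 1)) 𝓘(ℝ, Cn n) ∞ y)
    (hQ : ∀ x : Sph n, inner ℂ (x : Cn n) (y x) = 0) : SmoothField (mkField a η y) := by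
  refine smoothField_tlift ?_ fun x => inner_real_Tvec_smul_add a x _ (hQ x)
  have h : ContDiff ℝ ∞ (fun p : Cn n × ℝ => (p.2 : ℂ) • Tvec a p.1) :=
    (ofRealCLM.contDiff.comp contDiff_snd).smul ((contDiff_Tvec a).comp contDiff_fst)
  exact (contMDiff_comp_incl_prod h hη).add hy

theorem hat_eq (x : Sph n) : hat Y x = (etaF Y a x : ℂ) • Tvec a (x : Cn n) + projF Y a x := by
  unfold etaF projF
  rw [ctForm_smul_add_proj]

theorem inner_projF (ha : 0 < a) (x : Sph n) : inner ℂ (x : Cn n) (projF Y a x) = 0 :=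
  inner_sphere_proj ha x (inner_dIncl x (Y x))

/-- Differentiation of the identity `⟨x, y(x)⟩ = 0`; it supplies the hypothesis `hdy` of
`inner_transConn`. -/
theorem inner_hat_dproj (ha : 0 < a) {x : Sph n} {v : TangentSpace (𝓡 (2 * n + 1)) x}
    {y : Sph n → Cn n} {dy : Cn n} (h : HasD (𝓡 (2 * n + 1)) y x v dy)
    (hy : ∀ x : Sph n, inner ℂ (x : Cn n) (y x) = 0) :
    inner ℂ (dIncl n x v) (y x) + inner ℂ (x : Cn n) dy = 0 := by
  have h1 := (hasD_incl x v).hinner h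
  simp only [hy] at h1
  exact h1.unique (HasD.const 0 x v)

/-- The Levi-Civita connection of the deformed metric, as a map into the Hermitian space. -/
def lcHat (a : ℝ) (Y : (x : Sph n) → TangentSpace (𝓡 (2 * n + 1)) x) (x : Sph n)
    (v : TangentSpace (𝓡 (2 * n + 1)) x) : Cn n :=
  lcConn a x (ctForm a x (dIncl n x v)) (proj a x (dIncl n x v)) (etaF Y a x) (projF Y a x)
    (mvfderiv (𝓡 (2 * n + 1)) (etaF Y a) x v) (mvfderiv (𝓡 (2 * n + 1)) (projF Y a) x v)

theorem lcHat_add_right (x : Sph n) (v w : TangentSpace (𝓡 (2 * n + 1)) x) :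
    lcHat a Y x (v + w) = lcHat a Y x v + lcHat a Y x w := by
  simp only [lcHat, lcConn, transConn, map_add, ctForm_add, proj_add, inner_add_left, add_im,
    PiLp.add_apply, ofReal_add, ofReal_sub, ofReal_mul]
  module

theorem lcHat_smul_right (x : Sph n) (r : ℝ) (v : TangentSpace (𝓡 (2 * n + 1)) x) :
    lcHat a Y x (r • v) = r • lcHat a Y x v := by
  have hi : inner ℂ ((r : ℂ) • proj a x (dIncl n x v)) (projF Y a x) =
      r * inner ℂ (proj a x (dIncl n x v)) (projF Y a x) := by
    rw [inner_smul_left, conj_ofReal]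
  simp only [lcHat, lcConn, transConn, map_smul, ctForm_smul, proj_smul,
    smul_eq_mul]
  simp only [← Complex.coe_smul, hi, PiLp.smul_apply, smul_eq_mul, ofReal_sub, ofReal_mul,
    re_ofReal_mul, im_ofReal_mul]
  module

theorem lcConn_add (a : ℝ) (x : Cn n) (η : ℝ) (X : Cn n) (η₁ η₂ d₁ d₂ : ℝ) (y₁ y₂ e₁ e₂ : Cn n) :
    lcConn a x η X (η₁ + η₂) (y₁ + y₂) (d₁ + d₂) (e₁ + e₂) =
      lcConn a x η X η₁ y₁ d₁ e₁ + lcConn a x η X η₂ y₂ d₂ e₂ := by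
  simp only [lcConn, transConn_add, inner_add_right, add_im, ofReal_add, ofReal_sub, ofReal_mul]
  module

/-- The Leibniz rule in algebraic form, with `dr` in the role of the derivative of `r`. -/
theorem lcConn_smul (a : ℝ) (x : Cn n) (η : ℝ) (X : Cn n) (η₁ d₁ : ℝ) (y₁ e₁ : Cn n) (r dr : ℝ) :
    lcConn a x η X (r * η₁) (r • y₁) (dr * η₁ + r * d₁) (dr • y₁ + r • e₁) =
      r • lcConn a x η X η₁ y₁ d₁ e₁ + dr • ((η₁ : ℂ) • Tvec a x + y₁) := by
  simp only [← Complex.coe_smul, lcConn, transConn_csmul, inner_smul_right, ofReal_add, ofReal_sub,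
    ofReal_mul, re_ofReal_mul, im_ofReal_mul]
  module

theorem etaF_add (Y Z : (x : Sph n) → TangentSpace (𝓡 (2 * n + 1)) x) :
    etaF (Y + Z) a = etaF Y a + etaF Z a := by
  funext x
  simp only [etaF, hat, Pi.add_apply, map_add, ctForm_add]

theorem projF_add (Y Z : (x : Sph n) → TangentSpace (𝓡 (2 * n + 1)) x) :
    projF (Y + Z) a = projF Y a + projF Z a := by
  funext x
  simp only [projF, hat, Pi.add_apply, map_add, proj_add]

theorem etaF_smul (g : Sph n → ℝ) (Y : (x : Sph n) → TangentSpace (𝓡 (2 * n + 1)) x) :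
    etaF (g • Y) a = fun x => g x * etaF Y a x := by
  funext x
  simp only [etaF, hat, Pi.smul_apply', map_smul, ctForm_smul]

theorem projF_smul (g : Sph n → ℝ) (Y : (x : Sph n) → TangentSpace (𝓡 (2 * n + 1)) x) :
    projF (g • Y) a = fun x => g x • projF Y a x := by
  funext x
  simp only [projF, hat, Pi.smul_apply', map_smul, proj_smul]

/-- The Levi-Civita connection of the deformed metric. -/
def lcCov (n : ℕ) {a : ℝ} (ha : 0 < a) : CovariantDerivative (𝓡 (2 * n + 1))
    (EuclideanSpace ℝ (Fin (2 * n + 1)))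
    (TangentSpace (𝓡 (2 * n + 1)) : Sph n → Type _) where
  toFun Y x := LinearMap.toContinuousLinearMap
    { toFun := fun v => tlift n x (lcHat a Y x v)
      map_add' := fun v w => by rw [lcHat_add_right, map_add]
      map_smul' := fun r v => by rw [lcHat_smul_right, map_smul]; rfl }
  isCovariantDerivativeOnUniv :=
    { add := by
        intro Y Z x hY hZ _
        ext1 v
        have e : lcHat a (Y + Z) x v = lcHat a Y x v + lcHat a Z x v := by
          have h1 := ((HasD.of_mdiff (v := v) (etaF_mdiff ha hY)).add
            (HasD.of_mdiff (v := v) (etaF_mdiff ha hZ))).2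
          have h2 := ((HasD.of_mdiff (v := v) (projF_mdiff ha hY)).add
            (HasD.of_mdiff (v := v) (projF_mdiff ha hZ))).2
          rw [lcHat, etaF_add, projF_add]
          refine (congrArg₂ (lcConn a _ _ _ _ _) h1 h2).trans ?_
          exact lcConn_add _ _ _ _ _ _ _ _ _ _ _ _
        exact (congrArg (tlift n x) e).trans (map_add _ _ _)
      leibniz := by
        intro Y g x hY hg _
        ext1 v
        have e : lcHat a (g • Y) x v =
            g x • lcHat a Y x v + (mvfderiv (𝓡 (2 * n + 1)) g x v) • hat Y x := by
          have hg' := HasD.of_mdiff (v := v) hg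
          have h1 := (hg'.mul (HasD.of_mdiff (v := v) (etaF_mdiff ha hY))).2
          have h2 := (hg'.smul (HasD.of_mdiff (v := v) (projF_mdiff ha hY))).2
          rw [lcHat, etaF_smul, projF_smul, h1, h2, lcConn_smul, ← hat_eq]
          rfl
        refine (congrArg (tlift n x) e).trans ?_
        rw [map_add, map_smul, map_smul, hat, tlift_dIncl]
        rfl }

theorem lcCov_apply (ha : 0 < a) (Y : (x : Sph n) → TangentSpace (𝓡 (2 * n + 1)) x) (x : Sph n)
    (v : TangentSpace (𝓡 (2 * n + 1)) x) : lcCov n ha Y x v = tlift n x (lcHat a Y x v) := rfl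

theorem inner_transConn_projF (ha : 0 < a) {x : Sph n}
    (hY : MDifferentiableAt (𝓡 (2 * n + 1)) (𝓡 (2 * n + 1)).tangent
      (fun x => (⟨x, Y x⟩ : TangentBundle (𝓡 (2 * n + 1)) (Sph n))) x)
    (v : TangentSpace (𝓡 (2 * n + 1)) x) :
    inner ℂ (x : Cn n) (transConn a x (ctForm a x (dIncl n x v)) (proj a x (dIncl n x v))
      (projF Y a x) (mvfderiv (𝓡 (2 * n + 1)) (projF Y a) x v)) = 0 := by
  refine inner_transConn ha x _ (inner_sphere_proj ha x (inner_dIncl x v)) (inner_projF ha x) ?_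
  rw [ctForm_smul_add_proj]
  exact inner_hat_dproj ha (HasD.of_mdiff (projF_mdiff ha hY)) (inner_projF ha)

theorem inner_lcConn_proj (ha : 0 < a) {x : Sph n}
    (hY : MDifferentiableAt (𝓡 (2 * n + 1)) (𝓡 (2 * n + 1)).tangent
      (fun x => (⟨x, Y x⟩ : TangentBundle (𝓡 (2 * n + 1)) (Sph n))) x)
    (v : TangentSpace (𝓡 (2 * n + 1)) x) :
    inner ℂ (x : Cn n) ((etaF Y a x * I : ℂ) • (proj a x (dIncl n x v)) +
      transConn a x (ctForm a x (dIncl n x v)) (proj a x (dIncl n x v))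
      (projF Y a x) (mvfderiv (𝓡 (2 * n + 1)) (projF Y a) x v)) = 0 := by
  rw [inner_add_right, inner_smul_right, inner_transConn_projF ha hY,
    inner_sphere_proj ha x (inner_dIncl x v)]
  simp

/-- `tlift` inverts `dIncl` only on tangent vectors. That `lcHat` is tangent comes from
differentiating `⟨x, y⟩ = 0`, hence the differentiability hypothesis. -/
theorem dIncl_lcCov (ha : 0 < a) {x : Sph n}
    (hY : MDifferentiableAt (𝓡 (2 * n + 1)) (𝓡 (2 * n + 1)).tangent
      (fun x => (⟨x, Y x⟩ : TangentBundle (𝓡 (2 * n + 1)) (Sph n))) x)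
    (v : TangentSpace (𝓡 (2 * n + 1)) x) :
    dIncl n x (lcCov n ha Y x v) = lcHat a Y x v := by
  rw [lcCov_apply]
  exact dIncl_tlift x (inner_real_Tvec_smul_add a x _ (inner_lcConn_proj ha hY v))

theorem ctForm_lcCov (ha : 0 < a) {x : Sph n}
    (hY : MDifferentiableAt (𝓡 (2 * n + 1)) (𝓡 (2 * n + 1)).tangent
      (fun x => (⟨x, Y x⟩ : TangentBundle (𝓡 (2 * n + 1)) (Sph n))) x)
    (v : TangentSpace (𝓡 (2 * n + 1)) x) :
    ctForm a x (dIncl n x (lcCov n ha Y x v)) = mvfderiv (𝓡 (2 * n + 1)) (etaF Y a) x v -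
      (conf a (x : Cn n))⁻¹ * (inner ℂ (proj a x (dIncl n x v)) (projF Y a x)).im := by
  rw [dIncl_lcCov ha hY]
  exact ctForm_Tvec_smul_add ha x _ (inner_lcConn_proj ha hY v)

theorem proj_lcCov (ha : 0 < a) {x : Sph n}
    (hY : MDifferentiableAt (𝓡 (2 * n + 1)) (𝓡 (2 * n + 1)).tangent
      (fun x => (⟨x, Y x⟩ : TangentBundle (𝓡 (2 * n + 1)) (Sph n))) x)
    (v : TangentSpace (𝓡 (2 * n + 1)) x) :
    proj a x (dIncl n x (lcCov n ha Y x v)) = (etaF Y a x * I : ℂ) • (proj a x (dIncl n x v)) +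
      transConn a x (ctForm a x (dIncl n x v)) (proj a x (dIncl n x v))
      (projF Y a x) (mvfderiv (𝓡 (2 * n + 1)) (projF Y a) x v) := by
  rw [dIncl_lcCov ha hY]
  exact proj_Tvec_smul_add ha x _ (inner_lcConn_proj ha hY v)

/-- All arguments are independent variables here, so that `preservesSmooth_lcCov` follows by
composition. -/
theorem contDiff_lcConn (ha : 0 < a) :
    ContDiff ℝ ∞ (fun p : Cn n × (ℝ × Cn n × ℝ × Cn n × ℝ × Cn n) =>
      lcConn a p.1 p.2.1 p.2.2.1 p.2.2.2.1 p.2.2.2.2.1 p.2.2.2.2.2.1 p.2.2.2.2.2.2) := by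
  have hx : ContDiff ℝ ∞ (fun p : Cn n × (ℝ × Cn n × ℝ × Cn n × ℝ × Cn n) => p.1) := by fun_prop
  have hη : ContDiff ℝ ∞ (fun p : Cn n × (ℝ × Cn n × ℝ × Cn n × ℝ × Cn n) => (p.2.1 : ℂ)) := ofRealCLM.contDiff.comp (by fun_prop)
  have hX : ContDiff ℝ ∞ (fun p : Cn n × (ℝ × Cn n × ℝ × Cn n × ℝ × Cn n) => p.2.2.1) := by fun_prop
  have hηY : ContDiff ℝ ∞ (fun p : Cn n × (ℝ × Cn n × ℝ × Cn n × ℝ × Cn n) => (p.2.2.2.1 : ℂ)) := ofRealCLM.contDiff.comp (by fun_prop)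
  have hy : ContDiff ℝ ∞ (fun p : Cn n × (ℝ × Cn n × ℝ × Cn n × ℝ × Cn n) => p.2.2.2.2.1) := by fun_prop
  have hd : ContDiff ℝ ∞ (fun p : Cn n × (ℝ × Cn n × ℝ × Cn n × ℝ × Cn n) => p.2.2.2.2.2.1) := by fun_prop
  have hdy : ContDiff ℝ ∞ (fun p : Cn n × (ℝ × Cn n × ℝ × Cn n × ℝ × Cn n) => p.2.2.2.2.2.2) := by fun_prop
  have hx0 : ContDiff ℝ ∞ (fun p : Cn n × (ℝ × Cn n × ℝ × Cn n × ℝ × Cn n) => conj (p.1 0)) :=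
    (conjCLE : ℂ →L[ℝ] ℂ).contDiff.comp (contDiff_apply_zero.comp hx)
  have hX0 : ContDiff ℝ ∞ (fun p : Cn n × (ℝ × Cn n × ℝ × Cn n × ℝ × Cn n) => p.2.2.1 0) := contDiff_apply_zero.comp hX
  have hy0 : ContDiff ℝ ∞ (fun p : Cn n × (ℝ × Cn n × ℝ × Cn n × ℝ × Cn n) => p.2.2.2.2.1 0) := contDiff_apply_zero.comp hy
  have hf : ContDiff ℝ ∞ (fun p : Cn n × (ℝ × Cn n × ℝ × Cn n × ℝ × Cn n) => (conf a p.1)⁻¹) :=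
    ((contDiff_conf a).comp hx).inv fun p => (conf_pos ha _).ne'
  have hfc : ContDiff ℝ ∞ (fun p : Cn n × (ℝ × Cn n × ℝ × Cn n × ℝ × Cn n) => (conf a p.1 : ℂ)⁻¹) := by
    simp only [← ofReal_inv]
    exact ofRealCLM.contDiff.comp hf
  have hh : ContDiff ℝ ∞ (fun p : Cn n × (ℝ × Cn n × ℝ × Cn n × ℝ × Cn n) => inner ℂ p.2.2.1 p.2.2.2.2.1) := hX.inner ℂ hy
  have h1 : ContDiff ℝ ∞ (fun p : Cn n × (ℝ × Cn n × ℝ × Cn n × ℝ × Cn n) =>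
      ((p.2.2.2.2.2.1 - (conf a p.1)⁻¹ * (inner ℂ p.2.2.1 p.2.2.2.2.1).im : ℝ) : ℂ)) :=
    ofRealCLM.contDiff.comp (hd.sub (hf.mul (imCLM.contDiff.comp hh)))
  unfold lcConn transConn
  exact (h1.smul ((contDiff_Tvec a).comp hx)).add (((hηY.mul contDiff_const).smul hX).add
    (((hdy.sub (((contDiff_const.mul hη).mul hy0).smul contDiff_const)).sub
      (((contDiff_const.mul hfc).mul hx0).smul ((hX0.smul hy).add (hy0.smul hX)))).add
        ((hfc.mul hh).smul ((contDiff_defo a).comp hx))))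

end SphereConnection

/-! ### The deformed metric: existence and uniqueness -/

section DeformedMetric

open Complex ComplexConjugate

variable {n : ℕ} {a : ℝ}

/-- The real inner product as a continuous bilinear form. -/
def innerR (n : ℕ) : Cn n →L[ℝ] Cn n →L[ℝ] ℝ := innerSL ℝ

theorem innerR_apply (v w : Cn n) : innerR n v w = inner ℝ v w := rfl

/-- The contact form as a continuous linear map. -/
def ctFormL (a : ℝ) (x : Cn n) : Cn n →L[ℝ] ℝ := (conf a x)⁻¹ • innerR n (I • x)

theorem ctFormL_apply (x v : Cn n) : ctFormL a x v = ctForm a x v := by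
  simp only [ctFormL, ContinuousLinearMap.smul_apply, innerR_apply, inner_real_eq_re,
    inner_smul_left, ctForm]
  simp
  ring

/-- The deformed metric as a continuous bilinear form. -/
def metricFormL (a : ℝ) (x : Cn n) : Cn n →L[ℝ] Cn n →L[ℝ] ℝ :=
  (1 + (conf a x)⁻¹ * inner ℝ (Tvec a x) (Tvec a x)) • (ctFormL a x).smulRight (ctFormL a x) +
    (conf a x)⁻¹ • (innerR n - (innerR n (Tvec a x)).smulRight (ctFormL a x) -
      (ctFormL a x).smulRight (innerR n (Tvec a x)))

theorem metricFormL_apply (x v w : Cn n) : metricFormL a x v w = metricForm a x v w := by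
  simp only [metricFormL, metricForm, proj, Complex.coe_smul, inner_sub_left, inner_sub_right,
    real_inner_smul_left, real_inner_smul_right, ContinuousLinearMap.add_apply,
    ContinuousLinearMap.smul_apply, ContinuousLinearMap.sub_apply,
    ContinuousLinearMap.smulRight_apply, innerR_apply, ctFormL_apply, smul_eq_mul]
  rw [real_inner_comm v (Tvec a x)]
  ring

theorem contDiff_ctFormL (ha : 0 < a) : ContDiff ℝ ∞ (ctFormL a : Cn n → Cn n →L[ℝ] ℝ) := by
  have h1 : ContDiff ℝ ∞ (fun x : Cn n => innerR n (I • x)) :=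
    (innerR n).contDiff.comp (contDiff_const_smul I)
  exact ((contDiff_conf a).inv fun x => (conf_pos ha x).ne').smul h1

theorem contDiff_metricFormL (ha : 0 < a) :
    ContDiff ℝ ∞ (metricFormL a : Cn n → Cn n →L[ℝ] Cn n →L[ℝ] ℝ) := by
  have hf : ContDiff ℝ ∞ (fun x : Cn n => (conf a x)⁻¹) :=
    (contDiff_conf a).inv fun x => (conf_pos ha x).ne'
  have hT : ContDiff ℝ ∞ (fun x : Cn n => innerR n (Tvec a x)) :=
    (innerR n).contDiff.comp (contDiff_Tvec a)
  have he := contDiff_ctFormL (n := n) ha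
  unfold metricFormL
  exact ((contDiff_const.add (hf.mul ((contDiff_Tvec a).inner ℝ (contDiff_Tvec a)))).smul
    (he.smulRight he)).add (hf.smul ((contDiff_const.sub (hT.smulRight he)).sub (he.smulRight hT)))

theorem metricForm_symm (x v w : Cn n) : metricForm a x v w = metricForm a x w v := by
  rw [metricForm, metricForm, real_inner_comm, mul_comm (ctForm a x v)]

/-- If `ctForm` vanishes on `v`, then `proj` fixes `v` and the second summand is positive; otherwise
the first one is. -/
theorem metricForm_pos (ha : 0 < a) (x : Cn n) {v : Cn n} (hv : v ≠ 0) :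
    0 < metricForm a x v v := by
  have hf := conf_pos ha x
  rw [metricForm, real_inner_self_eq_norm_sq]
  by_cases h : ctForm a x v = 0
  · have : proj a x v = v := by simp [proj, h]
    rw [this, h]
    have := norm_pos_iff.2 hv
    positivity
  · have := mul_self_pos.2 h
    positivity

/-- A positive definite form on a finite dimensional space has a bounded unit ball. -/
theorem isVonNBounded_unitBall {V : Type*} [NormedAddCommGroup V] [NormedSpace ℝ V]
    [FiniteDimensional ℝ V] (B : V →L[ℝ] V →L[ℝ] ℝ) (hB : ∀ v, v ≠ 0 → 0 < B v v) :
    Bornology.IsVonNBounded ℝ {v | B v v < 1} := by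
  have hc : Continuous fun v => B v v := by fun_prop
  have : ProperSpace V := FiniteDimensional.proper ℝ V
  -- `c` is the minimum of `B` on the unit sphere (`1` if that is empty); homogeneity then bounds
  -- the unit ball by `√(1/c)`.
  obtain ⟨c, hc0, hcl⟩ : ∃ c : ℝ, 0 < c ∧ ∀ v ∈ Metric.sphere (0 : V) 1, c ≤ B v v := by
    rcases (Metric.sphere (0 : V) 1).eq_empty_or_nonempty with h | h
    · exact ⟨1, one_pos, by simp [h]⟩
    · obtain ⟨v, hv, hmin⟩ := (isCompact_sphere (0 : V) 1).exists_isMinOn h hc.continuousOn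
      refine ⟨B v v, hB v ?_, fun w hw => hmin hw⟩
      rintro rfl
      simp at hv
  rw [NormedSpace.isVonNBounded_iff ℝ, Metric.isBounded_iff_subset_closedBall 0]
  refine ⟨Real.sqrt (c⁻¹), fun v hv => ?_⟩
  rw [mem_closedBall_zero_iff]
  apply Real.le_sqrt_of_sq_le
  by_cases h0 : v = 0
  · simp [h0, hc0.le]
  have hn := norm_pos_iff.2 h0
  have h1 := hcl (‖v‖⁻¹ • v) (by simp [norm_smul, hn.ne'])
  simp only [map_smul, ContinuousLinearMap.smul_apply, smul_eq_mul] at h1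
  have h2 : B v v < 1 := hv
  have h3 : c * ‖v‖ ^ 2 ≤ B v v := by
    have := mul_le_mul_of_nonneg_right h1 (sq_nonneg ‖v‖)
    field_simp at this
    linarith
  rw [← one_div, le_div_iff₀ hc0]
  linarith

/-- The deformed metric. -/
def defMetric (n : ℕ) {a : ℝ} (ha : 0 < a) : RMetric (𝓡 (2 * n + 1)) (Sph n) where
  inner x := pullForm n (fun x => metricFormL a (x : Cn n)) x
  symm x v w := by
    rw [pullForm_apply, pullForm_apply, metricFormL_apply, metricFormL_apply, metricForm_symm]
  pos x v hv := by
    rw [pullForm_apply, metricFormL_apply]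
    exact metricForm_pos ha _ fun h => hv (dIncl_injective x (h.trans (map_zero _).symm))
  isVonNBounded x := by
    refine isVonNBounded_unitBall (V := EuclideanSpace ℝ (Fin (2 * n + 1)))
      (pullForm n (fun x => metricFormL a (x : Cn n)) x) fun v hv => ?_
    exact (metricForm_pos ha _ fun h => hv (dIncl_injective x (h.trans (map_zero _).symm))).trans_eq
      (metricFormL_apply _ _ _).symm
  contMDiff := contMDiff_pullForm ((contDiff_metricFormL ha).contMDiff.comp (contMDiff_incl n))

theorem defMetric_inner (ha : 0 < a) (x : Sph n) (v w : TangentSpace (𝓡 (2 * n + 1)) x) :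
    (defMetric n ha).inner x v w = metricForm a x (dIncl n x v) (dIncl n x w) :=
  metricFormL_apply _ _ _

theorem defMetric_inner_field (ha : 0 < a) (Y Z : (x : Sph n) → TangentSpace (𝓡 (2 * n + 1)) x)
    (x : Sph n) : (defMetric n ha).inner x (Y x) (Z x) =
      etaF Y a x * etaF Z a x + (conf a (x : Cn n))⁻¹ * inner ℝ (projF Y a x) (projF Z a x) :=
  defMetric_inner ha x (Y x) (Z x)

theorem dIncl_Tfield (x : Sph n) : dIncl n x (Tfield n a x) = Tvec a (x : Cn n) := by
  rw [Tfield, map_add, map_smul]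
  have h0 : dIncl n x (T₀ n x) = J₀ n x := (exists_tangent n x (J₀ n x) (inner_J₀ n x)).choose_spec
  have h1 : dIncl n x (T₁ n x) = J₁ n x := (exists_tangent n x (J₁ n x) (inner_J₁ n x)).choose_spec
  rw [h0, h1, J₀, J₁, Tvec, defo, smul_add, smul_smul, ← Complex.coe_smul]
  congr 1
  ext i
  refine Fin.cases ?_ (fun j => ?_) i
  · simp [e₀]
    ring
  · simp [e₀]

theorem dIncl_T₀ (x : Sph n) : dIncl n x (T₀ n x) = I • (x : Cn n) :=
  (exists_tangent n x (J₀ n x) (inner_J₀ n x)).choose_spec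

theorem g₀_T₀ (x : Sph n) (v : TangentSpace (𝓡 (2 * n + 1)) x) :
    g₀ n x (T₀ n x) v = (inner ℂ (x : Cn n) (dIncl n x v)).im := by
  rw [g₀, dIncl_T₀, inner_real_eq_re, inner_smul_left]
  simp

theorem inner_dIncl_eq_zero_iff (x : Sph n) (v : TangentSpace (𝓡 (2 * n + 1)) x) :
    g₀ n x (T₀ n x) v = 0 ↔ inner ℂ (x : Cn n) (dIncl n x v) = 0 := by
  have h := inner_dIncl x v
  rw [inner_real_eq_re] at h
  rw [g₀_T₀, Complex.ext_iff]
  simp [h]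

theorem ctForm_Tvec (ha : 0 < a) (x : Sph n) : ctForm a x (Tvec a (x : Cn n)) = 1 := by
  simpa using ctForm_Tvec_smul_add ha x 1 (y := 0) (by simp)

theorem proj_Tvec (ha : 0 < a) (x : Sph n) : proj a x (Tvec a (x : Cn n)) = 0 := by
  simpa using proj_Tvec_smul_add ha x 1 (y := 0) (by simp)

theorem g₀_Tfield_T₀ (x : Sph n) : g₀ n x (Tfield n a x) (T₀ n x) = conf a (x : Cn n) := by
  rw [g₀, real_inner_comm]
  change g₀ n x (T₀ n x) (Tfield n a x) = _
  rw [g₀_T₀, dIncl_Tfield, inner_sphere_Tvec]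
  simp

theorem isDeformedMetric_defMetric (ha : 0 < a) : IsDeformedMetric n a (defMetric n ha) := by
  intro x
  refine ⟨?_, fun v hv => ?_, fun v w hv hw => ?_⟩
  · rw [defMetric_inner, dIncl_Tfield, metricForm, ctForm_Tvec ha, proj_Tvec ha]
    simp
  · rw [inner_dIncl_eq_zero_iff] at hv
    rw [defMetric_inner, dIncl_Tfield, metricForm, ctForm_of_mem hv, proj_Tvec ha]
    simp
  · rw [inner_dIncl_eq_zero_iff] at hv hw
    rw [defMetric_inner, metricForm, ctForm_of_mem hv, proj_of_mem hv, proj_of_mem hw,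
      g₀_Tfield_T₀, g₀]
    simp

theorem exists_decomp (ha : 0 < a) (x : Sph n) (v : TangentSpace (𝓡 (2 * n + 1)) x) :
    ∃ (r : ℝ) (u : TangentSpace (𝓡 (2 * n + 1)) x), g₀ n x (T₀ n x) u = 0 ∧
      v = r • Tfield n a x + u := by
  have hP := inner_sphere_proj ha x (inner_dIncl x v)
  refine ⟨ctForm a x (dIncl n x v), v - ctForm a x (dIncl n x v) • Tfield n a x, ?_, by abel⟩
  rw [inner_dIncl_eq_zero_iff, map_sub, map_smul, dIncl_Tfield, ← Complex.coe_smul]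
  exact hP

/-- The three conditions fix `g` on pairs from `ℝT` and `Q`, and these span the tangent space by
`exists_decomp`. -/
theorem IsDeformedMetric.unique (ha : 0 < a) {g g' : RMetric (𝓡 (2 * n + 1)) (Sph n)}
    (h : IsDeformedMetric n a g) (h' : IsDeformedMetric n a g') : g' = g := by
  have key : ∀ x v w, g'.inner x v w = g.inner x v w := by
    intro x v w
    obtain ⟨r, u, hu, rfl⟩ := exists_decomp ha x v
    obtain ⟨s, t, ht, rfl⟩ := exists_decomp ha x w
    obtain ⟨h1, h2, h3⟩ := h x
    obtain ⟨h1', h2', h3'⟩ := h' x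
    simp only [map_add, map_smul, ContinuousLinearMap.add_apply, ContinuousLinearMap.smul_apply]
    rw [g.symm x u, g'.symm x u, h1, h1', h2 _ hu, h2' _ hu, h2 _ ht, h2' _ ht, h3 _ _ hu ht,
      h3' _ _ hu ht]
  have key' : g'.inner = g.inner := by
    funext x
    ext v w
    exact key x v w
  -- The remaining fields of the structure are propositions, so equality of the inner products
  -- suffices.
  cases g
  cases g'
  simp only at key'
  subst key'
  rfl

end DeformedMetric

/-! ### Levi-Civita, Sasakian and Killing properties -/

section LeviCivita

open Complex ComplexConjugate

variable {n : ℕ} {a : ℝ}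

theorem preservesSmooth_lcCov (ha : 0 < a) : PreservesSmooth (lcCov n ha) := by
  intro X Y hX hY
  refine smoothField_tlift (F := fun x => lcHat a Y x (X x)) ?_ fun x =>
    inner_real_Tvec_smul_add a x _ (inner_lcConn_proj ha (hY.mdiff x) (X x))
  exact contMDiff_comp_incl_prod (contDiff_lcConn ha)
    (F := fun x => (etaF X a x, projF X a x, etaF Y a x, projF Y a x,
      mvfderiv (𝓡 (2 * n + 1)) (etaF Y a) x (X x), mvfderiv (𝓡 (2 * n + 1)) (projF Y a) x (X x)))
    ((contMDiff_etaF ha hX).prodMk_space <| (contMDiff_projF ha hX).prodMk_space <|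
      (contMDiff_etaF ha hY).prodMk_space <| (contMDiff_projF ha hY).prodMk_space <|
      (contMDiff_mvfderiv_apply (contMDiff_etaF ha hY) hX).prodMk_space
        (contMDiff_mvfderiv_apply (contMDiff_projF ha hY) hX))

theorem hasD_Tvec (x : Sph n) (v : TangentSpace (𝓡 (2 * n + 1)) x) :
    HasD (𝓡 (2 * n + 1)) (fun y : Sph n => Tvec a (y : Cn n)) x v (Tvec a (dIncl n x v)) := by
  have h := hasD_incl x v
  refine ((h.add ((h.apply_zero.cmul_const (a : ℂ)).csmul
    (HasD.const (e₀ n) x v))).csmul_const I).congr_deriv ?_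
  simp [Tvec, defo]

theorem mvfderiv_hat (ha : 0 < a) {Y : (x : Sph n) → TangentSpace (𝓡 (2 * n + 1)) x}
    (hY : SmoothField Y) (x : Sph n) (v : TangentSpace (𝓡 (2 * n + 1)) x) :
    mvfderiv (𝓡 (2 * n + 1)) (hat Y) x v =
      (mvfderiv (𝓡 (2 * n + 1)) (etaF Y a) x v : ℂ) • Tvec a (x : Cn n) +
      (etaF Y a x : ℂ) • Tvec a (dIncl n x v) + mvfderiv (𝓡 (2 * n + 1)) (projF Y a) x v := by
  have e : hat Y = fun x => (etaF Y a x : ℂ) • Tvec a (x : Cn n) + projF Y a x :=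
    funext fun x => hat_eq x
  have h1 := HasD.of_mdiff (v := v) (etaF_mdiff ha (hY.mdiff x))
  have h2 := HasD.of_mdiff (v := v) (projF_mdiff ha (hY.mdiff x))
  have h3 := (h1.ofReal.csmul (hasD_Tvec (a := a) x v)).add h2
  rw [e]
  exact h3.2

theorem lcHat_sub_lcHat (ha : 0 < a) {X Y : (x : Sph n) → TangentSpace (𝓡 (2 * n + 1)) x}
    (hX : SmoothField X) (hY : SmoothField Y) (x : Sph n) :
    lcHat a Y x (X x) - lcHat a X x (Y x) =
      mvfderiv (𝓡 (2 * n + 1)) (hat Y) x (X x) - mvfderiv (𝓡 (2 * n + 1)) (hat X) x (Y x) := by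
  rw [mvfderiv_hat ha hY, mvfderiv_hat ha hX]
  have h := lcConn_sub_symm ha x (etaF X a x) (etaF Y a x)
    (mvfderiv (𝓡 (2 * n + 1)) (etaF X a) x (Y x)) (mvfderiv (𝓡 (2 * n + 1)) (etaF Y a) x (X x))
    (DX := mvfderiv (𝓡 (2 * n + 1)) (projF X a) x (Y x))
    (DY := mvfderiv (𝓡 (2 * n + 1)) (projF Y a) x (X x))
    (inner_projF (Y := X) ha x) (inner_projF (Y := Y) ha x)
  rw [← hat_eq, ← hat_eq] at h
  rw [sub_eq_sub_iff_sub_eq_sub]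
  exact h

theorem dIncl_mlieBracket {X Y : (x : Sph n) → TangentSpace (𝓡 (2 * n + 1)) x}
    (hX : SmoothField X) (hY : SmoothField Y) (x : Sph n) :
    dIncl n x (VectorField.mlieBracket (𝓡 (2 * n + 1)) X Y x) =
      mvfderiv (𝓡 (2 * n + 1)) (hat Y) x (X x) - mvfderiv (𝓡 (2 * n + 1)) (hat X) x (Y x) :=
  mvfderiv_mlieBracket (contMDiff_incl n) hX hY x

/-- Up to a symmetric term `lcHat` is the flat derivative in `ℂⁿ⁺¹`, and antisymmetrized flat
derivatives compute the Lie bracket. -/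
theorem torsion_lcCov (ha : 0 < a) : (lcCov n ha).torsion = 0 := by
  funext x
  ext1 u
  ext1 v
  obtain ⟨X, hX, rfl⟩ := hasSmoothExtensions_sphere n x u
  obtain ⟨Y, hY, rfl⟩ := hasSmoothExtensions_sphere n x v
  rw [CovariantDerivative.torsion_apply _ (hX.mdiff x) (hY.mdiff x)]
  apply dIncl_injective x
  rw [map_sub, map_sub, dIncl_lcCov ha (hY.mdiff x), dIncl_lcCov ha (hX.mdiff x),
    lcHat_sub_lcHat ha hX hY, dIncl_mlieBracket hX hY, sub_self]
  exact (map_zero _).symm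

/-- Against `η_Y η_Z + f⁻¹ Re⟨y, z⟩`, the horizontal terms `η_Y iX`, `η_Z iX` cancel the `Im` terms
of the `T` components. What remains is `inner_transConn_add_inner`, whose last term matches the
derivative of `f⁻¹`. -/
theorem isLeviCivita_lcCov (ha : 0 < a) : IsLeviCivita (defMetric n ha) (lcCov n ha) where
  torsion_free := torsion_lcCov ha
  metric := by
    intro Y Z hY hZ x v
    have hη : HasD (𝓡 (2 * n + 1)) _ x v _ := HasD.of_mdiff (etaF_mdiff ha (hY.mdiff x))
    have hy : HasD (𝓡 (2 * n + 1)) _ x v _ := HasD.of_mdiff (projF_mdiff ha (hY.mdiff x))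
    have hζ : HasD (𝓡 (2 * n + 1)) _ x v _ := HasD.of_mdiff (etaF_mdiff ha (hZ.mdiff x))
    have hz : HasD (𝓡 (2 * n + 1)) _ x v _ := HasD.of_mdiff (projF_mdiff ha (hZ.mdiff x))
    have hf := ((hasD_incl x v).conf a).inv (conf_pos ha _).ne'
    have e : (fun y => (defMetric n ha).inner y (Y y) (Z y)) = fun y => etaF Y a y * etaF Z a y +
        (conf a (y : Cn n))⁻¹ * inner ℝ (projF Y a y) (projF Z a y) :=
      funext fun y => defMetric_inner_field ha Y Z y
    have hD := (hη.mul hζ).add (hf.mul (hy.inner hz))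
    rw [e, hD.2, defMetric_inner, defMetric_inner, metricForm, metricForm,
      ctForm_lcCov ha (hY.mdiff x), ctForm_lcCov ha (hZ.mdiff x), proj_lcCov ha (hY.mdiff x),
      proj_lcCov ha (hZ.mdiff x)]
    rw [show ctForm a x (dIncl n x (Y x)) = etaF Y a x from rfl,
      show ctForm a x (dIncl n x (Z x)) = etaF Z a x from rfl,
      show proj a x (dIncl n x (Y x)) = projF Y a x from rfl,
      show proj a x (dIncl n x (Z x)) = projF Z a x from rfl]
    have hX := inner_sphere_proj ha x (inner_dIncl x v)
    have hyQ := inner_projF (Y := Y) ha x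
    have hzQ := inner_projF (Y := Z) ha x
    have key := congrArg Complex.re (inner_transConn_add_inner ha x (ctForm a x (dIncl n x v))
      (dy := mvfderiv (𝓡 (2 * n + 1)) (projF Y a) x v)
      (dz := mvfderiv (𝓡 (2 * n + 1)) (projF Z a) x v) hX hyQ hzQ)
    -- The factor `f` is constant along `T`: `conj (x 0)` times the coordinate `0` of `T` is
    -- imaginary. Hence only the horizontal part of `v` differentiates it.
    have hv0 : (conj (x.1 0) * dIncl n x v 0).re = (conj (x.1 0) * proj a x (dIncl n x v) 0).re := by
      conv_lhs => rw [← ctForm_smul_add_proj a x (dIncl n x v)]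
      simp only [PiLp.add_apply, PiLp.smul_apply, Tvec, defo_apply_zero, smul_eq_mul]
      simp
      ring
    have hc : (a : ℂ) * (conf a (x : Cn n) : ℂ)⁻¹ *
        (conj (x.1 0) * proj a x (dIncl n x v) 0 + x.1 0 * conj (proj a x (dIncl n x v) 0)) =
        ((a * (conf a (x : Cn n))⁻¹ * (2 * (conj (x.1 0) * dIncl n x v 0).re) : ℝ) : ℂ) := by
      rw [hv0]
      have h2 : x.1 0 * conj (proj a x (dIncl n x v) 0) =
          conj (conj (x.1 0) * proj a x (dIncl n x v) 0) := by simp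
      rw [h2, add_conj]
      push_cast
      ring
    have h3 : ∀ w : Cn n, inner ℂ w (proj a x (dIncl n x v)) =
        conj (inner ℂ (proj a x (dIncl n x v)) w) := fun w => (inner_conj_symm _ _).symm
    rw [hc, Complex.sub_re, re_ofReal_mul] at key
    simp only [inner_real_eq_re, inner_add_left, inner_add_right, inner_smul_left, inner_smul_right,
      h3, add_re] at key ⊢
    simp only [map_mul, conj_ofReal, conj_I, mul_re, mul_im, ofReal_re, ofReal_im, I_re, I_im,
      neg_re, neg_im, conj_re, conj_im]
    simp only [mul_re, conj_re, conj_im] at key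
    have hf0 := (conf_pos ha (x : Cn n)).ne'
    field_simp
    field_simp at key
    linear_combination (-1) * key

theorem Tfield_eq : Tfield n a = mkField a (fun _ => 1) (fun _ => 0) := by
  funext x
  apply dIncl_injective x
  rw [dIncl_Tfield]
  refine Eq.trans ?_ (hat_mkField (by simp)).symm
  simp

theorem smoothField_Tfield : SmoothField (Tfield n a) := by
  rw [Tfield_eq]
  exact smoothField_mkField contMDiff_const contMDiff_const (by simp)

theorem etaF_Tfield (ha : 0 < a) : etaF (Tfield n a) a = fun _ => 1 := by
  funext x
  rw [etaF, hat, dIncl_Tfield, ctForm_Tvec ha]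

theorem projF_Tfield (ha : 0 < a) : projF (Tfield n a) a = fun _ => 0 := by
  funext x
  rw [projF, hat, dIncl_Tfield, proj_Tvec ha]

/-- `T` has constant components `1` and `0`, so only the term `ηY i X` of `lcConn` survives. -/
theorem dIncl_lcCov_Tfield (ha : 0 < a) (x : Sph n) (v : TangentSpace (𝓡 (2 * n + 1)) x) :
    dIncl n x (lcCov n ha (Tfield n a) x v) = I • proj a x (dIncl n x v) := by
  rw [dIncl_lcCov ha (smoothField_Tfield.mdiff x), lcHat, etaF_Tfield ha, projF_Tfield ha,
    mvfderiv_const, mvfderiv_const]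
  simp [lcConn, transConn]

/-- `∇_Y T = i proj Y` is horizontal and `transConn` commutes with `i`, so the transverse
derivatives cancel. This leaves `-i(η_Y iX) = η_Y X` and `-f⁻¹ Im⟨X, iy⟩ T = -f⁻¹ Re⟨X, y⟩ T`;
adding and subtracting `η_Y η_v T` gives the right side. -/
theorem sasakianEquation_Tfield (ha : 0 < a) :
    SasakianEquation (defMetric n ha) (lcCov n ha) (Tfield n a) := by
  intro Y hY x v
  apply dIncl_injective x
  have hZ : SmoothField (fun y => lcCov n ha (Tfield n a) y (Y y)) :=
    preservesSmooth_lcCov ha _ _ hY smoothField_Tfield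
  have hat_Z : hat (fun y => lcCov n ha (Tfield n a) y (Y y)) = fun y => I • projF Y a y :=
    funext fun y => dIncl_lcCov_Tfield ha y (Y y)
  have hQ : ∀ y : Sph n, inner ℂ (y : Cn n) (I • projF Y a y) = 0 := fun y => by
    rw [inner_smul_right, inner_projF ha, mul_zero]
  have hη : etaF (fun y => lcCov n ha (Tfield n a) y (Y y)) a = fun _ => 0 := by
    funext y
    rw [etaF, hat_Z, ctForm_of_mem (hQ y)]
  have hp : projF (fun y => lcCov n ha (Tfield n a) y (Y y)) a = fun y => I • projF Y a y := by
    funext y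
    rw [projF, hat_Z, proj_of_mem (hQ y)]
  have hdp := (HasD.of_mdiff (v := v) (projF_mdiff ha (hY.mdiff x))).csmul_const I
  rw [map_sub, dIncl_lcCov ha (hZ.mdiff x), dIncl_lcCov_Tfield, lcHat, hη, hp, hdp.2,
    mvfderiv_const, proj_lcCov ha (hY.mdiff x), map_sub, map_smul, map_smul, dIncl_Tfield,
    defMetric_inner, defMetric_inner, dIncl_Tfield, metricForm, metricForm, ctForm_Tvec ha,
    proj_Tvec ha]
  have ht := transConn_csmul a (x : Cn n) (ctForm a x (dIncl n x v)) (proj a x (dIncl n x v))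
    (projF Y a x) (mvfderiv (𝓡 (2 * n + 1)) (projF Y a) x v) I 0
  rw [zero_smul, zero_add, zero_add] at ht
  rw [lcConn, ht, inner_smul_right, inner_real_eq_re]
  have hI : ∀ z : ℂ, (I * z).im = z.re := fun z => by simp
  rw [hI, inner_zero_left]
  have hdec := ctForm_smul_add_proj a x (dIncl n x v)
  have hII : I * I = -1 := I_mul_I
  rw [show ctForm a x (dIncl n x (Y x)) = etaF Y a x from rfl,
    show proj a x (dIncl n x (Y x)) = projF Y a x from rfl, inner_real_eq_re]
  simp only [← Complex.coe_smul, ofReal_sub, ofReal_mul, ofReal_add, ofReal_inv, zero_re,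
    ofReal_zero, ofReal_one, ContinuousLinearMap.zero_apply]
  linear_combination (norm := module) (etaF Y a x : ℂ) • hdec -
    hII • ((etaF Y a x : ℂ) • proj a (x : Cn n) (dIncl n x v))

/-- By torsion-freeness the Killing equation says that `∇T` is skew, and multiplication by `i` is
skew on `Q`. -/
theorem isKilling_Tfield (ha : 0 < a) : IsKilling (defMetric n ha) (Tfield n a) := by
  refine ⟨smoothField_Tfield, fun X Y hX hY x => ?_⟩
  have hLC := isLeviCivita_lcCov (n := n) ha
  have hskew : ∀ u v : TangentSpace (𝓡 (2 * n + 1)) x,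
      (defMetric n ha).inner x (lcCov n ha (Tfield n a) x u) v +
        (defMetric n ha).inner x u (lcCov n ha (Tfield n a) x v) = 0 := by
    intro u v
    have hQ : ∀ w : TangentSpace (𝓡 (2 * n + 1)) x,
        inner ℂ (x : Cn n) (I • proj a x (dIncl n x w)) = 0 := fun w => by
      rw [inner_smul_right, inner_sphere_proj ha x (inner_dIncl x w), mul_zero]
    rw [defMetric_inner, defMetric_inner, dIncl_lcCov_Tfield, dIncl_lcCov_Tfield, metricForm,
      metricForm, ctForm_of_mem (hQ u), ctForm_of_mem (hQ v), proj_of_mem (hQ u),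
      proj_of_mem (hQ v), inner_real_eq_re, inner_real_eq_re, inner_smul_left, inner_smul_right]
    simp
  rw [hLC.metric X Y hX hY, ← hLC.cov_sub_cov smoothField_Tfield hX,
    ← hLC.cov_sub_cov smoothField_Tfield hY, map_sub, map_sub, ContinuousLinearMap.sub_apply]
  linarith [hskew (X x) (Y x)]

theorem isSasakian_Tfield (ha : 0 < a) : IsSasakian (defMetric n ha) (Tfield n a) :=
  ⟨isKilling_Tfield ha, fun x => (isDeformedMetric_defMetric ha x).1, lcCov n ha,
    isLeviCivita_lcCov ha, sasakianEquation_Tfield ha⟩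

end LeviCivita

/-! ### Curvature applied to the horizontal field `ν` -/

section TransverseCurvature

open Complex ComplexConjugate VectorField

variable {n : ℕ} {a : ℝ}

/-- The projection of a constant vector to the transverse distribution. -/
def horiz (c x : Cn n) : Cn n := c - inner ℂ x c • x

theorem inner_horiz (c : Cn n) (x : Sph n) : inner ℂ (x : Cn n) (horiz c (x : Cn n)) = 0 := by
  rw [horiz, inner_sub_right, inner_smul_right, inner_sphere_self]
  ring

theorem horiz_of_mem {c x : Cn n} (h : inner ℂ x c = 0) : horiz c x = c := by
  simp [horiz, h]

theorem contDiff_horiz (c : Cn n) : ContDiff ℝ ∞ (horiz c : Cn n → Cn n) := by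
  unfold horiz
  exact contDiff_const.sub ((contDiff_id.inner ℂ contDiff_const).smul contDiff_id)

theorem horiz_e₀ (x : Cn n) : horiz (e₀ n) x = e₀ n - conj (x 0) • x := by
  rw [horiz, inner_e₀_right]

/-- The horizontal field `c ν`, where `ν` is the projection of the coordinate vector. -/
def nuField (n : ℕ) (a : ℝ) (c : ℂ) : (x : Sph n) → TangentSpace (𝓡 (2 * n + 1)) x :=
  mkField a (fun _ => 0) (fun x => c • horiz (e₀ n) (x : Cn n))

/-- The horizontal field defined by a constant vector. -/
def horizField (n : ℕ) (a : ℝ) (c : Cn n) : (x : Sph n) → TangentSpace (𝓡 (2 * n + 1)) x :=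
  mkField a (fun _ => 0) (fun x => horiz c (x : Cn n))

theorem smoothField_horizField (c : Cn n) : SmoothField (horizField n a c) :=
  smoothField_mkField contMDiff_const ((contDiff_horiz c).contMDiff.comp (contMDiff_incl n))
    (inner_horiz c)

theorem smoothField_nuField (c : ℂ) : SmoothField (nuField n a c) :=
  smoothField_mkField contMDiff_const
    (((contDiff_horiz _).const_smul c).contMDiff.comp (contMDiff_incl n))
    fun x => by rw [inner_smul_right, inner_horiz, mul_zero]

theorem hat_horizField (c : Cn n) (x : Sph n) : hat (horizField n a c) x = horiz c (x : Cn n) := by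
  refine (hat_mkField (inner_horiz c x)).trans ?_
  simp

theorem hat_nuField (c : ℂ) (x : Sph n) :
    hat (nuField n a c) x = c • horiz (e₀ n) (x : Cn n) := by
  refine (hat_mkField (by rw [inner_smul_right, inner_horiz, mul_zero])).trans ?_
  simp

/-- A field with values in the transverse distribution. -/
def IsHoriz (Y : (x : Sph n) → TangentSpace (𝓡 (2 * n + 1)) x) : Prop :=
  ∀ x : Sph n, inner ℂ (x : Cn n) (hat Y x) = 0

theorem isHoriz_horizField (c : Cn n) : IsHoriz (horizField n a c) := fun x => by
  rw [hat_horizField, inner_horiz]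

theorem isHoriz_nuField (c : ℂ) : IsHoriz (nuField n a c) := fun x => by
  rw [hat_nuField, inner_smul_right, inner_horiz, mul_zero]

variable {X Y : (x : Sph n) → TangentSpace (𝓡 (2 * n + 1)) x}

theorem IsHoriz.etaF (h : IsHoriz Y) : etaF Y a = fun _ => 0 :=
  funext fun x => ctForm_of_mem (h x)

theorem IsHoriz.projF (h : IsHoriz Y) : projF Y a = hat Y :=
  funext fun x => proj_of_mem (h x)

theorem hasD_nu (x : Sph n) (v : TangentSpace (𝓡 (2 * n + 1)) x) :
    HasD (𝓡 (2 * n + 1)) (fun y : Sph n => horiz (e₀ n) (y : Cn n)) x v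
      (-(conj (dIncl n x v 0) • (x : Cn n) + conj (x.1 0) • dIncl n x v)) := by
  have e : (fun y : Sph n => horiz (e₀ n) (y : Cn n)) =
      fun y : Sph n => e₀ n - conj (y.1 0) • (y : Cn n) := funext fun y => horiz_e₀ _
  rw [e]
  have h := hasD_incl x v
  exact ((HasD.const (e₀ n) x v).sub (h.apply_zero.conj.csmul h)).congr_deriv (zero_sub _)

/-- The principal part of the covariant derivative of `ν`. -/
def nuKappa (a : ℝ) (x : Cn n) : ℂ := (1 + a) * (conf a x : ℂ)⁻¹ * conj (x 0)

/-- The connection form of `ν`. -/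
def nuForm (a : ℝ) (x : Cn n) (η : ℝ) (X : Cn n) : ℂ :=
  I * a * η + a * (conf a x : ℂ)⁻¹ * (conj (x 0) * X 0 - x 0 * conj (X 0))

/-- The last argument is the derivative of `ν` from `hasD_nu`. Since `∇ν` stays in the span of `X`
and `ν`, its curvature reduces to derivatives of `nuKappa` and `nuForm`, called `κ` and `B` below.
-/
theorem transConn_nu (ha : 0 < a) (x : Sph n) (η : ℝ) {X : Cn n}
    (hX : inner ℂ (x : Cn n) X = 0) :
    transConn a (x : Cn n) η X (horiz (e₀ n) (x : Cn n))
      (-(conj (((η : ℂ) • Tvec a (x : Cn n) + X) 0) • (x : Cn n) +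
        conj (x.1 0) • ((η : ℂ) • Tvec a (x : Cn n) + X))) =
      -(nuKappa a (x : Cn n) • X + nuForm a (x : Cn n) η X • horiz (e₀ n) (x : Cn n)) := by
  have hf := mul_inv_cancel₀ (conf_ne_zero ha (x : Cn n))
  rw [ofReal_conf] at hf
  have hX' : inner ℂ X (x : Cn n) = 0 := inner_eq_zero_symm.1 hX
  rw [horiz_e₀]
  simp only [transConn, nuKappa, nuForm, inner_sub_right, inner_smul_right, inner_e₀_right, hX',
    PiLp.add_apply, PiLp.smul_apply, PiLp.sub_apply, smul_eq_mul, e₀_apply_zero, Tvec,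
    defo_apply_zero, map_add, map_mul, conj_I, conj_ofReal, map_one]
  rw [ofReal_conf] at *
  generalize (1 + (a : ℂ) * (conj (x.1 0) * x.1 0))⁻¹ = φ at *
  simp only [defo]
  linear_combination (norm := module) hf • (conj (x.1 0) • X) + hf • (conj (X 0) • (x : Cn n))

theorem ctForm_sub (x v w : Cn n) : ctForm a x (v - w) = ctForm a x v - ctForm a x w := by
  simp [ctForm, inner_sub_right, sub_div]

theorem proj_sub (x v w : Cn n) : proj a x (v - w) = proj a x v - proj a x w := by
  simp only [proj, ctForm_sub, ofReal_sub]
  module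

theorem dIncl_field (x : Sph n) : dIncl n x (X x) = hat X x := rfl

theorem im_inner_symm (u v : Cn n) : (inner ℂ u v).im = -(inner ℂ v u).im := by
  rw [← inner_conj_symm u v, conj_im]

/-- Read off from `∇_X Y - ∇_Y X`. The `T` component reflects that `Q` is a contact distribution. -/
theorem mlieBracket_of_horiz (ha : 0 < a) (hX : SmoothField X) (hY : SmoothField Y)
    (hXh : IsHoriz X) (hYh : IsHoriz Y) (x : Sph n) :
    ctForm a x (dIncl n x (mlieBracket (𝓡 (2 * n + 1)) X Y x)) =
      - 2 * ((conf a (x : Cn n))⁻¹ * (inner ℂ (hat X x) (hat Y x)).im) ∧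
    proj a x (dIncl n x (mlieBracket (𝓡 (2 * n + 1)) X Y x)) =
      transConn a x 0 (hat X x) (hat Y x) (mvfderiv (𝓡 (2 * n + 1)) (hat Y) x (X x)) -
      transConn a x 0 (hat Y x) (hat X x) (mvfderiv (𝓡 (2 * n + 1)) (hat X) x (Y x)) := by
  rw [← (isLeviCivita_lcCov ha).cov_sub_cov hX hY, map_sub, ctForm_sub, proj_sub,
    ctForm_lcCov ha (hX.mdiff x), ctForm_lcCov ha (hY.mdiff x), proj_lcCov ha (hX.mdiff x),
    proj_lcCov ha (hY.mdiff x), hXh.etaF, hYh.etaF, hXh.projF, hYh.projF, mvfderiv_const,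
    dIncl_field, dIncl_field, proj_of_mem (hXh x), proj_of_mem (hYh x),
    ctForm_of_mem (hXh x), ctForm_of_mem (hYh x), im_inner_symm (hat Y x)]
  constructor
  · simp
    ring
  · simp

theorem hasD_conf_inv (ha : 0 < a) (x : Sph n) (v : TangentSpace (𝓡 (2 * n + 1)) x) :
    HasD (𝓡 (2 * n + 1)) (fun y : Sph n => (conf a (y : Cn n) : ℂ)⁻¹) x v
      (-((conf a (x : Cn n) : ℂ)⁻¹) ^ 2 *
        (a * (conj (x.1 0) * dIncl n x v 0 + x.1 0 * conj (dIncl n x v 0)))) := by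
  have h := (((hasD_incl x v).conf a).inv (conf_pos ha _).ne').ofReal
  simp only [ofReal_inv] at h
  refine h.congr_deriv ?_
  have h2 : ((2 * (conj (x.1 0) * dIncl n x v 0).re : ℝ) : ℂ) =
      conj (x.1 0) * dIncl n x v 0 + x.1 0 * conj (dIncl n x v 0) := by
    rw [← add_conj]
    simp
  rw [ofReal_mul, ofReal_mul, h2]
  push_cast
  ring

theorem hasD_nuKappa (ha : 0 < a) (x : Sph n) (v : TangentSpace (𝓡 (2 * n + 1)) x) :
    HasD (𝓡 (2 * n + 1)) (fun y : Sph n => nuKappa a (y : Cn n)) x v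
      ((1 + a) * (-((conf a (x : Cn n) : ℂ)⁻¹) ^ 2 *
        (a * (conj (x.1 0) * dIncl n x v 0 + x.1 0 * conj (dIncl n x v 0))) * conj (x.1 0) +
        (conf a (x : Cn n) : ℂ)⁻¹ * conj (dIncl n x v 0))) := by
  have h := ((hasD_conf_inv ha x v).cmul (hasD_incl x v).apply_zero.conj).cmul_const (1 + a)
  simp only [← mul_assoc (1 + (a : ℂ)) (conf a _ : ℂ)⁻¹] at h
  exact h

theorem hasD_nuForm (ha : 0 < a) (hY : SmoothField Y) (x : Sph n)
    (v : TangentSpace (𝓡 (2 * n + 1)) x) :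
    HasD (𝓡 (2 * n + 1)) (fun y : Sph n => nuForm a (y : Cn n) 0 (hat Y y)) x v
      (a * (-((conf a (x : Cn n) : ℂ)⁻¹) ^ 2 *
        (a * (conj (x.1 0) * dIncl n x v 0 + x.1 0 * conj (dIncl n x v 0))) *
        (conj (x.1 0) * hat Y x 0 - x.1 0 * conj (hat Y x 0)) +
        (conf a (x : Cn n) : ℂ)⁻¹ *
        (conj (dIncl n x v 0) * hat Y x 0 +
          conj (x.1 0) * (mvfderiv (𝓡 (2 * n + 1)) (hat Y) x v) 0 -
          (dIncl n x v 0 * conj (hat Y x 0) +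
          x.1 0 * conj ((mvfderiv (𝓡 (2 * n + 1)) (hat Y) x v) 0))))) := by
  have h0 := (hasD_incl x v).apply_zero
  have hy := (hasD_hat (hY.mdiff x) v).apply_zero
  have h := ((hasD_conf_inv ha x v).cmul ((h0.conj.cmul hy).sub (h0.cmul hy.conj))).cmul_const a
  have e : (fun y : Sph n => nuForm a (y : Cn n) 0 (hat Y y)) = fun y : Sph n =>
      a * ((conf a (y : Cn n) : ℂ)⁻¹ * (conj (y.1 0) * hat Y y 0 - y.1 0 * conj (hat Y y 0))) := by
    funext y
    simp only [nuForm, ofReal_zero]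
    ring
  rw [e]
  exact h

theorem proj_apply_zero (x v : Cn n) :
    proj a x v 0 = v 0 - ctForm a x v * (I * ((1 + a) * x 0)) := by
  simp only [proj, Tvec, PiLp.sub_apply, PiLp.smul_apply, smul_eq_mul, defo_apply_zero]

/-- The exterior derivative of the connection form of `ν`. -/
theorem nuForm_curv (ha : 0 < a) (hX : SmoothField X) (hY : SmoothField Y)
    (hXh : IsHoriz X) (hYh : IsHoriz Y) (x : Sph n) :
    mvfderiv (𝓡 (2 * n + 1)) (fun y : Sph n => nuForm a (y : Cn n) 0 (hat Y y)) x (X x) -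
    mvfderiv (𝓡 (2 * n + 1)) (fun y : Sph n => nuForm a (y : Cn n) 0 (hat X y)) x (Y x) -
    nuForm a (x : Cn n) (ctForm a x (dIncl n x (mlieBracket (𝓡 (2 * n + 1)) X Y x)))
      (proj a x (dIncl n x (mlieBracket (𝓡 (2 * n + 1)) X Y x))) =
    2 * a * ((conf a (x : Cn n) : ℂ)⁻¹) ^ 2 *
      ((1 - 2 * (rho (x : Cn n) : ℂ) - a * rho (x : Cn n)) *
      (I * (inner ℂ (hat X x) (hat Y x)).im) +
      (conj (hat X x 0) * hat Y x 0 - hat X x 0 * conj (hat Y x 0))) := by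
  rw [(hasD_nuForm ha hY x (X x)).2, (hasD_nuForm ha hX x (Y x)).2, nuForm, proj_apply_zero,
    (mlieBracket_of_horiz ha hX hY hXh hYh x).1, dIncl_mlieBracket hX hY, dIncl_field, dIncl_field,
    ofReal_rho]
  have hf := mul_inv_cancel₀ (conf_ne_zero ha (x : Cn n))
  simp only [PiLp.sub_apply, map_sub, map_mul, conj_I, conj_ofReal, ofReal_mul, ofReal_inv,
    ofReal_neg, ofReal_ofNat, map_add, map_one, map_inv₀, map_neg, map_ofNat]
  rw [ofReal_conf] at *
  generalize (1 + (a : ℂ) * (conj (x.1 0) * x.1 0))⁻¹ = φ at *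
  generalize ((inner ℂ (hat X x) (hat Y x)).im : ℂ) = o at *
  generalize conj (x.1 0) = z at *
  generalize x.1 0 = z' at *
  linear_combination (-2 * a * φ * (conj (hat X x 0) * hat Y x 0 - hat X x 0 * conj (hat Y x 0) +
    I * o)) * hf

theorem proj_lcCov_nuField (ha : 0 < a) (c : ℂ) (x : Sph n) (v : TangentSpace (𝓡 (2 * n + 1)) x) :
    proj a x (dIncl n x (lcCov n ha (nuField n a c) x v)) =
      -(c • (nuKappa a (x : Cn n) • proj a x (dIncl n x v) +
        nuForm a (x : Cn n) (ctForm a x (dIncl n x v)) (proj a x (dIncl n x v)) •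
          horiz (e₀ n) (x : Cn n))) := by
  have hd := (hasD_nu x v).csmul_const c
  rw [proj_lcCov ha ((smoothField_nuField c).mdiff x), (isHoriz_nuField c).etaF,
    (isHoriz_nuField c).projF, show hat (nuField n a c) = _ from funext (hat_nuField c), hd.2]
  have h1 := transConn_csmul a (x : Cn n) (ctForm a x (dIncl n x v)) (proj a x (dIncl n x v))
    (horiz (e₀ n) (x : Cn n))
    (-(conj (dIncl n x v 0) • (x : Cn n) + conj (x.1 0) • dIncl n x v)) c 0
  have h2 := transConn_nu ha x (ctForm a x (dIncl n x v))
    (inner_sphere_proj ha x (inner_dIncl x v))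
  rw [ctForm_smul_add_proj] at h2
  rw [zero_smul, zero_add, zero_add, h2] at h1
  rw [h1]
  simp

theorem transConn_neg_csmul_add (x : Cn n) (η : ℝ) (X y y' dy dy' : Cn n) (c : ℂ) :
    transConn a x η X (-(c • (y + y'))) (-(c • (dy + dy'))) =
      -(c • (transConn a x η X y dy + transConn a x η X y' dy')) := by
  simp only [transConn, inner_neg_right, inner_add_right, inner_smul_right, PiLp.add_apply,
    PiLp.smul_apply, PiLp.neg_apply, smul_eq_mul]
  module

/-- `∇_Y(cν)` has a `T` component, which contributes through `∇_X T = iX`, and the horizontal part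
`-c(κY + B(Y)ν)`, differentiated by the Leibniz rule and `transConn_nu`. -/
theorem nuField_curv (ha : 0 < a) (c : ℂ) (hX : SmoothField X) (hY : SmoothField Y)
    (hXh : IsHoriz X) (hYh : IsHoriz Y) (x : Sph n) :
    proj a x (dIncl n x (lcCov n ha (fun y => lcCov n ha (nuField n a c) y (Y y)) x (X x))) =
      (-((conf a (x : Cn n) : ℂ)⁻¹ * (inner ℂ (hat Y x) (c • horiz (e₀ n) (x : Cn n))).im) * I) •
        hat X x - c •
      (mvfderiv (𝓡 (2 * n + 1)) (fun y : Sph n => nuKappa a (y : Cn n)) x (X x) • hat Y x +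
        nuKappa a (x : Cn n) •
          transConn a x 0 (hat X x) (hat Y x) (mvfderiv (𝓡 (2 * n + 1)) (hat Y) x (X x)) +
        mvfderiv (𝓡 (2 * n + 1)) (fun y : Sph n => nuForm a (y : Cn n) 0 (hat Y y)) x (X x) •
          horiz (e₀ n) (x : Cn n) - nuForm a (x : Cn n) 0 (hat Y x) •
            (nuKappa a (x : Cn n) • hat X x +
              nuForm a (x : Cn n) 0 (hat X x) • horiz (e₀ n) (x : Cn n))) := by
  have hL : SmoothField (fun y => lcCov n ha (nuField n a c) y (Y y)) :=
    preservesSmooth_lcCov ha _ _ hY (smoothField_nuField c)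
  have e1 : etaF (fun y => lcCov n ha (nuField n a c) y (Y y)) a = fun y : Sph n =>
      -((conf a (y : Cn n))⁻¹ * (inner ℂ (hat Y y) (c • horiz (e₀ n) (y : Cn n))).im) := by
    funext y
    refine (ctForm_lcCov ha ((smoothField_nuField c).mdiff y) (Y y)).trans ?_
    rw [(isHoriz_nuField c).etaF, (isHoriz_nuField c).projF, mvfderiv_const, dIncl_field,
      proj_of_mem (hYh y), hat_nuField]
    simp
  have e2 : projF (fun y => lcCov n ha (nuField n a c) y (Y y)) a = fun y : Sph n =>
      -(c • (nuKappa a (y : Cn n) • hat Y y +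
        nuForm a (y : Cn n) 0 (hat Y y) • horiz (e₀ n) (y : Cn n))) := by
    funext y
    refine (proj_lcCov_nuField ha c y (Y y)).trans ?_
    rw [dIncl_field, proj_of_mem (hYh y), ctForm_of_mem (hYh y)]
  have hκ := HasD.of_mdiff (v := X x) (hasD_nuKappa ha x (X x)).1
  have hB := HasD.of_mdiff (v := X x) (hasD_nuForm ha hY x (X x)).1
  have hd := (((hκ.csmul (hasD_hat (hY.mdiff x) (X x))).add
    (hB.csmul (hasD_nu x (X x)))).csmul_const c).neg
  rw [proj_lcCov ha (hL.mdiff x), e1, e2, hd.2, dIncl_field, proj_of_mem (hXh x),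
    ctForm_of_mem (hXh x)]
  have h2 := transConn_nu ha x 0 (hXh x)
  rw [ofReal_zero, zero_smul, zero_add] at h2
  have h1 := transConn_csmul a (x : Cn n) 0 (hat X x) (hat Y x)
    (mvfderiv (𝓡 (2 * n + 1)) (hat Y) x (X x)) (nuKappa a (x : Cn n))
    (mvfderiv (𝓡 (2 * n + 1)) (fun y : Sph n => nuKappa a (y : Cn n)) x (X x))
  have h3 := transConn_csmul a (x : Cn n) 0 (hat X x) (horiz (e₀ n) (x : Cn n))
    (-(conj (hat X x 0) • (x : Cn n) + conj (x.1 0) • hat X x)) (nuForm a (x : Cn n) 0 (hat Y x))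
    (mvfderiv (𝓡 (2 * n + 1)) (fun y : Sph n => nuForm a (y : Cn n) 0 (hat Y y)) x (X x))
  rw [h2] at h3
  beta_reduce
  rw [transConn_neg_csmul_add, h1, h3]
  simp only [ofReal_neg, ofReal_mul, ofReal_inv]
  module

/-- The combination `dκ + κB` is what enters the curvature. Its terms in the unconjugated coordinate
of `X` cancel. -/
theorem mvfderiv_nuKappa (ha : 0 < a) (x : Sph n) :
    mvfderiv (𝓡 (2 * n + 1)) (fun y : Sph n => nuKappa a (y : Cn n)) x (X x) +
      nuKappa a (x : Cn n) * nuForm a (x : Cn n) 0 (hat X x) =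
    (1 + a) * ((conf a (x : Cn n) : ℂ)⁻¹) ^ 2 * (1 - a * rho (x : Cn n)) * conj (hat X x 0) := by
  rw [(hasD_nuKappa ha x (X x)).2, dIncl_field, nuKappa, nuForm, ofReal_rho]
  have hf := mul_inv_cancel₀ (conf_ne_zero ha (x : Cn n))
  rw [ofReal_conf] at *
  generalize (1 + (a : ℂ) * (conj (x.1 0) * x.1 0))⁻¹ = φ at *
  rw [ofReal_zero]
  linear_combination (-(1 + (a : ℂ)) * φ * conj (hat X x 0)) * hf

/-- Antisymmetrizing `nuField_curv` cancels the products `B(X)B(Y)`, and `∇_{[X,Y]}ν` removes the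
derivatives of `X` and `Y`. The `T` contributions, `dκ + κB` and `dB` remain. -/
theorem proj_curv_nuField (ha : 0 < a) (c : ℂ) (hX : SmoothField X) (hY : SmoothField Y)
    (hXh : IsHoriz X) (hYh : IsHoriz Y) (x : Sph n) :
    proj a x (dIncl n x (curv (lcCov n ha) X Y (nuField n a c) x)) =
      (-((conf a (x : Cn n) : ℂ)⁻¹ * (inner ℂ (hat Y x) (c • horiz (e₀ n) (x : Cn n))).im) * I) •
        hat X x +
      ((conf a (x : Cn n) : ℂ)⁻¹ * (inner ℂ (hat X x) (c • horiz (e₀ n) (x : Cn n))).im * I) •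
        hat Y x + c •
      (((1 + a) * ((conf a (x : Cn n) : ℂ)⁻¹) ^ 2 * (1 - a * rho (x : Cn n))) •
        (conj (hat Y x 0) • hat X x - conj (hat X x 0) • hat Y x) -
      (2 * a * ((conf a (x : Cn n) : ℂ)⁻¹) ^ 2 *
        ((1 - 2 * (rho (x : Cn n) : ℂ) - a * rho (x : Cn n)) *
      (I * (inner ℂ (hat X x) (hat Y x)).im) +
      (conj (hat X x 0) * hat Y x 0 - hat X x 0 * conj (hat Y x 0)))) • horiz (e₀ n) (x : Cn n)) := by
  rw [curv, map_sub, map_sub, proj_sub, proj_sub, nuField_curv ha c hX hY hXh hYh,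
    nuField_curv ha c hY hX hYh hXh, proj_lcCov_nuField, ← nuForm_curv ha hX hY hXh hYh]
  nth_rw 1 [(mlieBracket_of_horiz ha hX hY hXh hYh x).2]
  have h1 := mvfderiv_nuKappa (X := X) ha x
  have h2 := mvfderiv_nuKappa (X := Y) ha x
  linear_combination (norm := module) (c * h2) • hat X x - (c * h1) • hat Y x

end TransverseCurvature

/-! ### Rigidity of solutions of the Sasakian equation -/

section SasakianRigidity

open Complex ComplexConjugate VectorField

variable {n : ℕ} {a : ℝ} {X Y ξ : (x : Sph n) → TangentSpace (𝓡 (2 * n + 1)) x}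

theorem inner_of_horiz (x : Sph n) {v : Cn n} (hv : inner ℂ (x : Cn n) v = 0) :
    inner ℂ v (horiz (e₀ n) (x : Cn n)) = conj (v 0) := by
  rw [horiz_e₀, inner_sub_right, inner_smul_right, inner_eq_zero_symm.1 hv, inner_e₀_right]
  ring

/-- Skewness moves the curvature onto `T`, and `R(X, Y)T = 0` for horizontal `X`, `Y`. -/
theorem ctForm_curv_nuField (ha : 0 < a) (c : ℂ) (hX : SmoothField X) (hY : SmoothField Y)
    (hXh : IsHoriz X) (hYh : IsHoriz Y) (x : Sph n) :
    ctForm a x (dIncl n x (curv (lcCov n ha) X Y (nuField n a c) x)) = 0 := by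
  have hT : ∀ v : TangentSpace (𝓡 (2 * n + 1)) x,
      (defMetric n ha).inner x (Tfield n a x) v = ctForm a x (dIncl n x v) := by
    intro v
    rw [defMetric_inner, dIncl_Tfield, metricForm, ctForm_Tvec ha, proj_Tvec ha]
    simp
  have h := (isLeviCivita_lcCov ha).curv_skew (preservesSmooth_lcCov ha) hX hY (smoothField_Tfield (a := a))
    (smoothField_nuField (a := a) c) x
  rw [(sasakianEquation_Tfield ha).curv_eq (isLeviCivita_lcCov ha) hX hY, hT, hT, dIncl_field,
    dIncl_field, ctForm_of_mem (hXh x), ctForm_of_mem (hYh x), zero_smul, zero_smul, sub_zero,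
    map_zero, add_zero, (defMetric n ha).symm, hT] at h
  exact h

/-- The curvature obstruction: the components of the curvature that vanish on the direction of a
Sasakian structure. -/
def obstr (a : ℝ) (x u v : Cn n) : Cn n :=
  (1 - 2 * (rho x : ℂ) - a * rho x) • (conj (u 0) • v - conj (v 0) • u) +
    (2 * ((1 - 2 * (rho x : ℂ) - a * rho x) * (I * (inner ℂ u v).im) +
      (conj (u 0) * v 0 - u 0 * conj (v 0)))) • horiz (e₀ n) x

/-- Skewness compares `R(X, Y)ξ = g(ξ, Y)X - g(ξ, X)Y`, paired with `cν`, with the explicit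
curvature of `cν`. The parts of constant curvature one cancel and a multiple of `obstr` is left. -/
theorem inner_obstr_eq_zero (ha : 0 < a) (hξ : SmoothField ξ)
    (hS : SasakianEquation (defMetric n ha) (lcCov n ha) ξ) (hX : SmoothField X)
    (hY : SmoothField Y) (hXh : IsHoriz X) (hYh : IsHoriz Y) (x : Sph n) :
    inner ℂ (obstr a (x : Cn n) (hat X x) (hat Y x)) (projF ξ a x) = 0 := by
  have key : ∀ c : ℂ,
      (conj c * inner ℂ (obstr a (x : Cn n) (hat X x) (hat Y x)) (projF ξ a x)).re = 0 := by
    intro c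
    have h := (isLeviCivita_lcCov ha).curv_skew (preservesSmooth_lcCov ha) hX hY hξ
      (smoothField_nuField (a := a) c) x
    rw [hS.curv_eq (isLeviCivita_lcCov ha) hX hY] at h
    simp only [map_sub, map_smul, smul_eq_mul] at h
    simp only [defMetric_inner_field] at h
    rw [show etaF (curv (lcCov n ha) X Y (nuField n a c)) a x = 0 from
        ctForm_curv_nuField ha c hX hY hXh hYh x,
      show projF (curv (lcCov n ha) X Y (nuField n a c)) a x = _ from
        proj_curv_nuField ha c hX hY hXh hYh x, (isHoriz_nuField c).projF, hXh.projF, hYh.projF,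
      (isHoriz_nuField c).etaF, hXh.etaF, hYh.etaF, hat_nuField] at h
    simp only [inner_real_eq_re, inner_add_left, inner_sub_left, inner_smul_left, inner_smul_right,
      inner_of_horiz x (hXh x), inner_of_horiz x (hYh x), obstr] at h ⊢
    rw [← inner_conj_symm (horiz _ _) (hat X x), ← inner_conj_symm (horiz _ _) (hat Y x),
      inner_of_horiz x (hXh x), inner_of_horiz x (hYh x), ← inner_conj_symm (projF ξ a x) (hat X x),
      ← inner_conj_symm (projF ξ a x) (hat Y x)] at h
    have hf : (1 + a * rho (x : Cn n)) * (conf a (x : Cn n))⁻¹ = 1 :=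
      mul_inv_cancel₀ (conf_pos ha (x : Cn n)).ne'
    have hfp := inv_pos.2 (conf_pos ha (x : Cn n))
    simp only [← ofReal_inv] at h
    generalize (conf a (x : Cn n))⁻¹ = φ at *
    generalize inner ℂ (hat X x) (projF ξ a x) = hu at *
    generalize inner ℂ (hat Y x) (projF ξ a x) = hv at *
    generalize inner ℂ (horiz (e₀ n) (x : Cn n)) (projF ξ a x) = hw at *
    generalize (inner ℂ (hat X x) (hat Y x)).im = o at *
    generalize rho (x : Cn n) = r at *
    generalize hat X x 0 = p at *
    generalize hat Y x 0 = q at *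
    simp only [pow_two, map_mul, map_add, map_sub, map_neg, conj_ofReal, conj_I, map_one, map_ofNat,
      conj_conj, mul_re, mul_im, add_re, add_im, sub_re, sub_im, neg_re, neg_im, conj_re, conj_im,
      ofReal_re, ofReal_im, I_re, I_im, one_re, one_im, re_ofNat, im_ofNat] at h ⊢
    -- The relation carries the factor `a f⁻³`, with `f⁻²` from the curvature and `f⁻¹` from the
    -- metric. For `a = 0`, the round metric, there would be no obstruction.
    have h2 : (a * φ ^ 3) ≠ 0 := by positivity
    apply mul_left_cancel₀ h2
    linear_combination (-1) * h - φ ^ 2 * (c.re * p.re * hv.re - c.re * p.im * hv.im -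
      c.re * q.re * hu.re + c.re * q.im * hu.im + p.re * hv.im * c.im + hv.re * p.im * c.im -
      q.re * hu.im * c.im - hu.re * q.im * c.im) * hf
  -- Taking `c` to be the product itself turns the real identity into the vanishing of its squared
  -- modulus.
  have h := key (inner ℂ (obstr a (x : Cn n) (hat X x) (hat Y x)) (projF ξ a x))
  rw [← normSq_eq_conj_mul_self, ofReal_re] at h
  exact normSq_eq_zero.1 h

theorem horiz_e₀_apply_zero (x : Cn n) : horiz (e₀ n) x 0 = ((1 - rho x : ℝ) : ℂ) := by
  rw [horiz_e₀]
  simp only [PiLp.sub_apply, PiLp.smul_apply, smul_eq_mul, e₀_apply_zero, ofReal_sub, ofReal_one,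
    ofReal_rho]

/-- At generic points a vector field satisfying the Sasakian equation is proportional to `T`. -/
theorem projF_eq_zero (ha : 0 < a) (hξ : SmoothField ξ)
    (hS : SasakianEquation (defMetric n ha) (lcCov n ha) ξ) (x : Sph n)
    (h1 : rho (x : Cn n) ≠ 1) (h2 : 1 - 2 * rho (x : Cn n) - a * rho (x : Cn n) ≠ 0)
    (h3 : 2 - 3 * rho (x : Cn n) - a * rho (x : Cn n) ≠ 0) : projF ξ a x = 0 := by
  have hs : (1 - rho (x : Cn n) : ℂ) ≠ 0 := by
    norm_cast
    exact sub_ne_zero.2 h1.symm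
  have h2' : (1 - 2 * (rho (x : Cn n) : ℂ) - a * rho (x : Cn n)) ≠ 0 := by exact_mod_cast h2
  have h3' : (2 - 3 * (rho (x : Cn n) : ℂ) - a * rho (x : Cn n)) ≠ 0 := by exact_mod_cast h3
  have hνν : inner ℂ (horiz (e₀ n) (x : Cn n)) (horiz (e₀ n) (x : Cn n)) =
      (1 - rho (x : Cn n) : ℂ) := by
    rw [inner_of_horiz x (inner_horiz _ x), horiz_e₀_apply_zero, conj_ofReal]
    push_cast
    rfl
  -- For `X = ν`, `Y = iν` the obstruction is a nonzero multiple of `ν`, so `projF ξ a x` is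
  -- orthogonal to `ν`.
  have e1 := inner_obstr_eq_zero ha hξ hS (smoothField_nuField (a := a) 1)
    (smoothField_nuField (a := a) I) (isHoriz_nuField 1) (isHoriz_nuField I) x
  have hν : inner ℂ (horiz (e₀ n) (x : Cn n)) (projF ξ a x) = 0 := by
    rw [hat_nuField, hat_nuField, one_smul] at e1
    have hC : obstr a (x : Cn n) (horiz (e₀ n) (x : Cn n)) (I • horiz (e₀ n) (x : Cn n)) =
        (4 * I * (1 - rho (x : Cn n)) * (2 - 3 * (rho (x : Cn n) : ℂ) - a * rho (x : Cn n))) •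
          horiz (e₀ n) (x : Cn n) := by
      have him : (I * (1 - rho (x : Cn n) : ℂ)).im = 1 - rho (x : Cn n) := by
        rw [← ofReal_one, ← ofReal_sub]
        simp
      rw [obstr, inner_smul_right, hνν, him]
      simp only [PiLp.smul_apply, smul_eq_mul, horiz_e₀_apply_zero, map_mul, conj_I, conj_ofReal]
      push_cast
      module
    rw [hC, inner_smul_left] at e1
    refine (mul_eq_zero.1 e1).resolve_left ?_
    refine (map_ne_zero _).2 ?_
    refine mul_ne_zero (mul_ne_zero (mul_ne_zero ?_ I_ne_zero) hs) h3'
    norm_num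
  have hw := inner_projF (Y := ξ) ha x
  -- Now `Y` extends `projF ξ a x` itself. By orthogonality to `ν` the obstruction is a nonzero
  -- multiple of this vector, which is therefore orthogonal to itself.
  have e2 := inner_obstr_eq_zero ha hξ hS (smoothField_nuField (a := a) 1)
    (smoothField_horizField (a := a) (projF ξ a x)) (isHoriz_nuField 1) (isHoriz_horizField _) x
  have hw0 : projF ξ a x 0 = 0 := by
    rw [← inner_e₀_left]
    rw [horiz_e₀, inner_sub_left, inner_smul_left, hw, mul_zero, sub_zero] at hν
    exact hν
  rw [hat_nuField, hat_horizField, one_smul, horiz_of_mem hw, obstr, hν, hw0,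
    horiz_e₀_apply_zero] at e2
  simp only [map_zero, zero_smul, sub_zero, zero_im, ofReal_zero, mul_zero, add_zero, conj_ofReal,
    smul_smul] at e2
  rw [inner_smul_left] at e2
  refine inner_self_eq_zero.1 ((mul_eq_zero.1 e2).resolve_left ?_)
  refine (map_ne_zero _).2 ?_
  refine mul_ne_zero h2' ?_
  rw [ofReal_sub, ofReal_one]
  exact hs

end SasakianRigidity

/-! ### The action of `U(1) × U(n)` and its orbits -/

section UnitaryAction

open Complex ComplexConjugate

variable {n : ℕ} {a : ℝ}

theorem dIncl_Tone (x : Sph n) : dIncl n x (T₁ n x) = (I * (x : Cn n) 0) • e₀ n := by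
  refine (exists_tangent n x (J₁ n x) (inner_J₁ n x)).choose_spec.trans ?_
  ext i
  by_cases h : i = 0 <;> simp [J₁, e₀, h]

/-- The action of an element of `U(1) × U(n)`, as a linear isometry. -/
def blockIso (n : ℕ) (h : Circle × Matrix.unitaryGroup (Fin n) ℂ) : Cn n →ₗᵢ[ℂ] Cn n where
  toFun := blockMap n h
  map_add' v w := by
    ext i
    refine Fin.cases ?_ (fun j => ?_) i
    · simp [blockMap, mul_add]
    · have : (fun i : Fin n => v i.succ + w i.succ) =
        (fun i : Fin n => v i.succ) + fun i : Fin n => w i.succ := rfl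
      simp [blockMap, this, Matrix.mulVec_add]
  map_smul' c v := by
    ext i
    refine Fin.cases ?_ (fun j => ?_) i
    · simp [blockMap]
      ring
    · have : (fun i : Fin n => c * v i.succ) = c • fun i : Fin n => v i.succ := rfl
      simp [blockMap, this, Matrix.mulVec_smul]
  norm_map' := norm_blockMap n h

variable (h : Circle × Matrix.unitaryGroup (Fin n) ℂ)

theorem coe_smul_sphere (x : Sph n) : ((h • x : Sph n) : Cn n) = blockIso n h x := rfl

theorem blockIso_apply_zero (v : Cn n) : blockIso n h v 0 = h.1 * v 0 := rfl

theorem blockIso_e₀ : blockIso n h (e₀ n) = (h.1 : ℂ) • e₀ n := by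
  have h0 : (fun i : Fin n => e₀ n i.succ) = 0 := by
    funext i
    simp [e₀]
  ext i
  refine Fin.cases ?_ (fun j => ?_) i
  · simp [blockIso_apply_zero]
  · change ((h.2 : Matrix (Fin n) (Fin n) ℂ).mulVec fun i => e₀ n i.succ) j = _
    rw [h0]
    simp [e₀]

theorem rho_blockIso (v : Cn n) : rho (blockIso n h v) = rho v := by
  rw [rho, blockIso_apply_zero, map_mul, Circle.normSq_coe, one_mul, rho]

/-- The action respects the splitting `ℂ ⊕ ℂⁿ`, hence commutes with `T`; being also Hermitian, it
preserves `ctForm`, `proj` and `metricForm`. -/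
theorem Tvec_blockIso (x : Cn n) : Tvec a (blockIso n h x) = blockIso n h (Tvec a x) := by
  simp only [Tvec, defo, map_smul, map_add, blockIso_e₀, blockIso_apply_zero, smul_smul]
  congr 3
  ring

theorem ctForm_blockIso (x v : Cn n) :
    ctForm a (blockIso n h x) (blockIso n h v) = ctForm a x v := by
  rw [ctForm, conf, rho_blockIso, LinearIsometry.inner_map_map, ctForm, conf]

theorem proj_blockIso (x v : Cn n) :
    proj a (blockIso n h x) (blockIso n h v) = blockIso n h (proj a x v) := by
  rw [proj, ctForm_blockIso, Tvec_blockIso, proj, map_sub, map_smul]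

theorem metricForm_blockIso (x v w : Cn n) :
    metricForm a (blockIso n h x) (blockIso n h v) (blockIso n h w) = metricForm a x v w := by
  rw [metricForm, ctForm_blockIso, ctForm_blockIso, proj_blockIso, proj_blockIso, conf,
    rho_blockIso, inner_real_eq_re, LinearIsometry.inner_map_map, metricForm, conf,
    inner_real_eq_re]

/-- The action as a real continuous linear map. -/
def blockCLM (n : ℕ) (h : Circle × Matrix.unitaryGroup (Fin n) ℂ) : Cn n →L[ℝ] Cn n :=
  (blockIso n h).toContinuousLinearMap.restrictScalars ℝ

theorem contMDiff_smul_sphere :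
    ContMDiff (𝓡 (2 * n + 1)) (𝓡 (2 * n + 1)) ∞ (fun x : Sph n => h • x) :=
  ContMDiff.codRestrict_sphere (f := fun x : Sph n => blockCLM n h x)
    ((blockCLM n h).contMDiff.comp (contMDiff_incl n)) (fun x => (h • x).2)

/-- The derivative of a map into the sphere, seen in the Hermitian space. -/
theorem hasD_coe_comp {E H M : Type*} [NormedAddCommGroup E] [NormedSpace ℝ E] [TopologicalSpace H]
    {J : ModelWithCorners ℝ E H} [TopologicalSpace M] [ChartedSpace H M]
    {F : M → Sph n} {x : M} (hF : MDifferentiableAt J (𝓡 (2 * n + 1)) F x) (v : TangentSpace J x) :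
    HasD J (fun y => (F y : Cn n)) x v (dIncl n (F x) (mfderiv J (𝓡 (2 * n + 1)) F x v)) := by
  have h1 := ((contMDiff_incl n (F x)).mdifferentiableAt (by simp)).hasMFDerivAt.comp x
    hF.hasMFDerivAt
  exact ⟨h1.mdifferentiableAt, congrArg (fun L => L v) h1.mfderiv⟩

theorem dIncl_mfderiv_smul (x : Sph n) (v : TangentSpace (𝓡 (2 * n + 1)) x) :
    dIncl n (h • x) (mfderiv (𝓡 (2 * n + 1)) (𝓡 (2 * n + 1)) (fun x : Sph n => h • x) x v) =
      blockIso n h (dIncl n x v) :=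
  (hasD_coe_comp ((contMDiff_smul_sphere h x).mdifferentiableAt (by simp)) v).unique
    ((hasD_incl x v).clm (blockCLM n h))

theorem preservesMetric_smul (ha : 0 < a) :
    PreservesMetric (defMetric n ha) (fun x : Sph n => h • x) := by
  intro x v w
  rw [defMetric_inner, dIncl_mfderiv_smul, dIncl_mfderiv_smul, coe_smul_sphere,
    metricForm_blockIso, defMetric_inner]

/-- The action of an element of the group, as a diffeomorphism. -/
def smulDiffeo : Sph n ≃ₘ^∞⟮𝓡 (2 * n + 1), 𝓡 (2 * n + 1)⟯ Sph n where
  toEquiv := MulAction.toPerm h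
  contMDiff_toFun := contMDiff_smul_sphere h
  contMDiff_invFun := contMDiff_smul_sphere h⁻¹

theorem orbit_subset_isometryOrbit (ha : 0 < a) (x : Sph n) :
    MulAction.orbit (Circle × Matrix.unitaryGroup (Fin n) ℂ) x ⊆
      isometryOrbit (defMetric n ha) x := by
  rintro _ ⟨h, rfl⟩
  exact ⟨smulDiffeo h, preservesMetric_smul h ha, rfl⟩

/-- Every vector is a unitary image of a multiple of a given coordinate vector. -/
theorem exists_unitary_mulVec_single {ι : Type*} [Fintype ι] [DecidableEq ι] (i : ι) (w : ι → ℂ) :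
    ∃ A : Matrix.unitaryGroup ι ℂ, (A : Matrix ι ι ℂ).mulVec
      (Pi.single i ((‖(WithLp.toLp 2 w : EuclideanSpace ℂ ι)‖ : ℝ) : ℂ)) = w := by
  by_cases hw : w = 0
  · refine ⟨1, ?_⟩
    subst hw
    simp
  set w' : EuclideanSpace ℂ ι := WithLp.toLp 2 w with hw'
  have hne : ‖w'‖ ≠ 0 := by
    rw [norm_ne_zero_iff]
    exact fun h => hw (congrArg WithLp.ofLp h)
  -- `w / ‖w‖` becomes the `i`-th vector of an orthonormal basis, and `A` is the matrix whose
  -- columns are this basis.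
  obtain ⟨b, hb⟩ := Orthonormal.exists_orthonormalBasis_extension_of_card_eq (𝕜 := ℂ) (ι := ι)
    (E := EuclideanSpace ℂ ι) (by simp) (v := fun _ => ((‖w'‖⁻¹ : ℝ) : ℂ) • w') (s := {i}) (by
      rw [orthonormal_iff_ite]
      rintro ⟨j, rfl⟩ ⟨k, rfl⟩
      rw [if_pos rfl, Set.domRestrict_apply, inner_smul_left, inner_smul_right,
        inner_self_eq_norm_sq_to_K, conj_ofReal]
      have : (‖w'‖ : ℂ) ≠ 0 := ofReal_ne_zero.2 hne
      push_cast
      change (‖w'‖ : ℂ)⁻¹ * ((‖w'‖ : ℂ)⁻¹ * (‖w'‖ : ℂ) ^ 2) = 1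
      field_simp)
  refine ⟨⟨(EuclideanSpace.basisFun ι ℂ).toBasis.toMatrix b,
    (EuclideanSpace.basisFun ι ℂ).toMatrix_orthonormalBasis_mem_unitary b⟩, ?_⟩
  funext j
  have hi := hb i rfl
  rw [Matrix.mulVec_single]
  have hne' : (‖w'‖ : ℂ) ≠ 0 := ofReal_ne_zero.2 hne
  simp only [Matrix.col, Matrix.transpose_apply, Module.Basis.toMatrix_apply, hi, Pi.smul_apply,
    MulOpposite.smul_eq_mul_unop, MulOpposite.unop_op, OrthonormalBasis.coe_toBasis_repr_apply,
    EuclideanSpace.basisFun_repr, PiLp.smul_apply, smul_eq_mul, ofReal_inv]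
  rw [mul_right_comm, inv_mul_cancel₀ hne', one_mul]

theorem norm_sq_eq_rho_add (x : Cn n) :
    ‖x‖ ^ 2 = rho x + ‖(WithLp.toLp 2 (fun i : Fin n => x i.succ) : EuclideanSpace ℂ (Fin n))‖ ^ 2 := by
  rw [EuclideanSpace.norm_sq_eq, EuclideanSpace.norm_sq_eq, Fin.sum_univ_succ, rho,
    normSq_eq_norm_sq]

theorem exists_circle_mul {z w : ℂ} (h : normSq z = normSq w) : ∃ u : Circle, (u : ℂ) * z = w := by
  by_cases hz : z = 0
  · refine ⟨1, ?_⟩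
    subst hz
    rw [map_zero] at h
    rw [normSq_eq_zero.1 h.symm, mul_zero]
  · refine ⟨⟨w / z, ?_⟩, div_mul_cancel₀ w hz⟩
    rw [normSq_eq_norm_sq, normSq_eq_norm_sq] at h
    have := (sq_eq_sq₀ (norm_nonneg _) (norm_nonneg _)).1 h
    change w / z ∈ Metric.sphere (0 : ℂ) 1
    rw [mem_sphere_zero_iff_norm, norm_div, this, div_self]
    rw [← this]
    exact norm_ne_zero_iff.2 hz

/-- On the unit sphere `rho` determines the norms of both components, and `U(1)`, `U(n)` are
transitive on the spheres of `ℂ`, `ℂⁿ`. -/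
theorem orbit_eq_level (hn : 1 ≤ n) (x : Sph n) :
    MulAction.orbit (Circle × Matrix.unitaryGroup (Fin n) ℂ) x =
      {y : Sph n | rho (y : Cn n) = rho (x : Cn n)} := by
  ext y
  constructor
  · rintro ⟨h, rfl⟩
    exact rho_blockIso h _
  · intro hy
    obtain ⟨u, hu⟩ := exists_circle_mul (show normSq ((x : Cn n) 0) = normSq ((y : Cn n) 0) from
      hy.symm)
    obtain ⟨A, hA⟩ := exists_unitary_mulVec_single (⟨0, hn⟩ : Fin n) fun i => (x : Cn n) i.succ
    obtain ⟨B, hB⟩ := exists_unitary_mulVec_single (⟨0, hn⟩ : Fin n) fun i => (y : Cn n) i.succ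
    have hnorm : ‖(WithLp.toLp 2 (fun i : Fin n => (x : Cn n) i.succ) : EuclideanSpace ℂ (Fin n))‖ =
        ‖(WithLp.toLp 2 (fun i : Fin n => (y : Cn n) i.succ) : EuclideanSpace ℂ (Fin n))‖ := by
      rw [← sq_eq_sq₀ (norm_nonneg _) (norm_nonneg _)]
      have h1 := norm_sq_eq_rho_add (x : Cn n)
      have h2 := norm_sq_eq_rho_add (y : Cn n)
      rw [norm_eq_of_mem_sphere] at h1 h2
      rw [hy] at h2
      linarith
    -- `A` and `B` send the same multiple of one coordinate vector to the `ℂⁿ` components of `x` and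
    -- `y`.
    refine ⟨(u, B * A⁻¹), Subtype.ext ?_⟩
    change blockMap n _ _ = _
    ext i
    refine Fin.cases hu (fun j => ?_) i
    change ((B * A⁻¹ : Matrix.unitaryGroup (Fin n) ℂ) : Matrix (Fin n) (Fin n) ℂ).mulVec
      (fun i => (x : Cn n) i.succ) j = _
    have hAA : ((B * A⁻¹ : Matrix.unitaryGroup (Fin n) ℂ) : Matrix (Fin n) (Fin n) ℂ) *
        (A : Matrix (Fin n) (Fin n) ℂ) = B :=
      congrArg Subtype.val (inv_mul_cancel_right B A)
    rw [← hA, Matrix.mulVec_mulVec, hAA, hnorm]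
    exact congrFun hB j

end UnitaryAction

/-! ### Level sets of `rho` and the generic points -/

section GenericPoints

open Complex ComplexConjugate

variable {n : ℕ} {a : ℝ}

/-- The regular level sets of `rho` are hypersurfaces. -/
theorem isSubmanifoldOfCodim_level (x : Sph n) (h0 : rho (x : Cn n) ≠ 0) (h1 : rho (x : Cn n) ≠ 1) :
    IsSubmanifoldOfCodim (𝓡 (2 * n + 1)) 1 {y : Sph n | rho (y : Cn n) = rho (x : Cn n)} := by
  have hc : Continuous (fun y : Sph n => rho (y : Cn n)) :=
    contDiff_rho.continuous.comp continuous_subtype_val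
  let L : ℝ →L[ℝ] EuclideanSpace ℝ (Fin 1) :=
    ContinuousLinearMap.toSpanSingleton ℝ (EuclideanSpace.single 0 1)
  have hL : ∀ r : ℝ, L r 0 = r := fun r => by
    simp [L]
  have hL0 : ∀ w : EuclideanSpace ℝ (Fin 1), L (w 0) = w := fun w => by
    ext i
    rw [Subsingleton.elim i 0]
    exact hL _
  have hD : ∀ (y : Sph n) (v : TangentSpace (𝓡 (2 * n + 1)) y),
      HasD (𝓡 (2 * n + 1)) (fun y : Sph n => L (rho (y : Cn n) - rho (x : Cn n))) y v
        (L (2 * (conj ((y : Cn n) 0) * (dIncl n y v) 0).re - 0)) := fun y v =>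
    ((hasD_incl y v).rho.sub (HasD.const _ y v)).clm L
  refine fun z hz => ⟨{y | rho (y : Cn n) ≠ 0 ∧ rho (y : Cn n) ≠ 1},
    fun y => L (rho (y : Cn n) - rho (x : Cn n)),
    (isOpen_ne_fun hc continuous_const).inter (isOpen_ne_fun hc continuous_const), ?_, ?_, ?_, ?_⟩
  · rw [Set.mem_ofPred_eq] at hz ⊢
    rw [hz]
    exact ⟨h0, h1⟩
  · have hs : ContDiff ℝ ∞ (fun y : Cn n => L (rho y - rho (x : Cn n))) :=
      L.contDiff.comp (contDiff_rho.sub contDiff_const)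
    exact (hs.contMDiff.comp (contMDiff_incl n)).contMDiffOn
  · rintro y ⟨hy0, hy1⟩ w
    -- At `y`, the derivative of `rho` along `(y 0) ν` is `2 rho (1 - rho)`, whence this
    -- normalization.
    set c : ℝ := w 0 / (2 * (rho (y : Cn n) * (1 - rho (y : Cn n)))) with hcdef
    have hu : inner ℝ (y : Cn n) (c • ((y : Cn n) 0 • horiz (e₀ n) (y : Cn n))) = 0 := by
      rw [inner_smul_right, inner_real_eq_re, inner_smul_right, inner_horiz]
      simp
    refine ⟨tlift n y (c • ((y : Cn n) 0 • horiz (e₀ n) (y : Cn n))), ?_⟩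
    rw [(hD y _).2, dIncl_tlift y hu]
    conv_rhs => rw [← hL0 w]
    congr 1
    have e : conj ((y : Cn n) 0) * (c • ((y : Cn n) 0 • horiz (e₀ n) (y : Cn n))) 0 =
        ((c * (rho (y : Cn n) * (1 - rho (y : Cn n))) : ℝ) : ℂ) := by
      simp only [PiLp.smul_apply, horiz_e₀_apply_zero, smul_eq_mul, real_smul]
      push_cast
      rw [ofReal_rho]
      ring
    have h1' : 1 - rho (y : Cn n) ≠ 0 := sub_ne_zero.2 (Ne.symm hy1)
    rw [e, ofReal_re, hcdef]
    field_simp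
    ring
  · ext y
    simp only [Set.mem_inter_iff, Set.mem_ofPred_eq]
    rw [and_comm]
    refine and_congr_right fun _ => ⟨fun h => by rw [h, sub_self, map_zero], fun h => ?_⟩
    have := hL (rho (y : Cn n) - rho (x : Cn n))
    rw [h] at this
    exact sub_eq_zero.1 this.symm

/-- The point of the sphere with the given directions in `ℂ` and `ℂⁿ`, and `rho = r`. -/
def joinPt (p : ℂ) (q : Fin n → ℂ) (r : ℝ) : Cn n :=
  WithLp.toLp 2 (Fin.cons ((√r : ℂ) * p) (fun i => (√(1 - r) : ℂ) * q i))

theorem continuous_joinPt (p : ℂ) (q : Fin n → ℂ) : Continuous (joinPt p q) := by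
  refine (PiLp.continuous_toLp 2 _).comp (continuous_pi fun i => ?_)
  refine Fin.cases ?_ (fun j => ?_) i
  · simp only [Fin.cons_zero]
    fun_prop
  · simp only [Fin.cons_succ]
    fun_prop

theorem rho_joinPt {p : ℂ} (hp : ‖p‖ = 1) (q : Fin n → ℂ) {r : ℝ} (h0 : 0 ≤ r) :
    rho (joinPt p q r) = r := by
  simp [rho, joinPt, normSq_eq_norm_sq, hp, Real.sq_sqrt h0, mul_pow]

theorem joinPt_mem {p : ℂ} (hp : ‖p‖ = 1) {q : Fin n → ℂ} (hq : ∑ i, ‖q i‖ ^ 2 = 1) {r : ℝ}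
    (h0 : 0 ≤ r) (h1 : r ≤ 1) : joinPt p q r ∈ Metric.sphere (0 : Cn n) 1 := by
  rw [mem_sphere_zero_iff_norm, EuclideanSpace.norm_eq, Fin.sum_univ_succ]
  simp [joinPt, hp, mul_pow, Real.sq_sqrt h0, Real.sq_sqrt (sub_nonneg.2 h1), ← Finset.mul_sum, hq]

/-- Polar decomposition of both components. A vanishing component leaves its direction free; in `ℂⁿ`
a unit vector exists because `1 ≤ n`. -/
theorem exists_joinPt (hn : 1 ≤ n) (x : Sph n) : ∃ (p : ℂ) (q : Fin n → ℂ), ‖p‖ = 1 ∧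
    ∑ i, ‖q i‖ ^ 2 = 1 ∧ 0 ≤ rho (x : Cn n) ∧ rho (x : Cn n) ≤ 1 ∧
      joinPt p q (rho (x : Cn n)) = x := by
  have h0 : 0 ≤ rho (x : Cn n) := normSq_nonneg _
  have hs := norm_sq_eq_rho_add (x : Cn n)
  rw [norm_eq_of_mem_sphere, EuclideanSpace.norm_sq_eq, one_pow] at hs
  simp only [] at hs
  have hsum : ∑ i : Fin n, ‖(x : Cn n) i.succ‖ ^ 2 = 1 - rho (x : Cn n) := by linarith
  have h1 : rho (x : Cn n) ≤ 1 := by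
    have : 0 ≤ ∑ i : Fin n, ‖(x : Cn n) i.succ‖ ^ 2 := by positivity
    linarith
  obtain ⟨p, hp, hp'⟩ : ∃ p : ℂ, ‖p‖ = 1 ∧ (√(rho (x : Cn n)) : ℂ) * p = (x : Cn n) 0 := by
    have e : √(rho (x : Cn n)) = ‖(x : Cn n) 0‖ := by
      rw [rho, normSq_eq_norm_sq, Real.sqrt_sq (norm_nonneg _)]
    rw [e]
    by_cases h : (x : Cn n) 0 = 0
    · exact ⟨1, by simp, by simp [h]⟩
    · refine ⟨(x : Cn n) 0 / ‖(x : Cn n) 0‖, ?_, ?_⟩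
      · rw [norm_div, norm_real, norm_norm, div_self (norm_ne_zero_iff.2 h)]
      · exact mul_div_cancel₀ _ (ofReal_ne_zero.2 (norm_ne_zero_iff.2 h))
  obtain ⟨q, hq, hq'⟩ : ∃ q : Fin n → ℂ, ∑ i, ‖q i‖ ^ 2 = 1 ∧
      ∀ i, (√(1 - rho (x : Cn n)) : ℂ) * q i = (x : Cn n) i.succ := by
    by_cases h : 1 - rho (x : Cn n) = 0
    · refine ⟨Pi.single ⟨0, hn⟩ 1, ?_, fun i => ?_⟩
      · rw [Finset.sum_eq_single ⟨0, hn⟩] <;> simp +contextual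
      · rw [h] at hsum ⊢
        have := (Finset.sum_eq_zero_iff_of_nonneg (fun i _ => by positivity)).1 hsum i
          (Finset.mem_univ i)
        rw [Real.sqrt_zero, ofReal_zero, zero_mul]
        exact (norm_eq_zero.1 (pow_eq_zero_iff two_ne_zero |>.1 this)).symm
    · have hpos : 0 < 1 - rho (x : Cn n) := lt_of_le_of_ne (by linarith) (Ne.symm h)
      have hne : (√(1 - rho (x : Cn n)) : ℂ) ≠ 0 := ofReal_ne_zero.2 (Real.sqrt_ne_zero'.2 hpos)
      refine ⟨fun i => (x : Cn n) i.succ / √(1 - rho (x : Cn n)), ?_,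
        fun i => mul_div_cancel₀ _ hne⟩
      simp only [norm_div, div_pow, norm_real, Real.norm_eq_abs, sq_abs]
      rw [← Finset.sum_div, Real.sq_sqrt hpos.le, hsum, div_self h]
  refine ⟨p, q, hp, hq, h0, h1, ?_⟩
  ext i
  refine Fin.cases hp' hq' i

/-- The points that are not on the exceptional level sets of `rho`. -/
def genericSet (n : ℕ) (a : ℝ) : Set (Sph n) :=
  {x | rho (x : Cn n) ≠ 0 ∧ rho (x : Cn n) ≠ 1 ∧ 1 - 2 * rho (x : Cn n) - a * rho (x : Cn n) ≠ 0 ∧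
    2 - 3 * rho (x : Cn n) - a * rho (x : Cn n) ≠ 0}

theorem isOpen_genericSet : IsOpen (genericSet n a) := by
  have hc : Continuous (fun y : Sph n => rho (y : Cn n)) :=
    contDiff_rho.continuous.comp continuous_subtype_val
  refine (isOpen_ne_fun hc continuous_const).inter ((isOpen_ne_fun hc continuous_const).inter
    ((isOpen_ne_fun ?_ continuous_const).inter (isOpen_ne_fun ?_ continuous_const)))
  · exact (continuous_const.sub (continuous_const.mul hc)).sub (continuous_const.mul hc)
  · exact (continuous_const.sub (continuous_const.mul hc)).sub (continuous_const.mul hc)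

/-- Through every point runs a curve `r ↦ joinPt p q r` with `rho = r`, so it is enough that the
admissible `r` are dense in `[0, 1]`. -/
theorem dense_genericSet (hn : 1 ≤ n) (ha : 0 < a) : Dense (genericSet n a) := by
  intro x
  obtain ⟨p, q, hp, hq, h0, h1, hx⟩ := exists_joinPt hn x
  rw [closure_subtype, ← hx]
  -- The excluded values are the roots of `1 - 2r - ar` and `2 - 3r - ar`.
  have hd : Dense ({(2 + a)⁻¹, 2 * (3 + a)⁻¹}ᶜ : Set ℝ) := Set.Countable.dense_compl ℝ (Set.toFinite _).countable
  have hmem : rho (x : Cn n) ∈ closure (Set.Ioo (0 : ℝ) 1 ∩ {(2 + a)⁻¹, 2 * (3 + a)⁻¹}ᶜ) := by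
    refine closure_minimal (hd.open_subset_closure_inter isOpen_Ioo) isClosed_closure ?_
    rw [closure_Ioo zero_ne_one]
    exact ⟨h0, h1⟩
  refine closure_mono ?_ (image_closure_subset_closure_image (continuous_joinPt p q)
    (Set.mem_image_of_mem _ hmem))
  rintro _ ⟨r, ⟨⟨hr0, hr1⟩, hr⟩, rfl⟩
  refine ⟨⟨joinPt p q r, joinPt_mem hp hq hr0.le hr1.le⟩, ?_, rfl⟩
  simp only [genericSet, Set.mem_ofPred_eq, rho_joinPt hp q hr0.le]
  simp only [Set.mem_compl_iff, Set.mem_insert_iff, Set.mem_singleton_iff, not_or] at hr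
  refine ⟨hr0.ne', hr1.ne, fun h => hr.1 ?_, fun h => hr.2 ?_⟩
  · field_simp
    linarith
  · field_simp
    linarith

end GenericPoints

/-! ### The two-torus and the flow of `T` -/

section TorusFlow

open Complex ComplexConjugate VectorField

variable {n : ℕ} {a : ℝ}

/-- The action of the two-torus: the rotation of all coordinates by `e^{iτ}`, composed with the
rotation of the coordinate `0` by `e^{iθ}`. -/
def torusRot (θ τ : ℝ) (z : Cn n) : Cn n :=
  exp (τ * I) • (z + ((exp (θ * I) - 1) * z 0) • e₀ n)

theorem torusRot_apply_zero (θ τ : ℝ) (z : Cn n) :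
    torusRot θ τ z 0 = exp (τ * I) * exp (θ * I) * z 0 := by
  simp [torusRot, e₀_apply_zero]
  ring

theorem torusRot_apply_succ (θ τ : ℝ) (z : Cn n) (i : Fin n) :
    torusRot θ τ z i.succ = exp (τ * I) * z i.succ := by
  simp [torusRot, e₀]

theorem rho_torusRot (θ τ : ℝ) (z : Cn n) : rho (torusRot θ τ z) = rho z := by
  rw [rho, torusRot_apply_zero, normSq_eq_norm_sq, norm_mul, norm_mul, norm_exp_ofReal_mul_I,
    norm_exp_ofReal_mul_I, one_mul, one_mul, rho, normSq_eq_norm_sq]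

theorem norm_torusRot (θ τ : ℝ) (z : Cn n) : ‖torusRot θ τ z‖ = ‖z‖ := by
  rw [EuclideanSpace.norm_eq, EuclideanSpace.norm_eq, Fin.sum_univ_succ, Fin.sum_univ_succ]
  simp only [torusRot_apply_zero, torusRot_apply_succ, norm_mul, norm_exp_ofReal_mul_I, one_mul]

/-- The action of the two-torus on the sphere. -/
def torus (θ τ : ℝ) (x : Sph n) : Sph n :=
  ⟨torusRot θ τ x, by rw [mem_sphere_zero_iff_norm, norm_torusRot, norm_eq_of_mem_sphere]⟩

theorem torus_zero (x : Sph n) : torus 0 0 x = x := by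
  apply Subtype.ext
  simp [torus, torusRot]

theorem torus_add_two_pi (θ τ : ℝ) (k l : ℤ) (x : Sph n) :
    torus (θ + l * (2 * Real.pi)) (τ + k * (2 * Real.pi)) x = torus θ τ x := by
  have key : ∀ (s : ℝ) (m : ℤ), exp (((s + m * (2 * Real.pi) : ℝ) : ℂ) * I) = exp (s * I) := by
    intro s m
    have : ((s + m * (2 * Real.pi) : ℝ) : ℂ) * I = s * I + m * (2 * Real.pi * I) := by
      push_cast
      ring
    rw [this, exp_periodic.int_mul m]
  apply Subtype.ext
  simp only [torus, torusRot, key]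

theorem contDiff_exp_mul_I (b c : ℝ) : ContDiff ℝ ∞ (fun t : ℝ => exp ((b * t + c : ℝ) * I)) :=
  contDiff_exp.comp ((ofRealCLM.contDiff.comp
    ((contDiff_const.mul contDiff_id).add contDiff_const)).mul contDiff_const)

theorem contMDiff_torus_line (b c : ℝ) (x : Sph n) :
    ContMDiff 𝓘(ℝ) (𝓡 (2 * n + 1)) ∞ (fun t : ℝ => torus (b * t) (c * t) x) := by
  refine ContMDiff.codRestrict_sphere (f := fun t : ℝ => torusRot (b * t) (c * t) (x : Cn n)) ?_
    (fun t => (torus (b * t) (c * t) x).2)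
  have h : ∀ b : ℝ, ContDiff ℝ ∞ (fun t : ℝ => exp ((b * t : ℝ) * I)) := fun b => by
    simpa using contDiff_exp_mul_I b 0
  exact ((h c).smul (contDiff_const.add
    ((((h b).sub contDiff_const).mul contDiff_const).smul contDiff_const))).contMDiff

theorem hasDerivAt_torusRot_line (b c : ℝ) (z : Cn n) (t : ℝ) :
    HasDerivAt (fun t : ℝ => torusRot (b * t) (c * t) z)
      ((c : ℂ) • (I • torusRot (b * t) (c * t) z) +
        ((b : ℂ) * (I * torusRot (b * t) (c * t) z 0)) • e₀ n) t := by
  have h : ∀ b : ℝ, HasDerivAt (fun t : ℝ => exp ((b * t : ℝ) * I))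
      (exp ((b * t : ℝ) * I) * (b * I)) t := fun b => by
    have h1 : HasDerivAt (fun t : ℝ => ((b * t : ℝ) : ℂ) * I) (b * I) t := by
      have := (((hasDerivAt_id t).const_mul b).ofReal_comp).mul_const I
      simpa using this
    exact h1.cexp
  have h2 := (h c).smul ((((h b).sub_const 1).mul_const (z 0)).smul_const (e₀ n) |>.const_add z)
  refine h2.congr_deriv ?_
  rw [torusRot_apply_zero, torusRot]
  module

/-- The smooth curves in the sphere, from their derivatives in the Hermitian space. -/
theorem hasMFDerivAt_curve {γ : ℝ → Sph n} (hγ : ContMDiff 𝓘(ℝ) (𝓡 (2 * n + 1)) ∞ γ) {t : ℝ}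
    {v : TangentSpace (𝓡 (2 * n + 1)) (γ t)}
    (h : HasDerivAt (fun s => (γ s : Cn n)) (dIncl n (γ t) v) t) :
    HasMFDerivAt 𝓘(ℝ) (𝓡 (2 * n + 1)) γ t
      ((1 : ℝ →L[ℝ] ℝ).smulRight (M₂ := EuclideanSpace ℝ (Fin (2 * n + 1))) v) := by
  have hm := (hγ t).mdifferentiableAt (by simp)
  have h1 : HasD 𝓘(ℝ) (fun s => (γ s : Cn n)) t (1 : ℝ) (dIncl n (γ t) v) := by
    refine ⟨h.differentiableAt.mdifferentiableAt, ?_⟩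
    have := h.hasFDerivAt.hasMFDerivAt.mfderiv
    exact (congrArg (fun L => L (1 : ℝ)) this).trans (one_smul ℝ _)
  have h2 := dIncl_injective _ ((hasD_coe_comp hm (1 : ℝ)).unique h1)
  refine hm.hasMFDerivAt.congr_mfderiv ?_
  ext1
  exact h2.trans (one_smul ℝ v).symm

/-- The factor `s` also covers the flow of `-T`, needed for isometries that reverse `T`. -/
theorem isMIntegralCurve_torus (s : ℝ) (x : Sph n) :
    IsMIntegralCurve (fun t => torus (s * a * t) (s * t) x) (fun y => s • Tfield n a y) := by
  intro t
  refine hasMFDerivAt_curve (contMDiff_torus_line (s * a) s x) ?_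
  refine (hasDerivAt_torusRot_line (s * a) s (x : Cn n) t).congr_deriv ?_
  rw [map_smul, dIncl_Tfield, Tvec, defo, ← Complex.coe_smul]
  change _ = (s : ℂ) • I • (torusRot (s * a * t) (s * t) (x : Cn n) +
    ((a : ℂ) * torusRot (s * a * t) (s * t) (x : Cn n) 0) • e₀ n)
  push_cast
  module

/-- A period `P` would give `e^{iP} = 1` and `e^{iaP} = 1`, so `P` and `aP` would be integer
multiples of `2π` and `a` would be rational. -/
theorem isIrregular_Tfield (hn : 1 ≤ n) (ha : Irrational a) : IsIrregular (Tfield n a) := by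
  have hq : ∑ i, ‖(Pi.single ⟨0, hn⟩ 1 : Fin n → ℂ) i‖ ^ 2 = 1 := by
    rw [Finset.sum_eq_single ⟨0, hn⟩] <;> simp +contextual
  -- At `rho = 1/2` both components are nonzero, so both phases can be read off.
  set x : Sph n := ⟨joinPt 1 (Pi.single ⟨0, hn⟩ 1) (1 / 2),
    joinPt_mem norm_one hq (by norm_num) (by norm_num)⟩ with hx
  refine ⟨fun t => torus (1 * a * t) (1 * t) x, ?_, ?_⟩
  · have := isMIntegralCurve_torus (a := a) 1 x
    simpa only [one_smul] using this
  rintro ⟨P, hP, hper⟩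
  have h := hper 0
  simp only [zero_add, mul_zero, torus_zero, one_mul] at h
  have hv : torusRot (a * P) P (x : Cn n) = x := congrArg Subtype.val h
  have h0 := torusRot_apply_zero (a * P) P (x : Cn n)
  have h1 := torusRot_apply_succ (a * P) P (x : Cn n) ⟨0, hn⟩
  rw [hv] at h0 h1
  have x0 : (x : Cn n) 0 ≠ 0 := by
    simp [hx, joinPt]
  have x1 : (x : Cn n) (Fin.succ ⟨0, hn⟩) ≠ 0 := by
    change ((√(1 - 1 / 2) : ℝ) : ℂ) * (Pi.single ⟨0, hn⟩ 1 : Fin n → ℂ) ⟨0, hn⟩ ≠ 0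
    rw [Pi.single_eq_same, mul_one, ofReal_ne_zero]
    exact Real.sqrt_ne_zero'.2 (by norm_num)
  have e1 := mul_right_cancel₀ x1 ((one_mul _).trans h1)
  rw [← e1, one_mul] at h0
  have e0 := mul_right_cancel₀ x0 ((one_mul _).trans h0)
  obtain ⟨k, hk⟩ := exp_eq_one_iff.1 e1.symm
  obtain ⟨l, hl⟩ := exp_eq_one_iff.1 e0.symm
  have hk' : P = k * (2 * Real.pi) := by
    have := congrArg Complex.im hk
    simpa using this
  have hl' : a * P = l * (2 * Real.pi) := by
    have := congrArg Complex.im hl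
    simpa using this
  have hk0 : (k : ℝ) ≠ 0 := by
    intro h
    rw [hk', h, zero_mul] at hP
    exact lt_irrefl _ hP
  refine ha ⟨(l : ℚ) / k, ?_⟩
  push_cast
  rw [div_eq_iff hk0]
  have hpi : (2 * Real.pi) ≠ 0 := by positivity
  rw [hk', ← mul_assoc] at hl'
  exact (mul_right_cancel₀ hpi hl').symm

end TorusFlow

/-! ### Isometries preserve `rho` at generic points -/

section Isometries

open Complex ComplexConjugate VectorField

variable {n : ℕ} {a : ℝ} {φ : Sph n ≃ₘ^∞⟮𝓡 (2 * n + 1), 𝓡 (2 * n + 1)⟯ Sph n}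

theorem metricForm_Tvec_left (ha : 0 < a) (x : Sph n) (w : Cn n) :
    metricForm a x (Tvec a (x : Cn n)) w = ctForm a x w := by
  rw [metricForm, ctForm_Tvec ha, proj_Tvec ha, inner_zero_left, mul_zero, one_mul, add_zero]

/-- This function separates the levels of `rho`, since `r ↦ r / (1 + ar)` is injective for `r ≥ 0`.
-/
theorem defMetric_Tfield_Tone (ha : 0 < a) (x : Sph n) :
    (defMetric n ha).inner x (Tfield n a x) (T₁ n x) = rho (x : Cn n) / conf a (x : Cn n) := by
  rw [defMetric_inner, dIncl_Tfield, metricForm_Tvec_left ha, dIncl_Tone, ctForm, inner_smul_right,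
    inner_e₀_right, mul_assoc, mul_comm ((x : Cn n) 0), ← ofReal_rho]
  simp

theorem hasMFDerivAt_torus_Tone (s : ℝ) (x : Sph n) :
    HasMFDerivAt 𝓘(ℝ) (𝓡 (2 * n + 1)) (fun t => torus (s * t) (0 * t) x) 0
      ((1 : ℝ →L[ℝ] ℝ).smulRight (M₂ := EuclideanSpace ℝ (Fin (2 * n + 1)))
        (s • T₁ n x)) := by
  have hx : torus (s * 0) (0 * 0) x = x := by simp only [mul_zero, torus_zero]
  suffices h : HasMFDerivAt 𝓘(ℝ) (𝓡 (2 * n + 1)) (fun t => torus (s * t) (0 * t) x) 0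
      ((1 : ℝ →L[ℝ] ℝ).smulRight (M₂ := EuclideanSpace ℝ (Fin (2 * n + 1)))
        (s • T₁ n (torus (s * 0) (0 * 0) x))) by
    rwa [hx] at h
  refine hasMFDerivAt_curve (contMDiff_torus_line s 0 x) ?_
  refine (hasDerivAt_torusRot_line s 0 (x : Cn n) 0).congr_deriv ?_
  rw [map_smul, dIncl_Tone, ← Complex.coe_smul]
  change _ = (s : ℂ) • (I * torusRot (s * 0) (0 * 0) (x : Cn n) 0) • e₀ n
  push_cast
  module

/-- An isometry maps `T` to plus or minus `T` along the flow line of a generic point. -/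
theorem exists_sign (ha : 0 < a) (hφ : PreservesMetric (defMetric n ha) φ) {x : Sph n}
    (hx : x ∈ genericSet n a) : ∃ ε : ℝ, ε ^ 2 = 1 ∧ ∀ t : ℝ,
      mfderiv (𝓡 (2 * n + 1)) (𝓡 (2 * n + 1)) φ (torus (1 * a * t) (1 * t) x)
          (Tfield n a (torus (1 * a * t) (1 * t) x)) =
        ε • Tfield n a (φ (torus (1 * a * t) (1 * t) x)) := by
  set ξ := mpullback (𝓡 (2 * n + 1)) (𝓡 (2 * n + 1)) φ (Tfield n a) with hξ
  have hs : SmoothField ξ := smoothField_Tfield.mpullback φ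
  have hS : SasakianEquation (defMetric n ha) (lcCov n ha) ξ :=
    SasakianEquation.mpullback (hasSmoothExtensions_sphere n) (isLeviCivita_lcCov ha)
      (preservesSmooth_lcCov ha) hφ smoothField_Tfield (sasakianEquation_Tfield ha)
  -- Rigidity makes `ξ` a multiple of `T` at generic points, and unit length leaves only a sign.
  have key : ∀ y : Sph n, y ∈ genericSet n a →
      etaF ξ a y ^ 2 = 1 ∧ ξ y = etaF ξ a y • Tfield n a y := by
    intro y hy
    have hp := projF_eq_zero ha hs hS y hy.2.1 hy.2.2.1 hy.2.2.2
    have he := hat_eq (Y := ξ) (a := a) y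
    rw [hp, add_zero, Complex.coe_smul, ← dIncl_Tfield, ← map_smul] at he
    have he' := dIncl_injective y he
    refine ⟨?_, he'⟩
    have hu := inner_mpullback hφ (Tfield n a) (Tfield n a) y
    rw [← hξ, he', (isDeformedMetric_defMetric ha _).1, map_smul, map_smul,
      ContinuousLinearMap.smul_apply, (isDeformedMetric_defMetric ha _).1] at hu
    simp only [smul_eq_mul, mul_one] at hu
    rw [sq]
    linarith
  have hg : ∀ t : ℝ, torus (1 * a * t) (1 * t) x ∈ genericSet n a := fun t => by
    simp only [genericSet, Set.mem_ofPred_eq, torus, rho_torusRot]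
    exact hx
  have hc : Continuous (fun t : ℝ => etaF ξ a (torus (1 * a * t) (1 * t) x)) :=
    (contMDiff_etaF ha hs).continuous.comp (contMDiff_torus_line (1 * a) 1 x).continuous
  obtain ⟨ε, hε, h⟩ : ∃ ε : ℝ, ε ^ 2 = 1 ∧
      ∀ t : ℝ, etaF ξ a (torus (1 * a * t) (1 * t) x) = ε := by
    -- The flow preserves `rho`, so the whole flow line is generic and the continuous sign is
    -- constant on it.
    rcases isPreconnected_univ.eq_or_eq_neg_of_sq_eq hc.continuousOn
      (continuousOn_const (c := (1 : ℝ))) (fun t _ => by simpa using (key _ (hg t)).1)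
      (fun _ => one_ne_zero) with h | h
    · exact ⟨1, by norm_num, fun t => h (Set.mem_univ t)⟩
    · exact ⟨-1, by norm_num, fun t => h (Set.mem_univ t)⟩
  refine ⟨ε, hε, fun t => ?_⟩
  have h1 := (key _ (hg t)).2
  rw [h t, hξ, mpullback_eq_iff, map_smul] at h1
  rw [h1, smul_smul, ← sq, hε, one_smul]

/-- An isometry is equivariant up to sign along the flow line of a generic point. -/
theorem map_flow (ha : 0 < a) (hφ : PreservesMetric (defMetric n ha) φ) {x : Sph n}
    (hx : x ∈ genericSet n a) : ∃ ε : ℝ, ε ^ 2 = 1 ∧ ∀ t : ℝ,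
      φ (torus (a * t) t x) = torus (ε * a * t) (ε * t) (φ x) := by
  obtain ⟨ε, hε, h⟩ := exists_sign ha hφ hx
  refine ⟨ε, hε, ?_⟩
  have h1 : IsMIntegralCurve (fun t => φ (torus (1 * a * t) (1 * t) x))
      (fun y => ε • Tfield n a y) := by
    intro t
    have h2 := isMIntegralCurve_torus (a := a) 1 x t
    simp only [one_smul] at h2
    have h3 := ((φ.contMDiff (torus (1 * a * t) (1 * t) x)).mdifferentiableAt
      (by simp)).hasMFDerivAt.comp t h2
    refine h3.congr_mfderiv ?_
    ext1
    refine Eq.trans ?_ ((h t).trans (one_smul ℝ _).symm)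
    exact congrArg _ (one_smul ℝ _)
  have hv : SmoothField (fun y : Sph n => ε • Tfield n a y) := by
    exact ContMDiff.const_smul_section smoothField_Tfield
  -- Both curves are integral curves of `εT` through `φ x`, so uniqueness identifies them.
  have h4 := isMIntegralCurve_Ioo_eq_of_contMDiff_boundaryless (t₀ := 0)
    (ContMDiff.of_le hv (by simp)) h1 (isMIntegralCurve_torus ε (φ x)) (by
      simp only [mul_zero, torus_zero])
  intro t
  simpa only [one_mul] using congrFun h4 t

/-- An isometry is equivariant up to sign for the rotations of the coordinate `0`. -/
theorem map_rotation (hirr : Irrational a) (ha : 0 < a) (hφ : PreservesMetric (defMetric n ha) φ)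
    {x : Sph n} (hx : x ∈ genericSet n a) : ∃ ε : ℝ, ε ^ 2 = 1 ∧ ∀ t : ℝ,
      φ (torus t 0 x) = torus (ε * t) 0 (φ x) := by
  obtain ⟨ε, hε, h⟩ := map_flow ha hφ hx
  refine ⟨ε, hε, ?_⟩
  -- Since `ε` is an integer, `ε` times a full turn is again a whole number of turns.
  obtain ⟨m, hm⟩ : ∃ m : ℤ, ε = m := by
    rcases mul_self_eq_one_iff.1 ((sq ε).symm.trans hε) with h | h
    · exact ⟨1, by simpa using h⟩
    · exact ⟨-1, by simpa using h⟩
  -- At time `2πk` the flow of `T` rotates only the coordinate `0`, by the angle `2πka`. Modulo full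
  -- turns these angles are dense because `a` is irrational, and the desired identity is closed in
  -- `t`.
  have hd : Dense (AddSubgroup.closure {a * (2 * Real.pi), 2 * Real.pi} : Set ℝ) := by
    rw [dense_addSubgroupClosure_pair_iff, mul_div_cancel_right₀ _ (by positivity)]
    exact hirr
  have hcl : IsClosed {t : ℝ | φ (torus t 0 x) = torus (ε * t) 0 (φ x)} := by
    have c1 := φ.continuous.comp (contMDiff_torus_line 1 0 x).continuous
    have c2 := (contMDiff_torus_line ε 0 (φ x)).continuous
    simp only [one_mul, zero_mul, Function.comp_def] at c1 c2
    exact isClosed_eq c1 c2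
  have hsub : (AddSubgroup.closure {a * (2 * Real.pi), 2 * Real.pi} : Set ℝ) ⊆
      {t : ℝ | φ (torus t 0 x) = torus (ε * t) 0 (φ x)} := by
    intro t ht
    obtain ⟨k, l, rfl⟩ := AddSubgroup.mem_closure_pair.1 ht
    have e1 : torus (a * (k * (2 * Real.pi))) (k * (2 * Real.pi)) x =
        torus (a * (k * (2 * Real.pi))) 0 x := by
      simpa using torus_add_two_pi (a * (k * (2 * Real.pi))) 0 k 0 x
    have e2 : torus (a * (k * (2 * Real.pi)) + l * (2 * Real.pi)) 0 x =
        torus (a * (k * (2 * Real.pi))) 0 x := by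
      simpa using torus_add_two_pi (a * (k * (2 * Real.pi))) 0 0 l x
    have e3 : torus (ε * a * (k * (2 * Real.pi))) (ε * (k * (2 * Real.pi))) (φ x) =
        torus (ε * a * (k * (2 * Real.pi))) 0 (φ x) := by
      have := torus_add_two_pi (ε * a * (k * (2 * Real.pi))) 0 (m * k) 0 (φ x)
      simpa [← hm, mul_assoc] using this
    have e4 : torus (ε * a * (k * (2 * Real.pi)) + ε * (l * (2 * Real.pi))) 0 (φ x) =
        torus (ε * a * (k * (2 * Real.pi))) 0 (φ x) := by
      have := torus_add_two_pi (ε * a * (k * (2 * Real.pi))) 0 0 (m * l) (φ x)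
      simpa [← hm, mul_assoc] using this
    have e5 : k • (a * (2 * Real.pi)) + l • (2 * Real.pi) =
        a * (k * (2 * Real.pi)) + l * (2 * Real.pi) := by
      simp only [zsmul_eq_mul]
      ring
    rw [Set.mem_ofPred_eq, e5, e2, ← e1, h, e3, mul_add, ← mul_assoc ε a, e4]
  intro t
  exact hcl.closure_subset_iff.2 hsub (hd t)

/-- Differentiating `map_rotation` gives `dφ(T₁) = ±T₁`, and `dφ(T) = ±T` by `exists_sign`; hence
`g(T, T₁)` is preserved up to sign. -/
theorem rho_map_eq (hirr : Irrational a) (ha : 0 < a) (hφ : PreservesMetric (defMetric n ha) φ)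
    {x : Sph n} (hx : x ∈ genericSet n a) : rho (φ x : Cn n) = rho (x : Cn n) := by
  obtain ⟨ε, hε, h⟩ := map_rotation hirr ha hφ hx
  obtain ⟨σ, hσ, hT⟩ := exists_sign ha hφ hx
  have hx0 : ∀ (r s : ℝ) (y : Sph n), torus (r * 0) (s * 0) y = y := fun r s y => by
    simp only [mul_zero, torus_zero]
  have hT0 := hT 0
  rw [hx0] at hT0
  have h1 := hasMFDerivAt_torus_Tone 1 x
  have h2 := hasMFDerivAt_torus_Tone ε (φ x)
  have hφ0 : HasMFDerivAt (𝓡 (2 * n + 1)) (𝓡 (2 * n + 1)) φ (torus (1 * 0) (0 * 0) x)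
      (mfderiv (𝓡 (2 * n + 1)) (𝓡 (2 * n + 1)) φ x) := by
    rw [hx0]
    exact ((φ.contMDiff x).mdifferentiableAt (by simp)).hasMFDerivAt
  have h3 := hφ0.comp (0 : ℝ) h1
  have hfun : (φ ∘ fun t => torus (1 * t) (0 * t) x) = fun t => torus (ε * t) (0 * t) (φ x) := by
    funext t
    simp only [Function.comp_apply, one_mul, zero_mul, h]
  rw [hfun] at h3
  have h4 := congrArg (fun L : ℝ →L[ℝ] EuclideanSpace ℝ (Fin (2 * n + 1)) => L 1)
    (h3.mfderiv.symm.trans h2.mfderiv)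
  have h5 : mfderiv (𝓡 (2 * n + 1)) (𝓡 (2 * n + 1)) φ x (T₁ n x) = ε • T₁ n (φ x) := by
    have e1 := congrArg (mfderiv (𝓡 (2 * n + 1)) (𝓡 (2 * n + 1)) φ x)
      ((one_smul ℝ _).trans (one_smul ℝ (T₁ n x)))
    exact e1.symm.trans (h4.trans (one_smul ℝ (ε • T₁ n (φ x))))
  have h6 := hφ x (Tfield n a x) (T₁ n x)
  rw [h5, hT0, map_smul, map_smul, ContinuousLinearMap.smul_apply, defMetric_Tfield_Tone,
    defMetric_Tfield_Tone] at h6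
  have hp := conf_pos ha (x : Cn n)
  have hp' := conf_pos ha (φ x : Cn n)
  have r0 : 0 ≤ rho (x : Cn n) := normSq_nonneg _
  have r0' : 0 ≤ rho (φ x : Cn n) := normSq_nonneg _
  -- Squaring removes both signs and nonnegativity then removes the squares; after
  -- cross-multiplication the terms `a rho(x) rho(φ x)` cancel.
  have h7 : (rho (φ x : Cn n) / conf a (φ x : Cn n)) ^ 2 = (rho (x : Cn n) / conf a (x : Cn n)) ^ 2 := by
    rw [← h6]
    simp only [smul_eq_mul, mul_pow, hε, hσ, one_mul]
  rw [sq_eq_sq₀ (by positivity) (by positivity), div_eq_div_iff hp'.ne' hp.ne', conf, conf] at h7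
  linarith

theorem isometryOrbit_eq_level (hn : 1 ≤ n) (hirr : Irrational a) (ha : 0 < a) {x : Sph n}
    (hx : x ∈ genericSet n a) : isometryOrbit (defMetric n ha) x =
      {y : Sph n | rho (y : Cn n) = rho (x : Cn n)} := by
  refine Set.Subset.antisymm ?_ ?_
  · rintro _ ⟨φ, hφ, rfl⟩
    exact rho_map_eq hirr ha hφ hx
  · rw [← orbit_eq_level hn]
    exact orbit_subset_isometryOrbit ha x

end Isometries

end

theorem mainTheorem6 (n : ℕ) (hn : 1 ≤ n) (a : ℝ) (ha : Irrational a) (ha0 : 0 < a) (ha1 : a < 1) :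
    ∃ g : RMetric (𝓡 (2 * n + 1)) (Sph n),
      IsDeformedMetric n a g ∧
      (∀ g' : RMetric (𝓡 (2 * n + 1)) (Sph n), IsDeformedMetric n a g' → g' = g) ∧
      IsSasakian g (Tfield n a) ∧
      IsIrregular (Tfield n a) ∧
      (∀ h : Circle × Matrix.unitaryGroup (Fin n) ℂ,
        ContMDiff (𝓡 (2 * n + 1)) (𝓡 (2 * n + 1)) ∞ (fun x : Sph n => h • x) ∧
        PreservesMetric g (fun x : Sph n => h • x)) ∧
      GenericOrbitsHaveCodim (𝓡 (2 * n + 1))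
        (MulAction.orbit (Circle × Matrix.unitaryGroup (Fin n) ℂ) : Sph n → Set (Sph n)) 1 ∧
      HasCohomogeneity g 1 := by
  refine ⟨defMetric n ha0, isDeformedMetric_defMetric ha0,
    fun g' h' => (isDeformedMetric_defMetric ha0).unique ha0 h', isSasakian_Tfield ha0,
    isIrregular_Tfield hn ha, fun h => ⟨contMDiff_smul_sphere h, preservesMetric_smul h ha0⟩,
    ⟨genericSet n a, isOpen_genericSet, dense_genericSet hn ha0, fun x hx => ?_⟩,
    ⟨genericSet n a, isOpen_genericSet, dense_genericSet hn ha0, fun x hx => ?_⟩⟩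
  · rw [orbit_eq_level hn]
    exact isSubmanifoldOfCodim_level x hx.1 hx.2.1
  · rw [isometryOrbit_eq_level hn ha ha0 hx]
    exact isSubmanifoldOfCodim_level x hx.1 hx.2.1
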